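/- Theorem 1.2. Let $k$ be an algebraically closed field of characteristic $p>0$. Let $L$ be a restricted Lie algebra over $k$, or, if $p\neq 2$, a restricted Lie superalgebra $L=L_{\bar 0}\oplus L_{\bar 1}$ over $k$, of arbitrary dimension. (A Lie superalgebra satisfies the graded skew symmetry and Jacobi identities and $[x,[x,x]]=0$ for odd $x$; it is restricted if $L_{\bar 0}$ is a restricted Lie algebra, with $p$-th power map $x\mapsto x^{[p]}$, and $(\operatorname{ad} x)^p=\operatorname{ad}(x^{[p]})$ on $L$ for all $x\in L_{\bar 0}$.) Let $C(L)=\{x\in L: [x,y]=0 \text{ for all } y\in L\}$; in the super case assume $C(L)\subseteq L_{\bar 0}$. Let $\{e_i\mid i\in I\}$ be a basis of $L$ such that $\{e_j\mid j\in J\}$, $J\subseteq I$, is a basis of $C(L)$; in the super case let moreover $I=I_0\sqcup I_1$, where $\{e_i\mid i\in I_0\}$ is a basis of $L_{\bar 0}$ and $\{e_i\mid i\in I_1\}$ is a basis of $L_{\bar 1}$, so that $J\subseteq I_0$. Let $\mathfrak g$ be $L[x]=L\otimes k[x]$, and put $\mathbb I=\mathbb N$, or let $\mathfrak g$ be $L(x)=L\otimes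 k[x,x^{-1}]$, and put $\mathbb I=\mathbb Z$; the bracket is $[e\otimes x^r,f\otimes x^s]=[e,f]\otimes x^{r+s}$, and in the super case $e\otimes x^r$ has the parity of $e$. Write $e_{ir}=e_i\otimes x^r$. Then $\mathfrak g$ has exactly one structure of a restricted Lie (super)algebra with $e_{ir}^{[p]}=e_i^{[p]}\otimes x^{rp}$ for all $r\in\mathbb I$ and all $i\in I$ (all $i\in I_0$ in the super case). Give $\mathfrak g$ this structure. Let $Z(\mathfrak g)=\{z\in U(\mathfrak g): [z,u]=0 \text{ for all } u\in U(\mathfrak g)\}$ be the center of the universal enveloping (super)algebra, where $[z,u]=zu-uz$, respectively $[z,u]=zu-(-1)^{|z||u|}uz$ for homogeneous $z,u$, extended bilinearly. Let $Z_p(\mathfrak g)$ be the subalgebra of $U(\mathfrak g)$ generated by all $y^p-y^{[p]}$ with $y\in\mathfrak g$ ($y\in\mathfrak g_{\bar 0}$ in the super case). Then $Z(\mathfrak g)$ is the subalgebra of $U(\mathfrak g)$ generated by $\{e_{jr}\mid j\in J,\ r\in\mathbb I\}$ together with $Z_p(\mathfrak g)$. Moreover: (1) if $L$ is a Lie algebra,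 then $Z(\mathfrak g)$ is freely generated, as a commutative $k$-algebra, by $$\{e_{jr}\mid j\in J,\ r\in\mathbb I\}\cup\{e_{ir}^p-e_{ir}^{[p]}\mid i\in I\setminus J,\ r\in\mathbb I\};$$ (2) if $L$ is a Lie superalgebra, then $Z(\mathfrak g)$ is freely generated, as a commutative $k$-algebra, by $$\{e_{jr}\mid j\in J,\ r\in\mathbb I\}\cup\{e_{ir}^p-e_{ir}^{[p]}\mid i\in I_0\setminus J,\ r\in\mathbb I\}.$$ -/

import Mathlib

open scoped TensorProduct Polynomial LaurentPolynomial

noncomputable section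

namespace LieCenter

/-! ### Restricted Lie algebras -/

section Restricted

variable {k : Type*} [Field k]

/-- The term `s_i(x, y)` of Jacobson's formula: `i * s_i(x, y)` is the coefficient of `t ^ (i - 1)`
in `(ad (t x + y)) ^ (p - 1) (x)`. Here `ad` is any linear map from `L` to the endomorphisms
of `V` (in use: the adjoint map of a Lie algebra or of a Lie superalgebra). -/
def jacobsonTerm {L : Type*} [AddCommGroup L] [Module k L] (ad : L →ₗ[k] Module.End k L)
    (p i : ℕ) (x y : L) : L :=
  (i : k)⁻¹ • ((Polynomial.X * Polynomial.C (ad x) + Polynomial.C (ad y)) ^ (p - 1)).coeff (i - 1) x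

/-- `P` is a `p`-th power map `x ↦ x^[p]`, making the Lie algebra `L` a restricted Lie algebra. -/
structure IsPMap (k : Type*) [Field k] {L : Type*} [LieRing L] [LieAlgebra k L]
    (p : ℕ) (P : L → L) : Prop where
  ad_map : ∀ x : L, LieAlgebra.ad k L (P x) = LieAlgebra.ad k L x ^ p
  map_smul : ∀ (c : k) (x : L), P (c • x) = c ^ p • P x
  map_add : ∀ x y : L, P (x + y) = P x + P y +
    ∑ i ∈ Finset.Ico 1 p, jacobsonTerm (LieAlgebra.ad k L : L →ₗ[k] Module.End k L) p i x y

end Restricted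

/-! ### Lie superalgebras -/

/-- A Lie superalgebra over `k`, in which `2` is meant to be invertible: a `ZMod 2`-graded module
`L = gr 0 ⊕ gr 1` with a bilinear bracket that respects the grading and satisfies the graded
skew symmetry and the graded Jacobi identity. The last axiom follows from the others when `3` is
invertible and is part of the usual definition in characteristic `3`. -/
class LieSuperalgebra (k : Type*) (L : Type*) [CommRing k] [AddCommGroup L] [Module k L] where
  gr : ZMod 2 → Submodule k L
  isCompl : IsCompl (gr 0) (gr 1)
  bracket : L →ₗ[k] L →ₗ[k] L
  bracket_mem : ∀ {a b : ZMod 2} {x y : L}, x ∈ gr a → y ∈ gr b → bracket x y ∈ gr (a + b)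
  bracket_skew : ∀ {a b : ZMod 2} {x y : L}, x ∈ gr a → y ∈ gr b →
    bracket x y = -((-1 : ℤˣ) ^ (a * b) • bracket y x)
  bracket_jacobi : ∀ {a b c : ZMod 2} {x y z : L}, x ∈ gr a → y ∈ gr b → z ∈ gr c →
    bracket x (bracket y z) =
      bracket (bracket x y) z + (-1 : ℤˣ) ^ (a * b) • bracket y (bracket x z)
  bracket_cube : ∀ {x : L}, x ∈ gr 1 → bracket x (bracket x x) = 0

namespace LieSuperalgebra

section Basic

variable (k : Type*) (L : Type*) [CommRing k] [AddCommGroup L] [Module k L] [LieSuperalgebra k L]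

/-- The adjoint map `x ↦ [x, -]`. -/
abbrev ad : L →ₗ[k] Module.End k L := bracket

/-- The even part of `L`. -/
abbrev even : Submodule k L := gr 0

/-- The center `C(L) = {x | [x, y] = 0 for all y}` of a Lie superalgebra. -/
def center : Submodule k L := LinearMap.ker (ad k L)

end Basic

/-- `P : L_0 → L_0` is a `p`-th power map `x ↦ x^[p]`, making `L` a restricted Lie superalgebra:
the even part is a restricted Lie algebra and `L` (hence also the odd part) is a restricted module
over it by the adjoint action. -/
structure IsPMap (k : Type*) [Field k] {L : Type*} [AddCommGroup L] [Module k L]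
    [LieSuperalgebra k L] (p : ℕ) (P : even k L → even k L) : Prop where
  ad_map : ∀ x : even k L, ad k L (P x : L) = ad k L (x : L) ^ p
  map_smul : ∀ (c : k) (x : even k L), P (c • x) = c ^ p • P x
  map_add : ∀ x y : even k L, (P (x + y) : L) = P x + P y +
    ∑ i ∈ Finset.Ico 1 p, jacobsonTerm (ad k L) p i (x : L) (y : L)

/-! ### Extension of scalars: the Lie superalgebra `A ⊗ L` -/

section Tensor

variable (k : Type*) (A : Type*) (L : Type*) [CommRing k] [CommRing A] [Algebra k A]
  [AddCommGroup L] [Module k L] [LieSuperalgebra k L]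

/-- The homogeneous part `A ⊗ L_a` of `A ⊗ L`. -/
def tensorGr (a : ZMod 2) : Submodule k (A ⊗[k] L) :=
  LinearMap.range (LinearMap.lTensor A (gr a : Submodule k L).subtype)

/-- The bracket `[a ⊗ x, b ⊗ y] = a b ⊗ [x, y]` on `A ⊗ L`. -/
def tensorBracket : (A ⊗[k] L) →ₗ[k] (A ⊗[k] L) →ₗ[k] (A ⊗[k] L) :=
  TensorProduct.map₂ (LinearMap.mul k A) bracket

variable {k A L}

@[simp]
theorem tensorBracket_tmul (a b : A) (x y : L) :
    tensorBracket k A L (a ⊗ₜ x) (b ⊗ₜ y) = (a * b) ⊗ₜ bracket (k := k) x y := rfl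

theorem tmul_mem_tensorGr {d : ZMod 2} (a : A) {x : L} (hx : x ∈ (gr d : Submodule k L)) :
    a ⊗ₜ[k] x ∈ tensorGr k A L d :=
  ⟨a ⊗ₜ ⟨x, hx⟩, rfl⟩

theorem tensorGr_induction {d : ZMod 2} {C : A ⊗[k] L → Prop} (h0 : C 0)
    (ht : ∀ (a : A) (x : L), x ∈ (gr d : Submodule k L) → C (a ⊗ₜ x))
    (ha : ∀ u v, u ∈ tensorGr k A L d → v ∈ tensorGr k A L d → C u → C v → C (u + v))
    {z : A ⊗[k] L} (hz : z ∈ tensorGr k A L d) : C z := by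
  obtain ⟨t, rfl⟩ := hz
  induction t using TensorProduct.induction_on with
  | zero => simpa using h0
  | tmul a x => exact ht a x x.2
  | add u v hu hv => rw [map_add]; exact ha _ _ ⟨u, rfl⟩ ⟨v, rfl⟩ hu hv

theorem tensor_units_smul {k A L : Type*} [CommRing k] [CommRing A] [Algebra k A]
    [AddCommGroup L] [Module k L] (s : ℤˣ) (a : A) (x : L) : s • (a ⊗ₜ[k] x) = a ⊗ₜ[k] (s • x) := by
  rcases Int.units_eq_one_or s with rfl | rfl <;> simp [TensorProduct.tmul_neg]

theorem tensorBracket_mem {a b : ZMod 2} {x y : A ⊗[k] L} (hx : x ∈ tensorGr k A L a)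
    (hy : y ∈ tensorGr k A L b) : tensorBracket k A L x y ∈ tensorGr k A L (a + b) := by
  refine tensorGr_induction (C := fun x => tensorBracket k A L x y ∈ _) (by simp) ?_ ?_ hx
  · intro r u hu
    refine tensorGr_induction (C := fun y => tensorBracket k A L _ y ∈ _) (by simp) ?_ ?_ hy
    · intro s v hv
      exact tmul_mem_tensorGr _ (bracket_mem hu hv)
    · intro v w _ _ hv hw
      rw [map_add]; exact add_mem hv hw
  · intro v w _ _ hv hw
    rw [map_add, LinearMap.add_apply]; exact add_mem hv hw

theorem tensorBracket_skew {a b : ZMod 2} {x y : A ⊗[k] L} (hx : x ∈ tensorGr k A L a)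
    (hy : y ∈ tensorGr k A L b) :
    tensorBracket k A L x y = -((-1 : ℤˣ) ^ (a * b) • tensorBracket k A L y x) := by
  refine tensorGr_induction
    (C := fun x => tensorBracket k A L x y = -((-1 : ℤˣ) ^ (a * b) • tensorBracket k A L y x))
    (by simp) ?_ ?_ hx
  · intro r u hu
    refine tensorGr_induction (C := fun y => tensorBracket k A L (r ⊗ₜ u) y =
      -((-1 : ℤˣ) ^ (a * b) • tensorBracket k A L y (r ⊗ₜ u))) (by simp) ?_ ?_ hy
    · intro s v hv
      rw [tensorBracket_tmul, tensorBracket_tmul, tensor_units_smul, bracket_skew hu hv,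
        TensorProduct.tmul_neg, mul_comm]
    · intro v w _ _ hv hw
      rw [map_add, map_add, LinearMap.add_apply, hv, hw, smul_add, neg_add]
  · intro v w _ _ hv hw
    rw [map_add, map_add, LinearMap.add_apply, hv, hw, smul_add, neg_add]

theorem tensorBracket_jacobi {a b c : ZMod 2} {x y z : A ⊗[k] L} (hx : x ∈ tensorGr k A L a)
    (hy : y ∈ tensorGr k A L b) (hz : z ∈ tensorGr k A L c) :
    tensorBracket k A L x (tensorBracket k A L y z) =
      tensorBracket k A L (tensorBracket k A L x y) z +
        (-1 : ℤˣ) ^ (a * b) • tensorBracket k A L y (tensorBracket k A L x z) := by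
  refine tensorGr_induction (C := fun x => tensorBracket k A L x (tensorBracket k A L y z) =
      tensorBracket k A L (tensorBracket k A L x y) z +
        (-1 : ℤˣ) ^ (a * b) • tensorBracket k A L y (tensorBracket k A L x z))
    (by simp) ?_ ?_ hx
  · intro r u hu
    refine tensorGr_induction (C := fun y => tensorBracket k A L (r ⊗ₜ u) (tensorBracket k A L y z) =
      tensorBracket k A L (tensorBracket k A L (r ⊗ₜ u) y) z +
        (-1 : ℤˣ) ^ (a * b) • tensorBracket k A L y (tensorBracket k A L (r ⊗ₜ u) z))
      (by simp) ?_ ?_ hy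
    · intro s v hv
      refine tensorGr_induction
        (C := fun z => tensorBracket k A L (r ⊗ₜ u) (tensorBracket k A L (s ⊗ₜ v) z) =
        tensorBracket k A L (tensorBracket k A L (r ⊗ₜ u) (s ⊗ₜ v)) z +
        (-1 : ℤˣ) ^ (a * b) • tensorBracket k A L (s ⊗ₜ v) (tensorBracket k A L (r ⊗ₜ u) z))
        (by simp) ?_ ?_ hz
      · intro t w hw
        simp only [tensorBracket_tmul, tensor_units_smul]
        rw [bracket_jacobi hu hv hw, TensorProduct.tmul_add, ← mul_assoc, mul_left_comm s r t,
          ← mul_assoc]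
      · intro w w' _ _ hw hw'
        simp only [map_add, hw, hw', smul_add]
        abel
    · intro w w' _ _ hw hw'
      simp only [map_add, LinearMap.add_apply, hw, hw', smul_add]
      abel
  · intro w w' _ _ hw hw'
    simp only [map_add, LinearMap.add_apply, hw, hw', smul_add]
    abel

theorem tensorBracket_cube {x : A ⊗[k] L} (hx : x ∈ tensorGr k A L 1) :
    tensorBracket k A L x (tensorBracket k A L x x) = 0 := by
  refine tensorGr_induction
    (C := fun x => tensorBracket k A L x (tensorBracket k A L x x) = 0) (by simp) ?_ ?_ hx
  · intro r u hu
    simp [bracket_cube hu]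
  · intro u v hu hv hu' hv'
    have key : ∀ {z w : A ⊗[k] L}, z ∈ tensorGr k A L 1 → w ∈ tensorGr k A L 1 →
        tensorBracket k A L w (tensorBracket k A L z z) +
          (tensorBracket k A L z (tensorBracket k A L z w) +
            tensorBracket k A L z (tensorBracket k A L w z)) = 0 := by
      intro z w hz hw
      have h1 := tensorBracket_jacobi hz hz hw
      have h2 := tensorBracket_skew hw hz
      have h3 := tensorBracket_skew (tensorBracket_mem hz hz) hw
      have e0 : (1 + 1 : ZMod 2) = 0 := by decide
      simp only [mul_one, uzpow_one, e0, uzpow_zero, one_smul,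
        Units.neg_smul, neg_neg] at h1 h2 h3
      rw [h2]
      rw [h3] at h1
      nth_rewrite 1 [h1]
      abel
    have h1 := key hu hv
    have h2 := key hv hu
    simp only [map_add, LinearMap.add_apply] at *
    rw [hu', hv']
    have h3 := congrArg₂ (· + ·) h1 h2
    simp only [add_zero] at h3
    refine Eq.trans ?_ h3
    abel

theorem tensorGr_isCompl : IsCompl (tensorGr k A L 0) (tensorGr k A L 1) := by
  have h := isCompl (k := k) (L := L)
  refine IsCompl.of_le ?_ ?_
  · rintro z ⟨h0, h1⟩
    set π : L →ₗ[k] L := Submodule.projection _ _ h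
    have e0 : LinearMap.lTensor A π z = z := by
      refine tensorGr_induction (C := fun z => LinearMap.lTensor A π z = z) (by simp) ?_ ?_ h0
      · intro a x hx
        rw [LinearMap.lTensor_tmul, Submodule.projection_apply_left h ⟨x, hx⟩]
      · intro u v _ _ hu hv
        rw [map_add, hu, hv]
    have e1 : LinearMap.lTensor A π z = 0 := by
      refine tensorGr_induction (C := fun z => LinearMap.lTensor A π z = 0) (by simp) ?_ ?_ h1
      · intro a x hx
        rw [LinearMap.lTensor_tmul, (Submodule.projection_apply_eq_zero_iff h).2 hx,
          TensorProduct.tmul_zero]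
      · intro u v _ _ hu hv
        rw [map_add, hu, hv, add_zero]
    exact e0.symm.trans e1
  · intro z _
    induction z using TensorProduct.induction_on with
    | zero => exact zero_mem _
    | tmul a x =>
      obtain ⟨y, hy, w, hw, rfl⟩ := Submodule.mem_sup.1 (h.sup_eq_top ▸ Submodule.mem_top (x := x))
      rw [TensorProduct.tmul_add]
      exact Submodule.add_mem_sup (tmul_mem_tensorGr a hy) (tmul_mem_tensorGr a hw)
    | add u v hu hv => exact add_mem (hu trivial) (hv trivial)

/-- `A ⊗ L` as a Lie superalgebra over `k`. For `A = k[X]` this is the current superalgebra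
`L[x]`, for `A = k[T;T⁻¹]` the loop superalgebra `L(x)`. -/
instance tensor : LieSuperalgebra k (A ⊗[k] L) where
  gr := tensorGr k A L
  isCompl := tensorGr_isCompl
  bracket := tensorBracket k A L
  bracket_mem := tensorBracket_mem
  bracket_skew := tensorBracket_skew
  bracket_jacobi := tensorBracket_jacobi
  bracket_cube := tensorBracket_cube

/-- The even element `a ⊗ x` of `A ⊗ L`, for `x` even. -/
def evenTmul (a : A) (x : even k L) : even k (A ⊗[k] L) :=
  ⟨a ⊗ₜ (x : L), tmul_mem_tensorGr a x.2⟩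

end Tensor

/-! ### The universal enveloping superalgebra and its center -/

section Enveloping

variable (k : Type*) (L : Type*) [CommRing k] [AddCommGroup L] [Module k L] [LieSuperalgebra k L]

/-- The relations `x y - (-1)^(|x||y|) y x = [x, y]`, for `x` and `y` homogeneous. -/
inductive Rel : TensorAlgebra k L → TensorAlgebra k L → Prop
  | of {a b : ZMod 2} {x y : L} (hx : x ∈ (gr a : Submodule k L)) (hy : y ∈ (gr b : Submodule k L)) :
      Rel (TensorAlgebra.ι k x * TensorAlgebra.ι k y -
        (-1 : ℤˣ) ^ (a * b) • (TensorAlgebra.ι k y * TensorAlgebra.ι k x))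
        (TensorAlgebra.ι k (bracket (k := k) x y))

/-- The universal enveloping algebra `U(L)` of a Lie superalgebra. -/
def Enveloping : Type _ := RingQuot (Rel k L)

instance : Ring (Enveloping k L) := inferInstanceAs (Ring (RingQuot (Rel k L)))

instance : Algebra k (Enveloping k L) := inferInstanceAs (Algebra k (RingQuot (Rel k L)))

/-- The canonical map `L → U(L)`. -/
def ι : L →ₗ[k] Enveloping k L :=
  (RingQuot.mkAlgHom k (Rel k L)).toLinearMap ∘ₗ TensorAlgebra.ι k

/-- The part `U(L)_a` of parity `a`: the span of the products `x_1 ⋯ x_n` of homogeneous elements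
of `L` whose parities add up to `a`. -/
def envGr (a : ZMod 2) : Submodule k (Enveloping k L) :=
  Submodule.span k {u | ∃ l : List (Σ b : ZMod 2, (gr b : Submodule k L)),
    (l.map Sigma.fst).sum = a ∧ (l.map fun x => ι k L (x.2 : L)).prod = u}

/-- The homogeneous elements `z` of parity `a` with `z u - (-1)^(|z||u|) u z = 0` for every
homogeneous `u`. -/
def superCentral (a : ZMod 2) : Submodule k (Enveloping k L) where
  carrier := {z | z ∈ envGr k L a ∧ ∀ b : ZMod 2, ∀ u ∈ envGr k L b,
    z * u - (-1 : ℤˣ) ^ (a * b) • (u * z) = 0}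
  zero_mem' := ⟨zero_mem _, by simp⟩
  add_mem' := by
    rintro z w ⟨hz, hz'⟩ ⟨hw, hw'⟩
    refine ⟨add_mem hz hw, fun b u hu => ?_⟩
    have h1 := hz' b u hu
    have h2 := hw' b u hu
    rw [sub_eq_zero] at *
    rw [add_mul, mul_add, smul_add, h1, h2]
  smul_mem' := by
    rintro c z ⟨hz, hz'⟩
    refine ⟨Submodule.smul_mem _ c hz, fun b u hu => ?_⟩
    have h1 := hz' b u hu
    rw [sub_eq_zero] at *
    rw [smul_mul_assoc, mul_smul_comm, h1, smul_comm]

variable {k L}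

theorem one_mem_envGr : (1 : Enveloping k L) ∈ envGr k L 0 :=
  Submodule.subset_span ⟨[], by simp, by simp⟩

theorem mul_mem_envGr {a b : ZMod 2} {u v : Enveloping k L} (hu : u ∈ envGr k L a)
    (hv : v ∈ envGr k L b) : u * v ∈ envGr k L (a + b) := by
  have h := Submodule.mul_mem_mul hu hv
  rw [envGr, envGr, Submodule.span_mul_span] at h
  refine Submodule.span_mono ?_ h
  rintro _ ⟨_, ⟨l, hl, rfl⟩, _, ⟨m, hm, rfl⟩, rfl⟩
  exact ⟨l ++ m, by simp [hl, hm], by simp⟩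

theorem one_mem_superCentral : (1 : Enveloping k L) ∈ superCentral k L 0 :=
  ⟨one_mem_envGr, by simp⟩

theorem mul_mem_superCentral {a b : ZMod 2} {z w : Enveloping k L} (hz : z ∈ superCentral k L a)
    (hw : w ∈ superCentral k L b) : z * w ∈ superCentral k L (a + b) := by
  refine ⟨mul_mem_envGr hz.1 hw.1, fun c u hu => ?_⟩
  have h1 := sub_eq_zero.1 (hz.2 c u hu)
  have h2 := sub_eq_zero.1 (hw.2 c u hu)
  rw [sub_eq_zero, mul_assoc, h2, mul_smul_comm, ← mul_assoc, h1, smul_mul_assoc, smul_smul,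
    mul_assoc, add_mul, uzpow_add, mul_comm ((-1 : ℤˣ) ^ (b * c))]

variable (k L)

/-- The center `Z(L) = {z | [z, u] = 0 for all u}` of `U(L)`, for the super commutator: the sums
`z = z_0 + z_1` of an even and an odd element that super commute with every homogeneous element. -/
def envCenter : Subalgebra k (Enveloping k L) where
  carrier := {z | ∃ z₀ ∈ superCentral k L 0, ∃ z₁ ∈ superCentral k L 1, z = z₀ + z₁}
  mul_mem' := by
    rintro _ _ ⟨z₀, h₀, z₁, h₁, rfl⟩ ⟨w₀, h₀', w₁, h₁', rfl⟩
    have e : (1 + 1 : ZMod 2) = 0 := by decide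
    have h00 := mul_mem_superCentral h₀ h₀'
    have h01 := mul_mem_superCentral h₀ h₁'
    have h10 := mul_mem_superCentral h₁ h₀'
    have h11 := mul_mem_superCentral h₁ h₁'
    rw [add_zero] at h00 h10
    rw [zero_add] at h01
    rw [e] at h11
    refine ⟨z₀ * w₀ + z₁ * w₁, add_mem h00 h11, z₀ * w₁ + z₁ * w₀, add_mem h01 h10, ?_⟩
    rw [add_mul, mul_add, mul_add]
    abel
  add_mem' := by
    rintro _ _ ⟨z₀, h₀, z₁, h₁, rfl⟩ ⟨w₀, h₀', w₁, h₁', rfl⟩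
    exact ⟨_, add_mem h₀ h₀', _, add_mem h₁ h₁', by abel⟩
  algebraMap_mem' c := ⟨algebraMap k _ c, by
    rw [Algebra.algebraMap_eq_smul_one]
    exact Submodule.smul_mem _ c one_mem_superCentral, 0, zero_mem _, by simp⟩

end Enveloping

/-- The `p`-center of `U(L)`: the subalgebra generated by all `x ^ p - x^[p]`, for `x` in the even
part of `L`. -/
def pCenter (k : Type*) [Field k] {L : Type*} [AddCommGroup L] [Module k L] [LieSuperalgebra k L]
    (p : ℕ) (P : even k L → even k L) : Subalgebra k (Enveloping k L) :=
  Algebra.adjoin k (Set.range fun x : even k L => ι k L (x : L) ^ p - ι k L (P x : L))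

/-- `P` is the restricted structure on the Lie superalgebra `A ⊗ L` with
`(m_r ⊗ e_i)^[p] = (m_r)^p ⊗ e_i^[p]`, for a basis `e` of the even part of the restricted Lie
superalgebra `L` and a family `m` in `A` (in use: the powers of `x`). -/
structure IsInducedPMap {k : Type*} [Field k] {L : Type*} [AddCommGroup L] [Module k L]
    [LieSuperalgebra k L] {A : Type*} [CommRing A] [Algebra k A] {R I : Type*}
    (p : ℕ) (m : R → A) (e : I → even k L) (PL : even k L → even k L)
    (P : even k (A ⊗[k] L) → even k (A ⊗[k] L)) : Prop where
  isPMap : IsPMap k p P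
  map_tmul : ∀ r i, P (evenTmul (m r) (e i)) = evenTmul (m r ^ p) (PL (e i))

end LieSuperalgebra

/-! ### Lie algebras -/

/-- The `p`-center of `U(L)`: the subalgebra generated by all `x ^ p - x^[p]`. -/
def pCenter (k : Type*) [Field k] {L : Type*} [LieRing L] [LieAlgebra k L]
    (p : ℕ) (P : L → L) : Subalgebra k (UniversalEnvelopingAlgebra k L) :=
  Algebra.adjoin k (Set.range fun x : L =>
    UniversalEnvelopingAlgebra.ι k x ^ p - UniversalEnvelopingAlgebra.ι k (P x))

/-- `P` is the restricted structure on the Lie algebra `A ⊗ L` with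
`(m_r ⊗ e_i)^[p] = (m_r)^p ⊗ e_i^[p]`, for a basis `e` of the restricted Lie algebra `L` and a
family `m` in `A` (in use: the powers of `x`). -/
structure IsInducedPMap {k : Type*} [Field k] {L : Type*} [LieRing L] [LieAlgebra k L]
    {A : Type*} [CommRing A] [Algebra k A] {R I : Type*}
    (p : ℕ) (m : R → A) (e : I → L) (PL : L → L) (P : A ⊗[k] L → A ⊗[k] L) : Prop where
  isPMap : IsPMap k p P
  map_tmul : ∀ r i, P (m r ⊗ₜ e i) = (m r ^ p) ⊗ₜ PL (e i)

/-- The subalgebra `Z` of `U` is freely generated by the (commuting) family `v`: the variables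
`X_s ↦ v_s` extend to an isomorphism of the polynomial algebra onto `Z`. -/
def FreelyGenerates {k : Type*} [Field k] {U : Type*} [Ring U] [Algebra k U] {σ : Type*}
    (v : σ → U) (Z : Subalgebra k U) : Prop :=
  ∃ φ : MvPolynomial σ k →ₐ[k] U,
    (∀ s, φ (MvPolynomial.X s) = v s) ∧ Function.Injective φ ∧ φ.range = Z

end LieCenter

end

/-!
The generators are central: in characteristic `p` one has `(ad x) ^ p = ad (x ^ p)` in an
associative algebra, so `x ^ p - x^[p]` commutes with everything. The content of the theorem is that there
is nothing else in the center, and that there are no relations between the generators. Both follow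
by comparing leading terms. Lie algebras are treated as Lie superalgebras without odd elements
(`ofLie`), and both kinds of enveloping algebra as instances of `IsEnveloping`.

* By the theorem of Poincaré, Birkhoff and Witt, the normal words (increasing words in a homogeneous
  basis, in which only even letters are repeated) form a basis of the enveloping algebra. Their
  linear independence is `disjoint_normal_relSpan`: rewriting bad pairs of letters is confluent,
  which by `rewriteRel_overlap` comes down to the Jacobi identity, so that the ideal of relations
  has a basis of elements with different leading words, none of which is normal.

* Up to shorter words, the super commutator with `y` acts on words as the derivation that extends
  `[y, -]` (`superCommutator_eword`). Let the leading part of a central element `z` involve the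
  finite set `F` of basis vectors. For `y = e_l ⊗ x ^ s` with large `s`, the vectors `[y, f]`,
  `f ∈ F`, involve new basis vectors only, so the vanishing of the derivation on the leading part means that
  `y` kills the gradient of the leading part, a vector with coefficients in polynomials. As `l` is
  arbitrary, the partial derivative of the leading part with respect to a basis vector outside the
  center vanishes (`separating_tensorProduct`, `count_eq_zero_of_superCentral`). Hence non-central
  letters are even and have multiplicities divisible by `p`.

* So the leading words of `z` are leading words of monomials in the generators; subtracting these
  and using induction on the length one sees that `z` is a polynomial in the generators
  (`superCommutes_mem_adjoin`). Different monomials in the generators have different leading words,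
  and so the generators are algebraically independent (`freelyGenerates_centralGen`).

* The restricted structure on `A ⊗ L` is obtained from Jacobson's theorem (`exists_isPMap`), that
  values of the `p`-th power map on a basis can be prescribed as long as `ad (y_i) = (ad e_i) ^ p`.
  The proof is in the enveloping algebra, where the `p`-th power of a sum is given by Jacobson's
  formula (`add_pow_eq_jacobsonTerm`).
-/

open Module

noncomputable section

namespace LieCenter

namespace LieSuperalgebra

/-! ### Signs and super commutators -/

/-- The sign `(-1)^(a * b)` as a scalar of `k`. -/
def sgn (k : Type*) [Ring k] (a b : ZMod 2) : k := if a = 1 ∧ b = 1 then -1 else 1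

theorem zmod_two_eq (a : ZMod 2) : a = 0 ∨ a = 1 := by
  revert a; decide

theorem units_smul_eq_sgn (k : Type*) [Ring k] {V : Type*} [AddCommGroup V] [Module k V]
    (a b : ZMod 2) (x : V) : (-1 : ℤˣ) ^ (a * b) • x = sgn k a b • x := by
  rcases zmod_two_eq a with rfl | rfl <;> rcases zmod_two_eq b with rfl | rfl <;>
    simp [sgn]

section Sgn

variable (k : Type*) [CommRing k]

@[simp]
theorem sgn_zero_left (a : ZMod 2) : sgn k 0 a = 1 := by simp [sgn]

@[simp]
theorem sgn_zero_right (a : ZMod 2) : sgn k a 0 = 1 := by simp [sgn]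

@[simp]
theorem sgn_one_one : sgn k 1 1 = -1 := by simp [sgn]

theorem sgn_comm (a b : ZMod 2) : sgn k a b = sgn k b a := by simp [sgn, and_comm]

theorem sgn_mul_self (a b : ZMod 2) : sgn k a b * sgn k a b = 1 := by
  unfold sgn; split_ifs <;> simp

theorem sgn_add_right (a b c : ZMod 2) : sgn k a (b + c) = sgn k a b * sgn k a c := by
  have e : (1 + 1 : ZMod 2) = 0 := by decide
  rcases zmod_two_eq a with rfl | rfl <;> rcases zmod_two_eq b with rfl | rfl <;>
    rcases zmod_two_eq c with rfl | rfl <;> simp [e]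

theorem sgn_ne_zero {k : Type*} [Field k] (a b : ZMod 2) : sgn k a b ≠ 0 := by
  intro h; simpa [h] using sgn_mul_self k a b

end Sgn

section Comm

variable {k : Type*} [Field k] {g : Type*} [AddCommGroup g] [Module k g] [LieSuperalgebra k g]
variable {A : Type*} [Ring A] [Algebra k A] (f : g →ₗ[k] A)

/-- The defect `f x f y - (-1)^(a b) f y f x - f [x, y]` of the defining relation of the enveloping
algebra, for `x` and `y` of parity `a` and `b`. -/
def comm (a b : ZMod 2) (x y : g) : A :=
  f x * f y - sgn k a b • (f y * f x) - f (bracket (k := k) x y)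

theorem skew_sgn {a b : ZMod 2} {x y : g} (hx : x ∈ (gr a : Submodule k g))
    (hy : y ∈ (gr b : Submodule k g)) :
    bracket (k := k) x y = -(sgn k a b • bracket (k := k) y x) := by
  rw [bracket_skew hx hy, units_smul_eq_sgn k]

theorem jacobi_sgn {a b c : ZMod 2} {x y z : g} (hx : x ∈ (gr a : Submodule k g))
    (hy : y ∈ (gr b : Submodule k g)) (hz : z ∈ (gr c : Submodule k g)) :
    bracket (k := k) x (bracket (k := k) y z) =
      bracket (k := k) (bracket (k := k) x y) z +
        sgn k a b • bracket (k := k) y (bracket (k := k) x z) := by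
  rw [bracket_jacobi hx hy hz, units_smul_eq_sgn k]

theorem comm_swap {a b : ZMod 2} {x y : g} (hx : x ∈ (gr a : Submodule k g))
    (hy : y ∈ (gr b : Submodule k g)) :
    comm f a b x y = -(sgn k a b • comm f b a y x) := by
  have h := sgn_mul_self k a b
  rw [comm, comm, skew_sgn hx hy, sgn_comm k b a, smul_sub, smul_sub, smul_smul, h, map_neg,
    map_smul, one_smul]
  abel

/-- The two ways of reversing a product of three letters differ by brackets only: the sum of the
defects around the hexagon of permutations is a combination of defects that involve a bracket.
This is where the Jacobi identity enters the theorem of Poincaré, Birkhoff and Witt. -/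
theorem comm_hexagon {a b c : ZMod 2} {x y z : g} (hx : x ∈ (gr a : Submodule k g))
    (hy : y ∈ (gr b : Submodule k g)) (hz : z ∈ (gr c : Submodule k g)) :
    comm f a b x y * f z + sgn k a b • (f y * comm f a c x z)
      + (sgn k a b * sgn k a c) • (comm f b c y z * f x)
      - f x * comm f b c y z - sgn k b c • (comm f a c x z * f y)
      - (sgn k b c * sgn k a c) • (f z * comm f a b x y) =
    comm f a (b + c) x (bracket (k := k) y z) - comm f (a + b) c (bracket (k := k) x y) z
      - sgn k a b • comm f b (a + c) y (bracket (k := k) x z) := by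
  have hj := congrArg f (jacobi_sgn hx hy hz)
  simp only [map_add, map_smul] at hj
  have e : (1 + 1 : ZMod 2) = 0 := by decide
  simp only [comm]
  rw [hj]
  clear hj
  rcases zmod_two_eq a with rfl | rfl <;> rcases zmod_two_eq b with rfl | rfl <;>
    rcases zmod_two_eq c with rfl | rfl <;>
    simp only [e, add_zero, zero_add, sgn_zero_left, sgn_zero_right, sgn_one_one, mul_one,
      mul_neg, neg_mul, neg_neg, one_smul, neg_smul, mul_sub, sub_mul, mul_assoc] <;> abel

theorem comm_cube {x : g} (hx : x ∈ (gr 1 : Submodule k g)) :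
    comm f 1 1 x x * f x - f x * comm f 1 1 x x = comm f 1 0 x (bracket (k := k) x x) := by
  simp [comm, bracket_cube hx, mul_sub, sub_mul, mul_add, add_mul, mul_assoc]

/-- The subspace spanned by the elements `u (x y - (-1)^(|x||y|) y x - [x, y]) v`: the kernel of the
map from the tensor algebra to the enveloping algebra. -/
def relSpan (k g : Type*) [Field k] [AddCommGroup g] [Module k g] [LieSuperalgebra k g] :
    Submodule k (TensorAlgebra k g) :=
  Submodule.span k {t | ∃ (u v : TensorAlgebra k g) (a b : ZMod 2) (x y : g),
    x ∈ (gr a : Submodule k g) ∧ y ∈ (gr b : Submodule k g) ∧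
    t = u * comm (TensorAlgebra.ι k) a b x y * v}

end Comm

/-! ### Words, inversions and normal words -/

section Words

variable {ι : Type*} [LinearOrder ι]

/-- The number of pairs of letters of a word in the wrong order. -/
def inversions : List ι → ℕ
  | [] => 0
  | a :: l => l.countP (· < a) + inversions l

/-- The measure by which rewriting terminates: length, then number of inversions. -/
def wordRank (l : List ι) : ℕ ×ₗ ℕ := toLex (l.length, inversions l)

theorem inversions_swap_lt {a c : ι} (h : c < a) (u v : List ι) :
    inversions (u ++ c :: a :: v) < inversions (u ++ a :: c :: v) := by
  induction u with
  | nil => simp [inversions, h, h.not_gt]; omega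
  | cons d u ih =>
    have : (u ++ c :: a :: v).countP (· < d) = (u ++ a :: c :: v).countP (· < d) :=
      List.Perm.countP_eq _ (List.Perm.append_left u (List.Perm.swap a c v))
    simp only [List.cons_append, inversions, this]
    omega

theorem wordRank_swap_lt {a c : ι} (h : c < a) (u v : List ι) :
    wordRank (u ++ c :: a :: v) < wordRank (u ++ a :: c :: v) := by
  rw [wordRank, wordRank, Prod.Lex.toLex_lt_toLex]
  exact Or.inr ⟨by simp, inversions_swap_lt h u v⟩

theorem wordRank_lt_of_length_lt {l m : List ι} (h : l.length < m.length) :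
    wordRank l < wordRank m := by
  rw [wordRank, wordRank, Prod.Lex.toLex_lt_toLex]
  exact Or.inl h

/-- `a c` is a pair of consecutive letters that does not occur in a normal word: the pair is
decreasing, or consists of two copies of an odd letter. -/
def Bad (par : ι → ZMod 2) (a c : ι) : Prop := c < a ∨ (a = c ∧ par a = 1)

/-- The normal words: increasing words in which only even letters are repeated. -/
def Normal (par : ι → ZMod 2) (l : List ι) : Prop := l.Pairwise fun a c => ¬ Bad par a c

variable {par : ι → ZMod 2}

theorem Bad.le {a c : ι} (h : Bad par a c) : c ≤ a := by
  rcases h with h | h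
  · exact h.le
  · exact h.1.ge

theorem not_bad_iff {a c : ι} : ¬ Bad par a c ↔ a < c ∨ (a = c ∧ par a = 0) := by
  unfold Bad
  rcases lt_trichotomy a c with h | rfl | h
  · simp [h, h.not_gt, h.ne]
  · rcases zmod_two_eq (par a) with e | e <;> simp [e]
  · simp [h, h.not_gt, h.ne']

theorem not_bad_trans {a c d : ι} (h : ¬ Bad par a c) (h' : ¬ Bad par c d) : ¬ Bad par a d := by
  rw [not_bad_iff] at *
  rcases h with h | ⟨rfl, h⟩
  · rcases h' with h' | ⟨rfl, h'⟩
    · exact Or.inl (h.trans h')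
    · exact Or.inl h
  · exact h'

theorem exists_bad_of_not_normal {l : List ι} (h : ¬ Normal par l) :
    ∃ u a c v, Bad par a c ∧ l = u ++ a :: c :: v := by
  induction l with
  | nil => exact absurd List.Pairwise.nil h
  | cons a l ih =>
    by_cases hl : Normal par l
    · cases l with
      | nil => exact absurd (List.pairwise_singleton _ _) h
      | cons d l =>
        by_cases hd : Bad par a d
        · exact ⟨[], a, d, l, hd, rfl⟩
        · refine absurd (List.pairwise_cons.2 ⟨fun c hc => ?_, hl⟩) h
          rcases List.mem_cons.1 hc with rfl | hc
          · exact hd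
          · exact not_bad_trans hd ((List.pairwise_cons.1 hl).1 c hc)
    · obtain ⟨u, b, c, v, hb, rfl⟩ := ih hl
      exact ⟨a :: u, b, c, v, hb, rfl⟩

theorem Normal.not_bad {u v : List ι} {a c : ι} (h : Normal par (u ++ a :: c :: v)) :
    ¬ Bad par a c := by
  have := (List.pairwise_append.1 h).2.1
  exact (List.pairwise_cons.1 this).1 c (by simp)

theorem Normal.sortedLE {l : List ι} (h : Normal par l) : l.Pairwise (· ≤ ·) :=
  List.Pairwise.imp (fun h => by
    rcases not_bad_iff.1 h with h | h
    exacts [h.le, h.1.le]) h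

theorem Normal.eq_of_perm {l m : List ι} (hl : Normal par l) (hm : Normal par m)
    (h : l.Perm m) : l = m :=
  h.eq_of_pairwise (fun _ _ _ _ h h' => le_antisymm h h') hl.sortedLE hm.sortedLE

end Words

section TensorAlgebra

variable {ι : Type*}

/-- The product of the letters of a word. -/
def word {A : Type*} [Ring A] (f : ι → A) (l : List ι) : A := (l.map f).prod

section WordLemmas

variable {A : Type*} [Ring A] (f : ι → A)

@[simp] theorem word_nil : word f [] = 1 := rfl

@[simp] theorem word_cons (a : ι) (l : List ι) : word f (a :: l) = f a * word f l := by
  simp [word]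

@[simp] theorem word_append (l m : List ι) : word f (l ++ m) = word f l * word f m := by
  simp [word]

end WordLemmas

variable {k : Type*} [Field k] {g : Type*} [AddCommGroup g] [Module k g] {b : Basis ι k g}

variable (b) in
/-- The word `b_{a_1} ⋯ b_{a_n}` in the tensor algebra. -/
abbrev tword (l : List ι) : TensorAlgebra k g := word (fun i => TensorAlgebra.ι k (b i)) l

variable (b) in
theorem tensorAlgebra_basis_apply (l : List ι) :
    b.tensorAlgebra (FreeMonoid.ofList l) = tword b l := by
  have h : ∀ i, (TensorAlgebra.equivFreeAlgebra b).symm (FreeAlgebra.ι k i) =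
    TensorAlgebra.ι k (b i) := TensorAlgebra.equivFreeAlgebra_symm_ι b
  have h' : ∀ m : FreeMonoid ι, b.tensorAlgebra m = (TensorAlgebra.equivFreeAlgebra b).symm
      (FreeAlgebra.equivMonoidAlgebraFreeMonoid.symm (MonoidAlgebra.single m 1)) := by
    intro m
    simp [Basis.tensorAlgebra, FreeAlgebra.basisFreeMonoid]
  have h1 : ∀ i : ι, FreeAlgebra.equivMonoidAlgebraFreeMonoid.symm
      (MonoidAlgebra.single (FreeMonoid.of i) (1 : k)) = FreeAlgebra.ι k i := by
    intro i
    rw [AlgEquiv.symm_apply_eq]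
    simp [FreeAlgebra.equivMonoidAlgebraFreeMonoid]
  rw [h']
  induction l with
  | nil =>
    have : MonoidAlgebra.single (FreeMonoid.ofList ([] : List ι)) (1 : k) = 1 := rfl
    rw [this, map_one, map_one, tword, word_nil]
  | cons a l ih =>
    rw [FreeMonoid.ofList_cons, tword, word_cons, ← tword, ← ih, ← h, ← h1, ← map_mul, ← map_mul,
      MonoidAlgebra.single_mul_single, one_mul]

variable (b) in
theorem tword_linearIndependent : LinearIndependent k (tword b) := by
  have := b.tensorAlgebra.linearIndependent
  rw [show tword b = b.tensorAlgebra ∘ FreeMonoid.ofList from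
    funext fun l => (tensorAlgebra_basis_apply b l).symm]
  exact this.comp _ FreeMonoid.ofList.injective

variable (b) in
theorem span_tword : Submodule.span k (Set.range (tword b)) = ⊤ := by
  rw [← b.tensorAlgebra.span_eq, show tword b = b.tensorAlgebra ∘ FreeMonoid.ofList from
    funext fun l => (tensorAlgebra_basis_apply b l).symm, FreeMonoid.ofList.surjective.range_comp]

end TensorAlgebra

/-! ### The theorem of Poincaré, Birkhoff and Witt -/

/-- `b` is a basis of the Lie superalgebra `g` that consists of homogeneous elements, `b i` being of
parity `par i`. The two last conditions make up for the fact that `LieSuperalgebra` is designed for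
the case that `2` is invertible: they say that `2` is invertible unless there are no odd elements,
and that the even part is a Lie algebra even if `2 = 0`. -/
structure IsParityBasis {k : Type*} [Field k] {g : Type*} [AddCommGroup g] [Module k g]
    [LieSuperalgebra k g] {ι : Type*} (b : Basis ι k g) (par : ι → ZMod 2) : Prop where
  mem : ∀ i, b i ∈ (gr (par i) : Submodule k g)
  two_ne_zero : ∀ i, par i = 1 → (2 : k) ≠ 0
  bracket_self : ∀ x ∈ (gr 0 : Submodule k g), bracket (k := k) x x = 0

section PBW

variable {k : Type*} [Field k] {g : Type*} [AddCommGroup g] [Module k g] [LieSuperalgebra k g]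
variable {ι : Type*} {b : Basis ι k g} {par : ι → ZMod 2}

theorem disjoint_gr {a c : ZMod 2} (h : a ≠ c) :
    Disjoint (gr a : Submodule k g) (gr c : Submodule k g) := by
  have := (isCompl (k := k) (L := g)).disjoint
  rcases zmod_two_eq a with rfl | rfl <;> rcases zmod_two_eq c with rfl | rfl
  · exact absurd rfl h
  · exact this
  · exact this.symm
  · exact absurd rfl h

theorem IsParityBasis.gr_eq_span (hb : IsParityBasis b par) (a : ZMod 2) :
    (gr a : Submodule k g) = Submodule.span k (b '' {i | par i = a}) := by
  refine le_antisymm (fun x hx => ?_) (Submodule.span_le.2 ?_)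
  · have hle : ∀ c, Submodule.span k (b '' {i | par i = c}) ≤ (gr c : Submodule k g) := by
      rintro c
      refine Submodule.span_le.2 ?_
      rintro _ ⟨i, rfl, rfl⟩
      exact hb.mem i
    have htop : x ∈ Submodule.span k (b '' {i | par i = a}) ⊔
        Submodule.span k (b '' {i | par i = a + 1}) := by
      rw [← Submodule.span_union, ← Set.image_union]
      have : {i | par i = a} ∪ {i | par i = a + 1} = Set.univ := by
        ext i
        have : ∀ a c : ZMod 2, c = a ∨ c = a + 1 := by decide
        simpa using this a (par i)
      rw [this, Set.image_univ, b.span_eq]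
      trivial
    obtain ⟨y, hy, z, hz, rfl⟩ := Submodule.mem_sup.1 htop
    have hne : ∀ a : ZMod 2, a ≠ a + 1 := by decide
    have hz0 : z = 0 := by
      have h1 : z ∈ (gr a : Submodule k g) := by
        simpa using sub_mem hx (hle _ hy)
      exact Submodule.disjoint_def.1 (disjoint_gr (hne a)) z h1 (hle _ hz)
    simpa [hz0] using hy
  · rintro _ ⟨i, rfl, rfl⟩
    exact hb.mem i

variable [LinearOrder ι]

variable (b par) in
/-- The span of the defects `u (b_a b_c - ± b_c b_a - [b_a, b_c]) v` for the bad pairs `a c` such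
that the word `u a c v` is smaller than `m`. -/
def relBelow (m : ℕ ×ₗ ℕ) : Submodule k (TensorAlgebra k g) :=
  Submodule.span k {t | ∃ (u : List ι) (a c : ι) (v : List ι), Bad par a c ∧
    wordRank (u ++ a :: c :: v) < m ∧
    t = tword b u * comm (TensorAlgebra.ι k) (par a) (par c) (b a) (b c) * tword b v}

theorem letters_mem_relBelow (hb : IsParityBasis b par) {m : ℕ ×ₗ ℕ} (u v : List ι) (a c : ι)
    (h1 : wordRank (u ++ a :: c :: v) < m) (h2 : wordRank (u ++ c :: a :: v) < m) :
    tword b u * comm (TensorAlgebra.ι k) (par a) (par c) (b a) (b c) * tword b v ∈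
      relBelow b par m := by
  by_cases h : Bad par a c
  · exact Submodule.subset_span ⟨u, a, c, v, h, h1, rfl⟩
  rcases not_bad_iff.1 h with h | ⟨rfl, h'⟩
  · rw [comm_swap _ (hb.mem a) (hb.mem c), mul_neg, neg_mul, mul_smul_comm, smul_mul_assoc]
    exact neg_mem (Submodule.smul_mem _ _ (Submodule.subset_span ⟨u, c, a, v, Or.inl h, h2, rfl⟩))
  · have := hb.bracket_self (b a) (h' ▸ hb.mem a)
    simp [comm, h', this]

theorem comm_mem_relBelow (hb : IsParityBasis b par) {m : ℕ ×ₗ ℕ} (u v : List ι)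
    (hm : ∀ a c, wordRank (u ++ a :: c :: v) < m) {α β : ZMod 2} {x y : g}
    (hx : x ∈ (gr α : Submodule k g)) (hy : y ∈ (gr β : Submodule k g)) :
    tword b u * comm (TensorAlgebra.ι k) α β x y * tword b v ∈ relBelow b par m := by
  rw [hb.gr_eq_span] at hx hy
  induction hx using Submodule.span_induction with
  | zero => simp [comm]
  | add x x' _ _ h h' =>
    convert add_mem h h' using 1
    simp only [comm, map_add, LinearMap.add_apply, mul_add, add_mul, mul_sub, sub_mul, smul_add]
    abel
  | smul r x _ h =>
    convert Submodule.smul_mem _ r h using 1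
    simp only [comm, map_smul, LinearMap.smul_apply, mul_sub, sub_mul, smul_sub, mul_smul_comm,
      smul_mul_assoc, smul_comm (sgn k α β) r]
  | mem x hx =>
    obtain ⟨a, rfl, rfl⟩ := hx
    induction hy using Submodule.span_induction with
    | zero => simp [comm]
    | add x x' _ _ h h' =>
      convert add_mem h h' using 1
      simp only [comm, map_add, mul_add, add_mul, mul_sub, sub_mul, smul_add]
      abel
    | smul r x _ h =>
      convert Submodule.smul_mem _ r h using 1
      simp only [comm, map_smul, mul_sub, sub_mul, smul_sub, mul_smul_comm,
        smul_mul_assoc, smul_comm (sgn k (par a) β) r]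
    | mem y hy =>
      obtain ⟨c, rfl, rfl⟩ := hy
      exact letters_mem_relBelow hb u v a c (hm a c) (hm c a)

/-- The coefficient of `b_a b_c` in the defect of the pair `a c`, if the pair is bad: it is `2` for
two copies of an odd letter. -/
def leadCoeff (k : Type*) [Field k] {ι : Type*} [LinearOrder ι] (a c : ι) : k :=
  if a = c then 2 else 1

theorem leadCoeff_ne_zero (hb : IsParityBasis b par) {a c : ι} (h : Bad par a c) :
    leadCoeff k a c ≠ 0 := by
  unfold leadCoeff
  split_ifs with e
  · rcases h with h | h
    · exact absurd e.symm h.ne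
    · exact hb.two_ne_zero a h.2
  · exact one_ne_zero

variable (b par) in
/-- The defect of a bad pair `a c` inside a word `u a c v`, normalized so that the coefficient of
this word is `1`. -/
def rewriteRel (u : List ι) (a c : ι) (v : List ι) : TensorAlgebra k g :=
  (leadCoeff k a c)⁻¹ •
    (tword b u * comm (TensorAlgebra.ι k) (par a) (par c) (b a) (b c) * tword b v)

theorem rewriteRel_mem_relBelow {m : ℕ ×ₗ ℕ} {u : List ι} {a c : ι} {v : List ι}
    (h : Bad par a c) (hm : wordRank (u ++ a :: c :: v) < m) :
    rewriteRel b par u a c v ∈ relBelow b par m :=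
  Submodule.smul_mem _ _ (Submodule.subset_span ⟨u, a, c, v, h, hm, rfl⟩)

/-- The words by which a bad pair `a c` is rewritten: `c a` (if `a ≠ c`), and single letters of
the parity of `[b_a, b_c]`. -/
def rewriteWords (par : ι → ZMod 2) (a c : ι) : Set (List ι) :=
  {w | (w = [c, a] ∧ c < a) ∨ ∃ t, par t = par a + par c ∧ w = [t]}

/-- A bad pair `f (b_a) f (b_c)` is, up to its defect, a combination of smaller words. -/
theorem bad_pair_sub_mem (hb : IsParityBasis b par) {A : Type*} [Ring A] [Algebra k A]
    (f : g →ₗ[k] A) {a c : ι} (h : Bad par a c) :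
    f (b a) * f (b c) - (leadCoeff k a c)⁻¹ • comm f (par a) (par c) (b a) (b c) ∈
      Submodule.span k (word (fun i => f (b i)) '' rewriteWords par a c) := by
  have hbr : f (bracket (k := k) (b a) (b c)) ∈
      Submodule.span k (word (fun i => f (b i)) '' rewriteWords par a c) := by
    have h1 := bracket_mem (hb.mem a) (hb.mem c)
    rw [hb.gr_eq_span] at h1
    have h2 := Submodule.mem_map_of_mem (f := f) h1
    rw [Submodule.map_span] at h2
    refine Submodule.span_mono ?_ h2
    rintro _ ⟨_, ⟨t, ht, rfl⟩, rfl⟩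
    exact ⟨[t], Or.inr ⟨t, ht, rfl⟩, by simp⟩
  rcases h with h | ⟨rfl, h⟩
  · rw [leadCoeff, if_neg h.ne', comm, inv_one, one_smul]
    have h3 : f (b c) * f (b a) ∈
        Submodule.span k (word (fun i => f (b i)) '' rewriteWords par a c) :=
      Submodule.subset_span ⟨[c, a], Or.inl ⟨rfl, h⟩, by simp⟩
    convert add_mem (Submodule.smul_mem _ (sgn k (par a) (par c)) h3) hbr using 1
    abel
  · have h2 := hb.two_ne_zero a h
    convert Submodule.smul_mem _ (2⁻¹ : k) hbr using 1
    rw [leadCoeff, if_pos rfl, comm, h, sgn_one_one, neg_smul, one_smul, sub_neg_eq_add, smul_sub,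
      ← two_smul k, smul_smul, inv_mul_cancel₀ h2, one_smul]
    abel

theorem wordRank_lt_of_mem_rewriteWords {a c : ι} {w : List ι} (hw : w ∈ rewriteWords par a c)
    (u v : List ι) : wordRank (u ++ w ++ v) < wordRank (u ++ a :: c :: v) := by
  rcases hw with ⟨rfl, h⟩ | ⟨t, -, rfl⟩
  · simpa using wordRank_swap_lt h u v
  · exact wordRank_lt_of_length_lt (by simp)

/-- The two ways of rewriting a word `u a b c v` with bad pairs `a b` and `b c` agree modulo smaller
defects. -/
theorem rewriteRel_overlap (hb : IsParityBasis b par) (u : List ι) {x y z : ι} (v : List ι)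
    (hxy : Bad par x y) (hyz : Bad par y z) :
    rewriteRel b par u x y (z :: v) - rewriteRel b par (u ++ [x]) y z v ∈
      relBelow b par (wordRank (u ++ x :: y :: z :: v)) := by
  set T := TensorAlgebra.ι k (M := g)
  set E := tword b u
  set V := tword b v
  set m := wordRank (u ++ x :: y :: z :: v) with hm
  have hlen : ∀ l : List ι, l.length = u.length + v.length + 2 → wordRank l < m := fun l hl =>
    wordRank_lt_of_length_lt (by simp [hl]; omega)
  have hshort : ∀ {α β : ZMod 2} {p q : g}, p ∈ (gr α : Submodule k g) →
      q ∈ (gr β : Submodule k g) → E * comm T α β p q * V ∈ relBelow b par m :=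
    fun hp hq => comm_mem_relBelow hb u v (fun a c => hlen _ (by simp; omega)) hp hq
  have hX := hb.mem x
  have hY := hb.mem y
  have hZ := hb.mem z
  have h1 : rewriteRel b par u x y (z :: v) =
      (leadCoeff k x y)⁻¹ • (E * (comm T (par x) (par y) (b x) (b y) * T (b z)) * V) := by
    simp [rewriteRel, mul_assoc, E, V, T]
  have h4 : rewriteRel b par (u ++ [x]) y z v =
      (leadCoeff k y z)⁻¹ • (E * (T (b x) * comm T (par y) (par z) (b y) (b z)) * V) := by
    simp [rewriteRel, mul_assoc, E, V, T]
  rw [h1, h4]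
  clear h1 h4
  by_cases hall : x = y ∧ y = z
  · -- three copies of an odd letter
    obtain ⟨rfl, rfl⟩ := hall
    have hodd : par x = 1 := by
      rcases hxy with h | h
      exacts [absurd h (lt_irrefl _), h.2]
    rw [← smul_sub, ← sub_mul, ← mul_sub, hodd]
    rw [hodd] at hX
    rw [comm_cube T hX]
    have := bracket_mem hX hX
    rw [show (1 + 1 : ZMod 2) = 0 by decide] at this
    exact Submodule.smul_mem _ _ (hshort hX this)
  have hxz : z < x := by
    refine lt_of_le_of_ne (hyz.le.trans hxy.le) fun h => hall ?_
    subst h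
    exact ⟨le_antisymm hyz.le hxy.le, le_antisymm hxy.le hyz.le⟩
  have key := congrArg (fun t => E * t * V) (comm_hexagon T hX hY hZ)
  simp only [mul_add, mul_sub, add_mul, sub_mul, mul_smul_comm, smul_mul_assoc] at key
  have hR := sub_mem (sub_mem (hshort hX (bracket_mem hY hZ)) (hshort (bracket_mem hX hY) hZ))
    (Submodule.smul_mem _ (sgn k (par x) (par y)) (hshort hY (bracket_mem hX hZ)))
  rw [← key] at hR
  clear key
  have mem : ∀ (s : List ι) (a c : ι) (t : List ι), Bad par a c →
      wordRank (s ++ a :: c :: t) < m →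
      tword b s * comm T (par a) (par c) (b a) (b c) * tword b t ∈ relBelow b par m :=
    fun s a c t h h' => Submodule.subset_span ⟨s, a, c, t, h, h', rfl⟩
  -- the four terms of the hexagon that do not start from the word `x y z`
  have t2 : y < x → E * (T (b y) * comm T (par x) (par z) (b x) (b z)) * V ∈ relBelow b par m := by
    intro h
    have := mem (u ++ [y]) x z v (Or.inl hxz) (by simpa using wordRank_swap_lt h u (z :: v))
    simpa [mul_assoc, E, V, T] using this
  have t5 : z < y → E * (comm T (par x) (par z) (b x) (b z) * T (b y)) * V ∈ relBelow b par m := by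
    intro h
    have := mem u x z (y :: v) (Or.inl hxz) (by simpa using wordRank_swap_lt h (u ++ [x]) v)
    simpa [mul_assoc, E, V, T] using this
  have t3 : E * (comm T (par y) (par z) (b y) (b z) * T (b x)) * V ∈ relBelow b par m := by
    have := mem u y z (x :: v) hyz (by
      have h' := wordRank_swap_lt hxz (u ++ [y]) v
      simp only [List.append_assoc, List.cons_append, List.nil_append] at h'
      rcases hxy with h | ⟨rfl, -⟩
      · exact h'.trans (wordRank_swap_lt h u (z :: v))
      · exact h')
    simpa [mul_assoc, E, V, T] using this
  have t6 : E * (T (b z) * comm T (par x) (par y) (b x) (b y)) * V ∈ relBelow b par m := by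
    have := mem (u ++ [z]) x y v hxy (by
      have h' := wordRank_swap_lt hxz u (y :: v)
      simp only [List.append_assoc, List.cons_append, List.nil_append]
      rcases hyz with h | ⟨rfl, -⟩
      · refine h'.trans ?_
        simpa using wordRank_swap_lt h (u ++ [x]) v
      · exact h')
    simpa [mul_assoc, E, V, T] using this
  have t3' := Submodule.smul_mem _ (sgn k (par x) (par y) * sgn k (par x) (par z)) t3
  have t6' := Submodule.smul_mem _ (sgn k (par y) (par z) * sgn k (par x) (par z)) t6
  rcases hxy with hxy | ⟨rfl, hxy⟩
  · have t2' := Submodule.smul_mem _ (sgn k (par x) (par y)) (t2 hxy)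
    rcases hyz with hyz | ⟨rfl, hyz⟩
    · have t5' := Submodule.smul_mem _ (sgn k (par y) (par z)) (t5 hyz)
      rw [leadCoeff, leadCoeff, if_neg hxy.ne', if_neg hyz.ne', inv_one, one_smul, one_smul]
      convert add_mem (add_mem (sub_mem (sub_mem hR t2') t3') t5') t6' using 1
      abel
    · have h2 := hb.two_ne_zero y hyz
      rw [leadCoeff, leadCoeff, if_neg hxy.ne', if_pos rfl, inv_one, one_smul]
      convert Submodule.smul_mem _ (2⁻¹ : k) (add_mem (sub_mem (sub_mem hR t2') t3') t6') using 1
      simp only [hyz, sgn_one_one]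
      match_scalars <;> field_simp <;> norm_num
  · have h2 := hb.two_ne_zero x hxy
    rcases hyz with hyz | ⟨rfl, hyz⟩
    · have t5' := Submodule.smul_mem _ (sgn k (par x) (par z)) (t5 hyz)
      rw [leadCoeff, leadCoeff, if_pos rfl, if_neg hyz.ne', inv_one, one_smul]
      convert Submodule.smul_mem _ (2⁻¹ : k) (add_mem (add_mem (sub_mem hR t3') t5') t6') using 1
      simp only [hxy, sgn_one_one]
      match_scalars <;> field_simp <;> norm_num
    · exact absurd ⟨rfl, rfl⟩ hall

/-- Two disjoint bad pairs of a word can be rewritten in either order. -/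
theorem rewriteRel_disjoint (hb : IsParityBasis b par) (u : List ι) {x y : ι} (w : List ι)
    {x' y' : ι} (v : List ι) (h : Bad par x y) (h' : Bad par x' y') :
    rewriteRel b par u x y (w ++ x' :: y' :: v) - rewriteRel b par (u ++ x :: y :: w) x' y' v ∈
      relBelow b par (wordRank (u ++ x :: y :: (w ++ x' :: y' :: v))) := by
  set m := wordRank (u ++ x :: y :: (w ++ x' :: y' :: v)) with hm
  set T := TensorAlgebra.ι k (M := g)
  set E := tword b u
  set M := tword b w
  set V := tword b v
  set d := (leadCoeff k x y)⁻¹ • comm T (par x) (par y) (b x) (b y) with hd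
  set d' := (leadCoeff k x' y')⁻¹ • comm T (par x') (par y') (b x') (b y') with hd'
  have e1 : rewriteRel b par u x y (w ++ x' :: y' :: v) =
      E * d * M * (T (b x') * T (b y')) * V := by
    simp [rewriteRel, hd, mul_assoc, E, M, V, T]
  have e2 : rewriteRel b par (u ++ x :: y :: w) x' y' v =
      E * (T (b x) * T (b y)) * M * d' * V := by
    simp [rewriteRel, hd', mul_assoc, E, M, V, T]
  rw [e1, e2]
  have h1 : ∀ t ∈ Submodule.span k (tword b '' rewriteWords par x' y'),
      E * d * M * t * V ∈ relBelow b par m := by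
    intro t ht
    induction ht using Submodule.span_induction with
    | zero => simp
    | add t t' _ _ ht ht' => rw [mul_add, add_mul]; exact add_mem ht ht'
    | smul r t _ ht => rw [mul_smul_comm, smul_mul_assoc]; exact Submodule.smul_mem _ _ ht
    | mem t ht =>
      obtain ⟨s, hs, rfl⟩ := ht
      have := rewriteRel_mem_relBelow (b := b) (m := m) (u := u) (v := w ++ s ++ v) h (by
        simpa using wordRank_lt_of_mem_rewriteWords hs (u ++ x :: y :: w) v)
      simpa [rewriteRel, hd, mul_assoc, E, M, V, T] using this
  have h2 : ∀ t ∈ Submodule.span k (tword b '' rewriteWords par x y),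
      E * t * M * d' * V ∈ relBelow b par m := by
    intro t ht
    induction ht using Submodule.span_induction with
    | zero => simp
    | add t t' _ _ ht ht' => simp only [mul_add, add_mul]; exact add_mem ht ht'
    | smul r t _ ht =>
      simp only [mul_smul_comm, smul_mul_assoc]; exact Submodule.smul_mem _ _ ht
    | mem t ht =>
      obtain ⟨s, hs, rfl⟩ := ht
      have := rewriteRel_mem_relBelow (b := b) (m := m) (u := u ++ s ++ w) (v := v) h' (by
        simpa using wordRank_lt_of_mem_rewriteWords hs u (w ++ x' :: y' :: v))
      simpa [rewriteRel, hd', mul_assoc, E, M, V, T] using this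
  convert sub_mem (h1 _ (bad_pair_sub_mem hb T h')) (h2 _ (bad_pair_sub_mem hb T h)) using 1
  simp only [← hd, ← hd']
  noncomm_ring

/-- All ways of rewriting a word agree modulo smaller defects. -/
theorem rewriteRel_confluent (hb : IsParityBasis b par) {l u u' v v' : List ι} {x y x' y' : ι}
    (h : Bad par x y) (h' : Bad par x' y') (e : l = u ++ x :: y :: v)
    (e' : l = u' ++ x' :: y' :: v') :
    rewriteRel b par u x y v - rewriteRel b par u' x' y' v' ∈ relBelow b par (wordRank l) := by
  wlog hu : u.length ≤ u'.length generalizing u u' v v' x y x' y'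
  · rw [← neg_sub]
    exact neg_mem (this h' h e' e (by omega))
  have hp : u <+: u' := List.prefix_of_prefix_length_le ⟨x :: y :: v, e.symm⟩
    ⟨x' :: y' :: v', e'.symm⟩ hu
  obtain ⟨w, rfl⟩ := hp
  have e'' := e.symm.trans e'
  rw [List.append_assoc, List.append_cancel_left_eq] at e''
  match w, e'' with
  | [], e'' =>
    simp only [List.nil_append, List.cons.injEq] at e''
    obtain ⟨rfl, rfl, rfl⟩ := e''
    simp
  | [s], e'' =>
    simp only [List.cons_append, List.nil_append, List.cons.injEq] at e''
    obtain ⟨rfl, rfl, rfl⟩ := e''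
    rw [e]
    exact rewriteRel_overlap hb u v' h h'
  | s :: t :: w, e'' =>
    simp only [List.cons_append, List.cons.injEq] at e''
    obtain ⟨rfl, rfl, rfl⟩ := e''
    rw [e]
    exact rewriteRel_disjoint hb u w v' h h'

variable (b par) in
/-- A chosen defect whose leading word is `l`, for each word `l` that is not normal. -/
def chosenRel (l : {l : List ι // ¬ Normal par l}) : TensorAlgebra k g :=
  have h := exists_bad_of_not_normal l.2
  rewriteRel b par h.choose h.choose_spec.choose h.choose_spec.choose_spec.choose
    h.choose_spec.choose_spec.choose_spec.choose

theorem chosenRel_spec (l : {l : List ι // ¬ Normal par l}) :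
    ∃ u a c v, Bad par a c ∧ l.1 = u ++ a :: c :: v ∧
      chosenRel b par l = rewriteRel b par u a c v :=
  have h := (exists_bad_of_not_normal l.2).choose_spec.choose_spec.choose_spec.choose_spec
  ⟨_, _, _, _, h.1, h.2, rfl⟩

theorem rewriteRel_mem_span (hb : IsParityBasis b par) {u v : List ι} {a c : ι}
    (h : Bad par a c) :
    rewriteRel b par u a c v ∈ Submodule.span k (Set.range (chosenRel b par)) := by
  suffices H : ∀ m : ℕ ×ₗ ℕ, ∀ u a c v, Bad par a c → wordRank (u ++ a :: c :: v) = m →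
      rewriteRel b par u a c v ∈ Submodule.span k (Set.range (chosenRel b par)) from
    H _ u a c v h rfl
  intro m
  induction m using WellFoundedLT.induction with
  | ind m ih =>
    rintro u a c v h rfl
    have hn : ¬ Normal par (u ++ a :: c :: v) := fun hn => hn.not_bad h
    obtain ⟨u', a', c', v', h', e, e'⟩ := chosenRel_spec (b := b) ⟨_, hn⟩
    have h1 := rewriteRel_confluent hb h h' rfl e
    rw [← e'] at h1
    have h2 : relBelow b par (wordRank (u ++ a :: c :: v)) ≤
        Submodule.span k (Set.range (chosenRel b par)) := by
      refine Submodule.span_le.2 ?_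
      rintro _ ⟨s, x, y, t, hxy, hlt, rfl⟩
      have h3 := Submodule.smul_mem _ (leadCoeff k x y) (ih _ hlt s x y t hxy rfl)
      rwa [rewriteRel, smul_smul, mul_inv_cancel₀ (leadCoeff_ne_zero hb hxy), one_smul] at h3
    have h4 := add_mem (h2 h1) (Submodule.subset_span ⟨⟨_, hn⟩, rfl⟩)
    rwa [sub_add_cancel] at h4

theorem relSpan_le_span_chosenRel (hb : IsParityBasis b par) :
    relSpan k g ≤ Submodule.span k (Set.range (chosenRel b par)) := by
  have hbelow : ∀ m, relBelow b par m ≤ Submodule.span k (Set.range (chosenRel b par)) := by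
    refine fun m => Submodule.span_le.2 ?_
    rintro _ ⟨s, x, y, t, hxy, -, rfl⟩
    have h3 := Submodule.smul_mem _ (leadCoeff k x y)
      (rewriteRel_mem_span hb (u := s) (v := t) hxy)
    rwa [rewriteRel, smul_smul, mul_inv_cancel₀ (leadCoeff_ne_zero hb hxy), one_smul] at h3
  refine Submodule.span_le.2 ?_
  rintro _ ⟨u, v, α, β, x, y, hx, hy, rfl⟩
  have hu : u ∈ Submodule.span k (Set.range (tword b)) := span_tword b ▸ Submodule.mem_top
  have hv : v ∈ Submodule.span k (Set.range (tword b)) := span_tword b ▸ Submodule.mem_top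
  rw [SetLike.mem_coe]
  induction hu using Submodule.span_induction with
  | zero => simp
  | add t t' _ _ ht ht' => simp only [add_mul]; exact add_mem ht ht'
  | smul r t _ ht => simp only [smul_mul_assoc]; exact Submodule.smul_mem _ _ ht
  | mem u hu =>
    obtain ⟨s, rfl⟩ := hu
    induction hv using Submodule.span_induction with
    | zero => simp
    | add t t' _ _ ht ht' => simp only [mul_add]; exact add_mem ht ht'
    | smul r t _ ht => simp only [mul_smul_comm]; exact Submodule.smul_mem _ _ ht
    | mem v hv =>
      obtain ⟨t, rfl⟩ := hv
      refine hbelow (toLex (s.length + t.length + 3, 0))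
        (comm_mem_relBelow hb s t (fun a c => ?_) hx hy)
      rw [wordRank, Prod.Lex.toLex_lt_toLex]
      exact Or.inl (by simp; omega)

/-- The chosen defects are unitriangular: apart from its leading word, a chosen defect consists of
smaller words. -/
theorem tword_sub_chosenRel_mem (hb : IsParityBasis b par) (l : {l : List ι // ¬ Normal par l}) :
    tword b l.1 - chosenRel b par l ∈
      Submodule.span k (tword b '' {w | wordRank w < wordRank l.1}) := by
  obtain ⟨u, a, c, v, h, e, e'⟩ := chosenRel_spec (b := b) l
  have h1 := bad_pair_sub_mem hb (TensorAlgebra.ι k) h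
  have h2 : ∀ t ∈ Submodule.span k (tword b '' rewriteWords par a c),
      tword b u * t * tword b v ∈
        Submodule.span k (tword b '' {w | wordRank w < wordRank l.1}) := by
    intro t ht
    induction ht using Submodule.span_induction with
    | zero => simp
    | add t t' _ _ ht ht' => rw [mul_add, add_mul]; exact add_mem ht ht'
    | smul r t _ ht => rw [mul_smul_comm, smul_mul_assoc]; exact Submodule.smul_mem _ _ ht
    | mem t ht =>
      obtain ⟨s, hs, rfl⟩ := ht
      refine Submodule.subset_span ⟨u ++ s ++ v, ?_, by simp [mul_assoc]⟩
      rw [Set.mem_ofPred, e]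
      exact wordRank_lt_of_mem_rewriteWords hs u v
  convert h2 _ h1 using 1
  rw [e', e]
  simp [rewriteRel, mul_sub, sub_mul, mul_assoc]

/-- The linear independence of the normal words in the theorem of Poincaré, Birkhoff and Witt: no
nonzero combination of normal words is in the ideal of relations. -/
theorem disjoint_normal_relSpan (hb : IsParityBasis b par) :
    Disjoint (Submodule.span k (tword b '' {l | Normal par l})) (relSpan k g) := by
  rw [Submodule.disjoint_def]
  intro x hx hx'
  obtain ⟨c, rfl⟩ := Finsupp.mem_span_range_iff_exists_finsupp.1
    (relSpan_le_span_chosenRel hb hx')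
  by_contra hne
  have hc : c.support.Nonempty := by
    rw [Finset.nonempty_iff_ne_empty, Ne, Finsupp.support_eq_empty]
    rintro rfl
    exact hne (by simp)
  obtain ⟨l, hl, hmax⟩ := Finset.exists_max_image c.support (fun l => wordRank l.1) hc
  -- the coefficient of the word `l`
  set B := b.tensorAlgebra with hB
  classical
  have hcoord : ∀ w : List ι, B.coord (FreeMonoid.ofList l.1) (tword b w) =
      if w = l.1 then 1 else 0 := by
    intro w
    rw [← tensorAlgebra_basis_apply, Basis.coord_apply, Basis.repr_self, Finsupp.single_apply]
    simp [FreeMonoid.ofList.injective.eq_iff]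
  have hzero : ∀ S : Set (List ι), l.1 ∉ S → ∀ t ∈ Submodule.span k (tword b '' S),
      B.coord (FreeMonoid.ofList l.1) t = 0 := by
    intro S hS t ht
    induction ht using Submodule.span_induction with
    | zero => simp
    | add t t' _ _ ht ht' => rw [map_add, ht, ht', add_zero]
    | smul r t _ ht => rw [map_smul, ht, smul_zero]
    | mem t ht =>
      obtain ⟨s, hs, rfl⟩ := ht
      rw [hcoord, if_neg (fun h : s = l.1 => hS (h ▸ hs))]
  have h0 := hzero _ l.2 _ hx
  rw [Finsupp.sum, map_sum, Finset.sum_eq_single l] at h0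
  · have h1 := hzero {w | wordRank w < wordRank l.1} (by simp) _ (tword_sub_chosenRel_mem hb l)
    rw [map_sub, sub_eq_zero, hcoord, if_pos rfl] at h1
    rw [map_smul, ← h1, smul_eq_mul, mul_one] at h0
    exact Finsupp.mem_support_iff.1 hl h0
  · intro l' hl' hne'
    have h1 := hzero {w | wordRank w < wordRank l'.1} (fun h => (hmax l' hl').not_gt h) _
      (tword_sub_chosenRel_mem hb l')
    rw [map_sub, sub_eq_zero, hcoord, if_neg (fun h => hne' (Subtype.ext h))] at h1
    rw [map_smul, ← h1, smul_zero]
  · exact fun h => absurd hl h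

end PBW

/-! ### Enveloping algebras and their filtration -/

section Words

variable {k : Type*} [Field k] {g : Type*} [AddCommGroup g] [Module k g]
variable {ι : Type*} {b : Basis ι k g} {par : ι → ZMod 2}
variable {U : Type*} [Ring U] [Algebra k U] {j : g →ₗ[k] U}

/-- The word `b_{a_1} ⋯ b_{a_n}` in the enveloping algebra. -/
abbrev eword (b : Basis ι k g) (j : g →ₗ[k] U) (l : List ι) : U := word (fun i => j (b i)) l

theorem lift_tword (l : List ι) : TensorAlgebra.lift k j (tword b l) = eword b j l := by
  simp [word, map_list_prod, Function.comp_def]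

/-- The parity of a word. -/
def wpar (par : ι → ZMod 2) (l : List ι) : ZMod 2 := (l.map par).sum

@[simp] theorem wpar_nil : wpar par [] = 0 := rfl

@[simp] theorem wpar_cons (a : ι) (l : List ι) : wpar par (a :: l) = par a + wpar par l := by
  simp [wpar]

@[simp] theorem wpar_append (l m : List ι) : wpar par (l ++ m) = wpar par l + wpar par m := by
  simp [wpar]

theorem wpar_perm {l m : List ι} (h : l.Perm m) : wpar par l = wpar par m :=
  (h.map par).sum_eq

theorem wpar_eq_zero {l : List ι} (h : ∀ s ∈ l, par s = 0) : wpar par l = 0 := by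
  rw [wpar, List.map_congr_left (g := fun _ => 0) h]
  simp

/-- The span of the words of parity `a` with fewer than `n` letters. -/
def fil (b : Basis ι k g) (par : ι → ZMod 2) (j : g →ₗ[k] U) (n : ℕ) (a : ZMod 2) :
    Submodule k U :=
  Submodule.span k (eword b j '' {l | l.length < n ∧ wpar par l = a})

theorem eword_mem_fil {l : List ι} {n : ℕ} (h : l.length < n) :
    eword b j l ∈ fil b par j n (wpar par l) :=
  Submodule.subset_span ⟨l, ⟨h, rfl⟩, rfl⟩

theorem eword_mem_fil_succ (l : List ι) : eword b j l ∈ fil b par j (l.length + 1) (wpar par l) :=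
  eword_mem_fil (Nat.lt_succ_self _)

theorem fil_zero (a : ZMod 2) : fil b par j 0 a = ⊥ := by
  simp [fil]

theorem fil_mono {m n : ℕ} (h : m ≤ n) (a : ZMod 2) : fil b par j m a ≤ fil b par j n a :=
  Submodule.span_mono (Set.image_mono fun _ hl => ⟨hl.1.trans_le h, hl.2⟩)

theorem mul_mem_fil {m n r : ℕ} {a c : ZMod 2} {x y : U} (hx : x ∈ fil b par j m a)
    (hy : y ∈ fil b par j n c) (h : m + n ≤ r + 1) : x * y ∈ fil b par j r (a + c) := by
  have h1 := Submodule.mul_mem_mul hx hy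
  rw [fil, fil, Submodule.span_mul_span] at h1
  refine Submodule.span_mono ?_ h1
  rintro _ ⟨_, ⟨l, ⟨hl, rfl⟩, rfl⟩, _, ⟨l', ⟨hl', rfl⟩, rfl⟩, rfl⟩
  refine ⟨l ++ l', ⟨by simp; omega, by simp⟩, by simp⟩

theorem exists_finset_letters {n : ℕ} {a : ZMod 2} {z : U} (hz : z ∈ fil b par j n a) :
    ∃ F : Finset ι, z ∈ Submodule.span k
      (eword b j '' {l | (l.length < n ∧ wpar par l = a) ∧ ∀ s ∈ l, s ∈ F}) := by
  classical
  induction hz using Submodule.span_induction with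
  | zero => exact ⟨∅, zero_mem _⟩
  | add t t' _ _ ht ht' =>
    obtain ⟨F, hF⟩ := ht
    obtain ⟨F', hF'⟩ := ht'
    refine ⟨F ∪ F', add_mem (Submodule.span_mono (Set.image_mono ?_) hF)
      (Submodule.span_mono (Set.image_mono ?_) hF')⟩
    · exact fun l hl => ⟨hl.1, fun s hs => Finset.mem_union_left _ (hl.2 s hs)⟩
    · exact fun l hl => ⟨hl.1, fun s hs => Finset.mem_union_right _ (hl.2 s hs)⟩
  | smul r t _ ht =>
    obtain ⟨F, hF⟩ := ht
    exact ⟨F, Submodule.smul_mem _ _ hF⟩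
  | mem u hu =>
    obtain ⟨l, hl, rfl⟩ := hu
    exact ⟨l.toFinset, Submodule.subset_span ⟨l, ⟨hl, by simp⟩, rfl⟩⟩

end Words

/-- `j : g → U` is an enveloping algebra of the Lie superalgebra `g`: it satisfies the defining
relations, generates `U`, and every relation follows from the defining ones. -/
structure IsEnveloping {k : Type*} [Field k] {g : Type*} [AddCommGroup g] [Module k g]
    [LieSuperalgebra k g] {U : Type*} [Ring U] [Algebra k U] (j : g →ₗ[k] U) : Prop where
  comm_eq_zero : ∀ {a b : ZMod 2} {x y : g}, x ∈ (gr a : Submodule k g) →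
    y ∈ (gr b : Submodule k g) → comm j a b x y = 0
  surjective : Function.Surjective (TensorAlgebra.lift k j)
  mem_relSpan : ∀ t, TensorAlgebra.lift k j t = 0 → t ∈ relSpan k g

section Filtration

variable {k : Type*} [Field k] {g : Type*} [AddCommGroup g] [Module k g] [LieSuperalgebra k g]
variable {ι : Type*} {b : Basis ι k g} {par : ι → ZMod 2}
variable {U : Type*} [Ring U] [Algebra k U] {j : g →ₗ[k] U}

theorem span_eword (hj : IsEnveloping j) :
    Submodule.span k (Set.range (eword b j)) = ⊤ := by
  have := congrArg (Submodule.map (TensorAlgebra.lift k j).toLinearMap) (span_tword (k := k) b)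
  rw [Submodule.map_span, Submodule.map_top, LinearMap.range_eq_top.2 hj.surjective,
    ← Set.range_comp] at this
  rw [← this]
  congr 2
  exact funext fun l => (lift_tword l).symm

theorem linearIndependent_normal [LinearOrder ι] (hb : IsParityBasis b par)
    (hj : IsEnveloping j) :
    LinearIndependent k (fun l : {l : List ι // Normal par l} => eword b j l.1) := by
  have h1 : LinearIndependent k (fun l : {l : List ι // Normal par l} => tword b l.1) :=
    (tword_linearIndependent b).comp _ Subtype.val_injective
  have h2 : Disjoint (Submodule.span k (Set.range
      (fun l : {l : List ι // Normal par l} => tword b l.1)))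
      (LinearMap.ker (TensorAlgebra.lift k j).toLinearMap) := by
    refine (disjoint_normal_relSpan hb).mono (Submodule.span_mono ?_)
      (fun t ht => hj.mem_relSpan t ht)
    rintro _ ⟨l, rfl⟩
    exact ⟨l.1, l.2, rfl⟩
  have h3 := h1.map h2
  rwa [show (fun l : {l : List ι // Normal par l} => eword b j l.1) =
    (TensorAlgebra.lift k j).toLinearMap ∘ fun l => tword b l.1 from
    funext fun l => (lift_tword l.1).symm]

theorem j_mem_fil (hb : IsParityBasis b par) {a : ZMod 2} {x : g}
    (hx : x ∈ (gr a : Submodule k g)) : j x ∈ fil b par j 2 a := by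
  rw [hb.gr_eq_span] at hx
  have h2 := Submodule.mem_map_of_mem (f := j) hx
  rw [Submodule.map_span] at h2
  refine Submodule.span_mono ?_ h2
  rintro _ ⟨_, ⟨t, ht, rfl⟩, rfl⟩
  exact ⟨[t], ⟨by simp, by simpa using ht⟩, by simp⟩

/-- Up to shorter words, homogeneous elements super commute. -/
theorem mul_sub_mul_mem_fil (hb : IsParityBasis b par) (hj : IsEnveloping j) {a c : ZMod 2}
    {x y : g} (hx : x ∈ (gr a : Submodule k g)) (hy : y ∈ (gr c : Submodule k g)) :
    j x * j y - sgn k a c • (j y * j x) ∈ fil b par j 2 (a + c) := by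
  have h := hj.comm_eq_zero hx hy
  rw [comm, sub_eq_zero] at h
  rw [h]
  exact j_mem_fil hb (bracket_mem hx hy)

/-- The spanning part of the theorem of Poincaré, Birkhoff and Witt. -/
theorem eword_mem_span_normal [LinearOrder ι] (hb : IsParityBasis b par) (hj : IsEnveloping j)
    (l : List ι) :
    eword b j l ∈ Submodule.span k (eword b j '' {m | Normal par m ∧ wpar par m = wpar par l ∧
      (m.length < l.length ∨ m.Perm l)}) := by
  suffices H : ∀ r : ℕ ×ₗ ℕ, ∀ l : List ι, wordRank l = r →
      eword b j l ∈ Submodule.span k (eword b j '' {m | Normal par m ∧ wpar par m = wpar par l ∧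
      (m.length < l.length ∨ m.Perm l)}) from H _ l rfl
  intro r
  induction r using WellFoundedLT.induction with
  | ind r ih =>
    rintro l rfl
    by_cases hl : Normal par l
    · exact Submodule.subset_span ⟨l, ⟨hl, rfl, Or.inr (List.Perm.refl _)⟩, rfl⟩
    obtain ⟨u, a, c, v, h, rfl⟩ := exists_bad_of_not_normal hl
    have h1 := bad_pair_sub_mem hb j h
    rw [hj.comm_eq_zero (hb.mem a) (hb.mem c), smul_zero, sub_zero] at h1
    have e : eword b j (u ++ a :: c :: v) = eword b j u * (j (b a) * j (b c)) * eword b j v := by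
      simp [mul_assoc]
    rw [e]
    generalize j (b a) * j (b c) = q at h1
    clear e
    induction h1 using Submodule.span_induction with
    | zero => simp
    | add t t' _ _ ht ht' => rw [mul_add, add_mul]; exact add_mem ht ht'
    | smul r t _ ht => rw [mul_smul_comm, smul_mul_assoc]; exact Submodule.smul_mem _ _ ht
    | mem t ht =>
      obtain ⟨s, hs, rfl⟩ := ht
      have h2 := ih _ (wordRank_lt_of_mem_rewriteWords hs u v) _ rfl
      rw [show eword b j u * eword b j s * eword b j v = eword b j (u ++ s ++ v) by
        simp [mul_assoc]]
      refine Submodule.span_mono (Set.image_mono ?_) h2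
      rintro m ⟨hm, hm', hm''⟩
      rcases hs with ⟨rfl, -⟩ | ⟨t, ht, rfl⟩
      · refine ⟨hm, hm'.trans ?_, ?_⟩
        · simp; ring
        · have hp : (u ++ [c, a] ++ v).Perm (u ++ a :: c :: v) := by
            simpa using List.Perm.append_left u (List.Perm.swap a c v)
          rcases hm'' with h | h
          · left; simpa using h
          · exact Or.inr (h.trans hp)
      · refine ⟨hm, hm'.trans ?_, ?_⟩
        · simp [ht]; ring
        · left
          rcases hm'' with h | h
          · simp at h ⊢; omega
          · have := h.length_eq
            simp at this ⊢; omega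

theorem fil_le_span_normal [LinearOrder ι] (hb : IsParityBasis b par) (hj : IsEnveloping j)
    (n : ℕ) (a : ZMod 2) :
    fil b par j n a ≤ Submodule.span k (eword b j '' {m | Normal par m ∧ m.length < n}) := by
  refine Submodule.span_le.2 ?_
  rintro _ ⟨l, ⟨hl, -⟩, rfl⟩
  refine Submodule.span_mono (Set.image_mono ?_) (eword_mem_span_normal hb hj l)
  rintro m ⟨hm, -, h | h⟩
  · exact ⟨hm, h.trans hl⟩
  · exact ⟨hm, h.length_eq ▸ hl⟩

/-- Normal words of length `n` are linearly independent modulo words of smaller length. -/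
theorem eq_zero_of_linearCombination_mem_fil [LinearOrder ι] (hb : IsParityBasis b par)
    (hj : IsEnveloping j) {n : ℕ} {a : ZMod 2} {c : List ι →₀ k}
    (hc : ∀ l ∈ c.support, Normal par l ∧ l.length = n)
    (h : Finsupp.linearCombination k (eword b j) c ∈ fil b par j n a) : c = 0 := by
  have hind := linearIndependent_normal hb hj
  have h1 := fil_le_span_normal hb hj n a h
  have h2 : Finsupp.linearCombination k (eword b j) c ∈
      Submodule.span k (eword b j '' {m | Normal par m ∧ m.length = n}) :=
    Finsupp.mem_span_image_iff_linearCombination k |>.2 ⟨c, fun l hl => hc l hl, rfl⟩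
  have hd := hind.disjoint_span_image (s := {m | m.1.length < n}) (t := {m | m.1.length = n})
    (Set.disjoint_left.2 fun m hm hm' => by
      simp only [Set.mem_ofPred] at hm hm'; omega)
  have him : ∀ P : List ι → Prop, (fun l : {l : List ι // Normal par l} => eword b j l.1) ''
      {m | P m.1} = eword b j '' {m | Normal par m ∧ P m} := by
    intro P
    ext x
    constructor
    · rintro ⟨m, hm, rfl⟩
      exact ⟨m.1, ⟨m.2, hm⟩, rfl⟩
    · rintro ⟨m, ⟨hm, hm'⟩, rfl⟩
      exact ⟨⟨m, hm⟩, hm', rfl⟩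
  rw [him (fun m => m.length < n), him (fun m => m.length = n)] at hd
  have h0 := Submodule.disjoint_def.1 hd _ h1 h2
  have hind' : LinearIndepOn k (eword b j) {m | Normal par m} := hind
  exact linearIndepOn_iff.1 hind' c (fun l hl => (hc l hl).1) h0

theorem IsEnveloping.injective (hb : IsParityBasis b par) (hj : IsEnveloping j) :
    Function.Injective j := by
  classical
  let : LinearOrder ι := linearOrderOfSTO WellOrderingRel
  have hind := linearIndependent_normal hb hj
  have h1 : LinearIndependent k (fun i => j (b i)) := by
    have := hind.comp (fun i : ι => ⟨[i], List.pairwise_singleton _ _⟩) (fun i i' h => by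
      simpa using congrArg Subtype.val h)
    simpa [Function.comp_def] using this
  have h2 := b.injective_constr_of_linearIndependent (R₂ := k) h1
  rwa [show (b.constr k fun i => j (b i)) = j from b.ext fun i => by simp] at h2

end Filtration

/-! ### Polarization of words -/

section Polar

variable (k : Type*) [Field k] {ι : Type*} (par : ι → ZMod 2)
variable {M : Type*} [AddCommGroup M] [Module k M]

/-- The polarization of a word: the sum of `± f s w` over all ways of moving one of its letters `s`
to the front, leaving the word `w`, with the sign that this costs in a supercommutative algebra. -/
def polar : List ι → (ι → List ι → M) → M
  | [], _ => 0
  | a :: l, f => f a l + polar l (fun s w => sgn k (par a) (par s) • f s (a :: w))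

variable {k par}

theorem polar_mem {S : Submodule k M} {l : List ι} {f : ι → List ι → M}
    (h : ∀ s w, (s :: w).Perm l → w.Sublist l → f s w ∈ S) : polar k par l f ∈ S := by
  induction l generalizing f with
  | nil => exact zero_mem S
  | cons a l ih =>
    refine add_mem (h a l (List.Perm.refl _) (List.sublist_cons_self a l)) (ih fun s w hp hs => ?_)
    exact S.smul_mem _ (h s (a :: w) ((List.Perm.swap a s w).trans (hp.cons a)) (hs.cons_cons a))

theorem map_polar {N : Type*} [AddCommGroup N] [Module k N] (L : M →ₗ[k] N) (l : List ι)
    (f : ι → List ι → M) : L (polar k par l f) = polar k par l fun s w => L (f s w) := by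
  induction l generalizing f with
  | nil => exact map_zero L
  | cons a l ih => simp [polar, ih]

theorem polar_sub (l : List ι) (f f' : ι → List ι → M) :
    polar k par l f - polar k par l f' = polar k par l fun s w => f s w - f' s w := by
  induction l generalizing f f' with
  | nil => simp [polar]
  | cons a l ih => simp only [polar, smul_sub, ← ih]; abel

theorem polar_eq_linearCombination (l : List ι) (f : ι → List ι → M) :
    polar k par l f = Finsupp.linearCombination k (fun x : ι × List ι => f x.1 x.2)
      (polar k par l fun s w => Finsupp.single (s, w) 1) := by
  rw [map_polar]; simp

theorem polar_congr {l : List ι} {f f' : ι → List ι → M}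
    (h : ∀ s w, (s :: w).Perm l → f s w = f' s w) : polar k par l f = polar k par l f' := by
  rw [← sub_eq_zero, polar_sub, ← Submodule.mem_bot k]
  exact polar_mem fun s w hp _ => by simp [h s w hp]

variable [LinearOrder ι]

theorem Normal.count_eq_one {l : List ι} (h : Normal par l) {s : ι} (hs : s ∈ l)
    (hodd : par s = 1) : l.count s = 1 := by
  induction l with
  | nil => simp at hs
  | cons a l ih =>
    rw [Normal, List.pairwise_cons] at h
    by_cases ha : a = s
    · subst ha
      have : a ∉ l := fun hl => h.1 a hl (Or.inr ⟨rfl, hodd⟩)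
      rw [List.count_cons_self, List.count_eq_zero.2 this]
    · rw [List.count_cons_of_ne ha]
      exact ih h.2 (by simpa [Ne.symm ha] using hs)

/-- The coefficient of `s ⊗ w` in the polarization of a normal word `s w` is, up to sign, the
multiplicity of `s`. -/
theorem polar_indicator {l : List ι} (h : Normal par l) {s : ι} (hs : s ∈ l) :
    ∃ η : k, η ≠ 0 ∧ (par s = 0 → η = 1) ∧
      polar k par l (fun s' w' => if s' = s ∧ w' = l.erase s then (1 : k) else 0) =
        η * l.count s := by
  induction l with
  | nil => simp at hs
  | cons a l ih =>
    have h' := List.pairwise_cons.1 h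
    by_cases ha : a = s
    · subst ha
      refine ⟨1, one_ne_zero, fun _ => rfl, ?_⟩
      by_cases hl : a ∈ l
      · have heven : par a = 0 := by
          rcases zmod_two_eq (par a) with e | e
          · exact e
          · exact absurd (Or.inr ⟨rfl, e⟩) (h'.1 a hl)
        obtain ⟨η, -, hη, hη'⟩ := ih h'.2 hl
        -- as `a` is the least letter of `l`, it is the first one
        have hcons : a :: l.erase a = l := by
          cases l with
          | nil => simp at hl
          | cons d l =>
            have hd : a ≤ d := not_lt.1 fun hlt => h'.1 d (by simp) (Or.inl hlt)
            have hd' : d ≤ a := by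
              rcases List.mem_cons.1 hl with rfl | hm
              · exact le_rfl
              · exact not_lt.1 fun hlt => (List.pairwise_cons.1 h'.2).1 a hm (Or.inl hlt)
            have : d = a := le_antisymm hd' hd
            subst this
            simp
        have he : ∀ w, a :: w = l ↔ w = l.erase a := fun w => by
          constructor
          · rintro rfl; simp
          · rintro rfl; exact hcons
        simp only [polar, List.erase_cons_head, and_self, if_true, heven, sgn_zero_left, one_smul,
          he, hη', hη heven, List.count_cons_self]
        push_cast
        ring
      · have h0 : polar k par l (fun s' w' => sgn k (par a) (par s') •
            if s' = a ∧ a :: w' = l then (1 : k) else 0) = 0 := by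
          rw [← Submodule.mem_bot k]
          refine polar_mem fun s w hp _ => ?_
          rw [if_neg, smul_zero]
          · exact zero_mem _
          · rintro ⟨rfl, -⟩
            exact hl (hp.subset (by simp))
        simp only [polar, List.erase_cons_head, and_self, if_true, h0, List.count_cons_self,
          List.count_eq_zero.2 hl]
        simp
    · obtain ⟨η, hη, hη', e⟩ := ih h'.2 (by simpa [Ne.symm ha] using hs)
      refine ⟨sgn k (par a) (par s) * η, mul_ne_zero (sgn_ne_zero _ _) hη,
        fun h0 => by simp [h0, hη' h0], ?_⟩
      rw [List.count_cons_of_ne ha, mul_assoc, ← e, List.erase_cons_tail (by simpa using ha)]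
      simp only [polar, ha, false_and, if_false, zero_add, List.cons.injEq, true_and]
      rw [← smul_eq_mul, ← LinearMap.lsmul_apply (R := k) (M := k), map_polar]
      refine polar_congr fun s' w' _ => ?_
      by_cases hs' : s' = s
      · subst hs'; simp
      · simp [hs']

end Polar

/-! ### Commutators in the enveloping algebra up to shorter words -/

section Commutator

variable {k : Type*} [Field k] {g : Type*} [AddCommGroup g] [Module k g] [LieSuperalgebra k g]
variable {ι : Type*} {b : Basis ι k g} {par : ι → ZMod 2}
variable {U : Type*} [Ring U] [Algebra k U] {j : g →ₗ[k] U}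

/-- Up to shorter words, the super commutator with `y` is the derivation that extends `[y, -]`;
it is written by means of the polarization, with a sign that does not depend on `y`. -/
theorem superCommutator_eword (hb : IsParityBasis b par) (hj : IsEnveloping j) {γ : ZMod 2}
    {y : g} (hy : y ∈ (gr γ : Submodule k g)) (l : List ι) :
    j y * eword b j l - sgn k γ (wpar par l) • (eword b j l * j y) -
      polar k par l (fun s w => j (bracket (k := k) y (b s)) * eword b j w) ∈
      fil b par j l.length (γ + wpar par l) := by
  induction l with
  | nil => simp [polar]
  | cons a l ih =>
    have h1 := hj.comm_eq_zero hy (hb.mem a)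
    have h2 : j (b a) * (j y * eword b j l - sgn k γ (wpar par l) • (eword b j l * j y) -
        polar k par l (fun s w => j (bracket (k := k) y (b s)) * eword b j w)) ∈
        fil b par j (l.length + 1) (par a + (γ + wpar par l)) :=
      mul_mem_fil (j_mem_fil hb (hb.mem a)) ih (by omega)
    have h3 : polar k par l (fun s w =>
        sgn k γ (par a) • (j (b a) * (j (bracket (k := k) y (b s)) * eword b j w)) -
        sgn k (par a) (par s) • (j (bracket (k := k) y (b s)) * eword b j (a :: w))) ∈
        fil b par j (l.length + 1) (par a + (γ + wpar par l)) := by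
      refine polar_mem fun s w hp _ => ?_
      have h4 := mul_mem_fil (r := l.length + 1)
        (mul_sub_mul_mem_fil hb hj (hb.mem a) (bracket_mem hy (hb.mem s)))
        (eword_mem_fil_succ (b := b) (par := par) (j := j) w)
        (by have := hp.length_eq; simp at this; omega)
      have e : par a + (γ + par s) + wpar par w = par a + (γ + wpar par l) := by
        rw [← wpar_perm hp, wpar_cons]; ring
      rw [e] at h4
      convert Submodule.smul_mem _ (sgn k γ (par a)) h4 using 1
      have hs : sgn k γ (par a) * (sgn k γ (par a) * sgn k (par a) (par s)) =
          sgn k (par a) (par s) := by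
        rw [← mul_assoc, sgn_mul_self, one_mul]
      rw [sub_mul, smul_sub, smul_mul_assoc, smul_smul, sgn_add_right, sgn_comm k (par a) γ, hs,
        mul_assoc, mul_assoc, ← word_cons (fun i => j (b i))]
    have h2' := Submodule.smul_mem _ (sgn k γ (par a)) h2
    rw [wpar_cons, List.length_cons, ← add_assoc, add_comm γ, add_assoc]
    convert add_mem h2' h3 using 1
    rw [← polar_sub]
    have e1 : polar k par l (fun s w =>
        sgn k γ (par a) • (j (b a) * (j (bracket (k := k) y (b s)) * eword b j w))) =
        sgn k γ (par a) • (j (b a) *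
          polar k par l (fun s w => j (bracket (k := k) y (b s)) * eword b j w)) := by
      have := map_polar (k := k) (par := par)
        (sgn k γ (par a) • LinearMap.mulLeft k (j (b a))) l
        (fun s w => j (bracket (k := k) y (b s)) * eword b j w)
      simpa using this.symm
    rw [e1, polar, sgn_add_right, eword, word_cons, ← mul_assoc]
    rw [comm, sub_eq_zero, sub_eq_iff_eq_add] at h1
    rw [h1]
    simp only [mul_sub, smul_sub, add_mul, smul_mul_assoc, mul_smul_comm, smul_smul, mul_assoc]
    abel

theorem superCommutator_mem_fil (hb : IsParityBasis b par) (hj : IsEnveloping j) {γ a : ZMod 2}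
    {y : g} (hy : y ∈ (gr γ : Submodule k g)) {n : ℕ} {x : U} (hx : x ∈ fil b par j n a) :
    j y * x - sgn k γ a • (x * j y) ∈ fil b par j n (γ + a) := by
  induction hx using Submodule.span_induction with
  | zero => simp
  | add t t' _ _ ht ht' =>
    convert add_mem ht ht' using 1
    simp only [mul_add, add_mul, smul_add]
    abel
  | smul r t _ ht =>
    convert Submodule.smul_mem _ r ht using 1
    simp only [smul_sub, mul_smul_comm, smul_mul_assoc, smul_comm r (sgn k γ a)]
  | mem x hx =>
    obtain ⟨l, ⟨hl, rfl⟩, rfl⟩ := hx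
    have h1 := fil_mono hl.le _ (superCommutator_eword hb hj hy l)
    have h2 : polar k par l (fun s w => j (bracket (k := k) y (b s)) * eword b j w) ∈
        fil b par j n (γ + wpar par l) := by
      refine polar_mem fun s w hp _ => ?_
      have h4 := mul_mem_fil (r := n) (j_mem_fil hb (bracket_mem hy (hb.mem s)))
        (eword_mem_fil_succ (b := b) (par := par) (j := j) w)
        (by have := hp.length_eq; simp at this; omega)
      rwa [← wpar_perm hp, wpar_cons, ← add_assoc]
    simpa using add_mem h1 h2

/-- Words in even letters that differ by a permutation agree up to shorter words. -/
theorem eword_sub_mem_fil_of_perm (hb : IsParityBasis b par) (hj : IsEnveloping j)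
    {l m : List ι} (h : l.Perm m) (heven : ∀ s ∈ l, par s = 0) :
    eword b j l - eword b j m ∈ fil b par j l.length 0 := by
  induction h with
  | nil => simp
  | @cons a l l' h ih =>
    have h1 := mul_mem_fil (r := l.length + 1) (j_mem_fil hb (hb.mem a))
      (ih fun s hs => heven s (by simp [hs])) (by omega)
    rw [heven a (by simp), zero_add] at h1
    simpa [mul_sub] using h1
  | swap a c l =>
    have hc : par c = 0 := heven c (by simp)
    have ha : par a = 0 := heven a (by simp)
    have hl : wpar par l = 0 := by
      rw [wpar, List.map_congr_left (g := fun _ => 0) (fun s hs => heven s (by simp [hs]))]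
      simp
    have h1 := mul_mem_fil (mul_sub_mul_mem_fil hb hj (hb.mem c) (hb.mem a))
      (eword_mem_fil_succ (b := b) (par := par) (j := j) l) (r := l.length + 2) (by omega)
    simpa [hc, ha, hl, sub_mul, mul_assoc] using h1
  | trans h h' ih ih' =>
    have h1 := ih heven
    have h2 := ih' fun s hs => heven s (h.mem_iff.2 hs)
    rw [← h.length_eq] at h2
    simpa using add_mem h1 h2

/-- The condition on a Lie superalgebra with basis `b` from which its enveloping algebra gets a
small center: a finite combination `v` of basis vectors in `F` is killed by all basis vectors that
map `F` to combinations of vectors outside `F` only if `v` involves only basis vectors in `J`. -/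
def Separating (b : Basis ι k g) (J : Set ι) : Prop :=
  ∀ (F : Finset ι) (v : g), (∀ t, t ∉ F → b.repr v t = 0) →
    (∀ q, (∀ s ∈ F, ∀ t ∈ F, b.repr (bracket (k := k) (b q) (b s)) t = 0) →
      bracket (k := k) (b q) v = 0) → ∀ s, s ∉ J → b.repr v s = 0

/-- The leading words of an element that super commutes with `g`: if `F` is the set of their
letters and the other basis vectors come before `F`, then letters outside `J` are even, and their
multiplicities vanish in `k`. Bracketing with a basis vector that maps `F` off `F` replaces one
letter of a leading word by a smaller new letter in front, so that the results stay linearly independent;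
their coefficients are those of the polarization `Θ` of the leading part. -/
theorem count_eq_zero_of_superCentral [LinearOrder ι] (hb : IsParityBasis b par)
    (hj : IsEnveloping j) {J : Set ι} (hsep : Separating b J) (F : Finset ι)
    (hF : ∀ t ∉ F, ∀ s ∈ F, t < s) {n : ℕ} {a : ZMod 2} {c : List ι →₀ k}
    (hc : ∀ l ∈ c.support, Normal par l ∧ l.length = n ∧ wpar par l = a ∧ ∀ s ∈ l, s ∈ F)
    {r : U} (hr : r ∈ fil b par j n a)
    (hcomm : ∀ q, j (b q) * (Finsupp.linearCombination k (eword b j) c + r) =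
      sgn k (par q) a • ((Finsupp.linearCombination k (eword b j) c + r) * j (b q)))
    {l : List ι} (hl : l ∈ c.support) {s : ι} (hs : s ∈ l) (hsJ : s ∉ J) :
    par s = 0 ∧ (l.count s : k) = 0 := by
  classical
  -- the polarization of the leading part, as a combination of the symbols `s ⊗ w`
  set Θ : ι × List ι →₀ k := Finsupp.linearCombination k
    (fun l => polar k par l fun s w => Finsupp.single (s, w) (1 : k)) c with hΘ
  have hΘsupp : Θ ∈ Finsupp.supported k k
      {x : ι × List ι | ∃ l ∈ c.support, (x.1 :: x.2).Perm l ∧ x.2.Sublist l} := by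
    rw [hΘ, Finsupp.linearCombination_apply, Finsupp.sum]
    refine Submodule.sum_mem _ fun l hl => Submodule.smul_mem _ _ (polar_mem fun s w hp hsub => ?_)
    exact Finsupp.single_mem_supported _ _ ⟨l, hl, hp, hsub⟩
  -- the vector that collects the coefficients of `s ⊗ w`, for fixed `w`
  let P : List ι → (ι × List ι →₀ k) →ₗ[k] g := fun w =>
    Finsupp.linearCombination k fun x => if x.2 = w then b x.1 else 0
  have hP : ∀ w s, b.repr (P w Θ) s = Θ (s, w) := by
    intro w s
    suffices H : (Finsupp.lapply s ∘ₗ b.repr.toLinearMap ∘ₗ P w : (ι × List ι →₀ k) →ₗ[k] k) =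
        Finsupp.lapply (s, w) from LinearMap.congr_fun H Θ
    refine Finsupp.lhom_ext' fun x => LinearMap.ext_ring ?_
    obtain ⟨s', w'⟩ := x
    by_cases hw : w' = w
    · simp [P, hw, Finsupp.single_apply]
    · simp [P, hw]
  have hkey : ∀ w s, s ∉ J → Θ (s, w) = 0 := by
    intro w s hs
    rw [← hP]
    refine hsep F (P w Θ) (fun t ht => ?_) (fun q hq => ?_) s hs
    · rw [hP]
      by_contra hne
      obtain ⟨l, hl, hp, -⟩ := hΘsupp (Finsupp.mem_support_iff.2 hne)
      exact ht ((hc l hl).2.2.2 t (hp.subset (by simp)))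
    · -- the leading part of the super commutator with `b q`
      let f : ι × List ι → (List ι →₀ k) := fun x =>
        (b.repr (bracket (k := k) (b q) (b x.1))).mapDomain (· :: x.2)
      set Ξ := Finsupp.linearCombination k f Θ with hΞ
      have hfe : ∀ x, Finsupp.linearCombination k (eword b j) (f x) =
          j (bracket (k := k) (b q) (b x.1)) * eword b j x.2 := by
        intro x
        simp only [f]
        rw [Finsupp.linearCombination_mapDomain]
        conv_rhs => rw [← b.linearCombination_repr (bracket (k := k) (b q) (b x.1))]
        rw [Finsupp.apply_linearCombination, Finsupp.linearCombination_apply,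
          Finsupp.linearCombination_apply, Finsupp.sum, Finsupp.sum, Finset.sum_mul]
        exact Finset.sum_congr rfl fun i _ => by simp
      have hΞmem : Finsupp.linearCombination k (eword b j) Ξ ∈ fil b par j n (par q + a) := by
        have e1 : Finsupp.linearCombination k (eword b j) Ξ = Finsupp.linearCombination k
            (fun l => polar k par l
              fun s w => j (bracket (k := k) (b q) (b s)) * eword b j w) c := by
          rw [hΞ, Finsupp.apply_linearCombination, hΘ, Finsupp.apply_linearCombination]
          congr 2
          funext l
          refine Eq.trans ?_ (polar_eq_linearCombination l _).symm
          rw [Function.comp_apply]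
          congr 2
          funext x
          exact hfe x
        have h1 : ∀ l ∈ c.support, c l • (j (b q) * eword b j l -
            sgn k (par q) a • (eword b j l * j (b q)) - polar k par l
              (fun s w => j (bracket (k := k) (b q) (b s)) * eword b j w)) ∈
            fil b par j n (par q + a) := by
          intro l hl
          obtain ⟨-, h1, h2, -⟩ := hc l hl
          have := superCommutator_eword hb hj (hb.mem q) l
          rw [h1, h2] at this
          exact Submodule.smul_mem _ _ this
        have h2 := Submodule.sum_mem _ h1
        have h3 := superCommutator_mem_fil hb hj (hb.mem q) hr
        have h4 := sub_eq_zero.2 (hcomm q)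
        rw [e1]
        convert neg_mem (add_mem h2 h3) using 1
        rw [eq_neg_iff_add_eq_zero, ← h4]
        simp only [Finsupp.linearCombination_apply, Finsupp.sum, mul_add, add_mul, smul_add,
          smul_sub, Finset.sum_sub_distrib, Finset.mul_sum, Finset.sum_mul, Finset.smul_sum,
          mul_smul_comm, smul_mul_assoc, smul_comm (sgn k (par q) a)]
        abel
      -- all words in `Ξ` are normal: their first letter is outside `F`, the others are in `F`
      have hΞ0 : Ξ = 0 := by
        refine eq_zero_of_linearCombination_mem_fil hb hj (n := n) (fun m hm => ?_) hΞmem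
        have : Ξ ∈ Finsupp.supported k k {m : List ι | Normal par m ∧ m.length = n} := by
          rw [hΞ, Finsupp.linearCombination_apply, Finsupp.sum]
          refine Submodule.sum_mem _ fun x hx => Submodule.smul_mem _ _ ?_
          obtain ⟨l, hl, hp, hsub⟩ := hΘsupp hx
          obtain ⟨hn, hlen, -, hlF⟩ := hc l hl
          intro m hm
          obtain ⟨t, ht, rfl⟩ := Finset.mem_image.1 (Finsupp.mapDomain_support hm)
          have htF : t ∉ F := fun htF => Finsupp.mem_support_iff.1 ht
            (hq x.1 (hlF _ (hp.subset (by simp))) t htF)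
          refine ⟨List.pairwise_cons.2 ⟨fun s hs => ?_, List.Pairwise.sublist hsub hn⟩, ?_⟩
          · exact not_bad_iff.2 (Or.inl (hF t htF s (hlF s (hsub.subset hs))))
          · have := hp.length_eq
            simp at this ⊢; omega
        exact this hm
      refine b.repr.injective (Finsupp.ext fun t => ?_)
      rw [map_zero, Finsupp.zero_apply]
      have hΞt : Ξ (t :: w) = b.repr (bracket (k := k) (b q) (P w Θ)) t := by
        suffices H : (Finsupp.lapply (t :: w) ∘ₗ Finsupp.linearCombination k f :
            (ι × List ι →₀ k) →ₗ[k] k) =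
            Finsupp.lapply t ∘ₗ b.repr.toLinearMap ∘ₗ bracket (k := k) (b q) ∘ₗ P w from
          LinearMap.congr_fun H Θ
        refine Finsupp.lhom_ext' fun x => LinearMap.ext_ring ?_
        obtain ⟨s', w'⟩ := x
        by_cases hw : w' = w
        · subst hw
          have := Finsupp.mapDomain_apply (f := (· :: w'))
            (fun t t' h => by simpa using h) (b.repr (bracket (k := k) (b q) (b s'))) t
          simpa [P, f] using this
        · have := Finsupp.mapDomain_of_notMem_range (f := (· :: w'))
            (b.repr (bracket (k := k) (b q) (b s'))) (t :: w) (by simp [hw])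
          simpa [P, f, hw] using this
      rw [← hΞt, hΞ0, Finsupp.zero_apply]
  have hΘl : Θ (s, l.erase s) = c l * polar k par l
      (fun s' w' => if s' = s ∧ w' = l.erase s then (1 : k) else 0) := by
    have hterm : ∀ l', (polar k par l' fun s w => Finsupp.single (s, w) (1 : k)) (s, l.erase s) =
        polar k par l' (fun s' w' => if s' = s ∧ w' = l.erase s then (1 : k) else 0) := by
      intro l'
      have := map_polar (k := k) (par := par) (Finsupp.lapply (s, l.erase s)) l'
        (fun s w => Finsupp.single (s, w) (1 : k))
      simpa [Finsupp.single_apply] using this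
    rw [hΘ, Finsupp.linearCombination_apply, Finsupp.sum, Finsupp.finsetSum_apply,
      Finset.sum_eq_single l]
    · rw [Finsupp.smul_apply, hterm, smul_eq_mul]
    · intro l' hl' hne
      rw [Finsupp.smul_apply, hterm]
      have h0 : polar k par l'
          (fun s' w' => if s' = s ∧ w' = l.erase s then (1 : k) else 0) = 0 := by
        rw [← Submodule.mem_bot k]
        refine polar_mem fun s' w' hp _ => ?_
        rw [if_neg]
        · exact zero_mem _
        · rintro ⟨rfl, rfl⟩
          exact hne ((hc l' hl').1.eq_of_perm (hc l hl).1
            (hp.symm.trans (List.perm_cons_erase hs).symm))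
      rw [h0, smul_zero]
    · exact fun h => absurd hl h
  obtain ⟨η, hη, -, e⟩ := polar_indicator (k := k) (hc l hl).1 hs
  rw [hkey _ s hsJ, e] at hΘl
  have hcount : (l.count s : k) = 0 := by
    simpa [Finsupp.mem_support_iff.1 hl, hη] using hΘl.symm
  refine ⟨?_, hcount⟩
  -- an odd letter of a normal word has multiplicity `1`, which is not zero in `k`
  rcases zmod_two_eq (par s) with h0 | h1
  · exact h0
  · rw [(hc l hl).1.count_eq_one hs h1] at hcount
    simp at hcount

end Commutator

/-! ### The central generators and their monomials -/

section Center

variable {k : Type*} [Field k] {g : Type*} [AddCommGroup g] [Module k g] [LieSuperalgebra k g]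
variable {ι : Type*} {b : Basis ι k g} {par : ι → ZMod 2}
variable {U : Type*} [Ring U] [Algebra k U] {j : g →ₗ[k] U} {α β : Type*}

/-- An element that commutes with `g` is central in the enveloping algebra. -/
theorem IsEnveloping.commute_of_commute (b : Basis ι k g) (hj : IsEnveloping j) {z : U}
    (hz : ∀ i, Commute z (j (b i))) (u : U) : Commute z u := by
  have hu : u ∈ Submodule.span k (Set.range (eword b j)) := span_eword hj ▸ Submodule.mem_top
  induction hu using Submodule.span_induction with
  | zero => exact Commute.zero_right z
  | add t t' _ _ ht ht' => exact ht.add_right ht'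
  | smul r t _ ht => exact ht.smul_right r
  | mem u hu =>
    obtain ⟨l, rfl⟩ := hu
    refine Commute.list_prod_right _ _ fun x hx => ?_
    obtain ⟨i, -, rfl⟩ := List.mem_map.1 hx
    exact hz i

/-- Commuting `p` times with an element of an associative algebra of characteristic `p` is
commuting with its `p`-th power. -/
theorem ad_pow_char {U : Type*} [Ring U] [Algebra k U] (p : ℕ) [Fact p.Prime] [CharP k p]
    (x u : U) :
    ((LinearMap.mulLeft k x - LinearMap.mulRight k x) ^ p) u = x ^ p * u - u * x ^ p := by
  rcases subsingleton_or_nontrivial U with h | h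
  · exact Subsingleton.elim _ _
  have : CharP (Module.End k U) p :=
    charP_of_injective_algebraMap (algebraMap k (Module.End k U)).injective p
  rw [sub_pow_char_of_commute _ (LinearMap.commute_mulLeft_right x x),
    LinearMap.pow_mulLeft, LinearMap.pow_mulRight]
  simp

theorem ad_pow_apply (hb : IsParityBasis b par) (hj : IsEnveloping j) {x : g}
    (hx : x ∈ (gr 0 : Submodule k g)) (n : ℕ) (y : g) :
    j ((ad k g x ^ n) y) =
      ((LinearMap.mulLeft k (j x) - LinearMap.mulRight k (j x)) ^ n) (j y) := by
  have h1 : ∀ y, j (bracket (k := k) x y) = j x * j y - j y * j x := by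
    intro y
    suffices H : j ∘ₗ bracket (k := k) x =
        (LinearMap.mulLeft k (j x) - LinearMap.mulRight k (j x)) ∘ₗ j by
      simpa using LinearMap.congr_fun H y
    refine b.ext fun i => ?_
    have := hj.comm_eq_zero hx (hb.mem i)
    rw [comm, sgn_zero_left, one_smul, sub_eq_zero] at this
    simpa using this.symm
  induction n generalizing y with
  | zero => simp
  | succ n ih => rw [pow_succ, pow_succ, Module.End.mul_apply, Module.End.mul_apply, ih]; simp [h1]

/-- The elements `x ^ p - x^[p]` are central. -/
theorem commute_pow_sub (hb : IsParityBasis b par) (hj : IsEnveloping j) (p : ℕ) [Fact p.Prime]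
    [CharP k p] {x y : g} (hx : x ∈ (gr 0 : Submodule k g)) (hy : y ∈ (gr 0 : Submodule k g))
    (h : ad k g y = ad k g x ^ p) (u : U) : Commute (j x ^ p - j y) u := by
  refine hj.commute_of_commute b (fun i => ?_) u
  have h1 := ad_pow_apply hb hj hx p (b i)
  have h2 := ad_pow_apply hb hj hy 1 (b i)
  rw [ad_pow_char, ← h] at h1
  rw [pow_one, h1] at h2
  simp only [pow_one, LinearMap.sub_apply, LinearMap.mulLeft_apply,
    LinearMap.mulRight_apply] at h2
  rw [Commute, SemiconjBy, sub_mul, mul_sub, sub_eq_sub_iff_sub_eq_sub, h2]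

/-- The generators of the center: central basis vectors, and the elements `x ^ p - x^[p]` for the
other even basis vectors `x`; here `y c` is the `p`-th power of the basis vector of index `jC c`. -/
def centralGen (b : Basis ι k g) (j : g →ₗ[k] U) (p : ℕ) (jJ : α → ι) (jC : β → ι) (y : β → g) :
    α ⊕ β → U :=
  Sum.elim (fun a => j (b (jJ a))) (fun c => j (b (jC c)) ^ p - j (y c))

/-- The leading word of a generator of the center: a letter, or `p` copies of a letter. -/
def genWord (p : ℕ) (jJ : α → ι) (jC : β → ι) : α ⊕ β → List ι :=
  Sum.elim (fun a => [jJ a]) (fun c => List.replicate p (jC c))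

/-- The hypotheses on the indices of the generators: `jJ` enumerates the basis vectors that generate
the center of `g`, `jC` the other even basis vectors, and `y c` is a `p`-th power of the basis
vector of index `jC c`. -/
structure IsCentralIndexing (b : Basis ι k g) (par : ι → ZMod 2) (p : ℕ) (jJ : α → ι) (jC : β → ι)
    (y : β → g) : Prop where
  injective_left : Function.Injective jJ
  injective_right : Function.Injective jC
  disjoint : ∀ a c, jJ a ≠ jC c
  par_left : ∀ a, par (jJ a) = 0
  par_right : ∀ c, par (jC c) = 0
  mem_range : ∀ i, par i = 0 → i ∈ Set.range jJ ∨ i ∈ Set.range jC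
  bracket_left : ∀ a, bracket (k := k) (b (jJ a)) = 0
  mem_even : ∀ c, y c ∈ (gr 0 : Submodule k g)
  ad_pow : ∀ c, ad k g (y c) = ad k g (b (jC c)) ^ p

variable {p : ℕ} {jJ : α → ι} {jC : β → ι} {y : β → g}

theorem commute_centralGen [Fact p.Prime] [CharP k p] (hb : IsParityBasis b par)
    (hj : IsEnveloping j) (hI : IsCentralIndexing b par p jJ jC y) (x : α ⊕ β) (u : U) :
    Commute (centralGen b j p jJ jC y x) u := by
  rcases x with a | c
  · refine hj.commute_of_commute b (fun i => ?_) u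
    have := hj.comm_eq_zero (hb.mem (jJ a)) (hb.mem i)
    rwa [comm, hI.par_left, hI.bracket_left, sgn_zero_left, one_smul, LinearMap.zero_apply,
      map_zero, sub_zero, sub_eq_zero] at this
  · have h := hb.mem (jC c)
    rw [hI.par_right] at h
    exact commute_pow_sub hb hj p h (hI.mem_even c) (hI.ad_pow c) u

theorem par_of_mem_genWord (hI : IsCentralIndexing b par p jJ jC y) {L : List (α ⊕ β)} {s : ι}
    (hs : s ∈ L.flatMap (genWord p jJ jC)) : par s = 0 := by
  obtain ⟨x, -, hx⟩ := List.mem_flatMap.1 hs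
  rcases x with a | c
  · simp only [genWord, Sum.elim_inl, List.mem_singleton] at hx
    rw [hx, hI.par_left]
  · rw [List.eq_of_mem_replicate hx, hI.par_right]

/-- A product of generators of the center is, up to shorter words, the product of their leading
words. -/
theorem prod_centralGen_sub_mem_fil [Fact p.Prime] (hb : IsParityBasis b par)
    (hI : IsCentralIndexing b par p jJ jC y) (L : List (α ⊕ β)) :
    (L.map (centralGen b j p jJ jC y)).prod - eword b j (L.flatMap (genWord p jJ jC)) ∈
      fil b par j (L.flatMap (genWord p jJ jC)).length 0 := by
  induction L with
  | nil => simp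
  | cons x L ih =>
    have hx : centralGen b j p jJ jC y x - eword b j (genWord p jJ jC x) ∈
        fil b par j (genWord p jJ jC x).length 0 := by
      rcases x with a | c
      · simp [centralGen, genWord]
      · have h1 := fil_mono (Fact.out : p.Prime).two_le _
          (j_mem_fil (j := j) hb (hI.mem_even c))
        have e : eword b j (List.replicate p (jC c)) = j (b (jC c)) ^ p := by simp [word]
        simpa [centralGen, genWord, e] using h1
    have hW : eword b j (genWord p jJ jC x) ∈ fil b par j ((genWord p jJ jC x).length + 1) 0 := by
      have := eword_mem_fil_succ (b := b) (par := par) (j := j) (genWord p jJ jC x)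
      rwa [wpar_eq_zero fun s hs => par_of_mem_genWord hI (L := [x]) (by simpa using hs)] at this
    have hP : (L.map (centralGen b j p jJ jC y)).prod ∈
        fil b par j ((L.flatMap (genWord p jJ jC)).length + 1) 0 := by
      have h1 := eword_mem_fil_succ (b := b) (par := par) (j := j) (L.flatMap (genWord p jJ jC))
      rw [wpar_eq_zero fun s hs => par_of_mem_genWord hI hs] at h1
      simpa using add_mem (fil_mono (Nat.le_succ _) _ ih) h1
    have h1 := mul_mem_fil (r := ((x :: L).flatMap (genWord p jJ jC)).length) hx hP
      (by simp; omega)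
    have h2 := mul_mem_fil (r := ((x :: L).flatMap (genWord p jJ jC)).length) hW ih
      (by simp; omega)
    rw [add_zero] at h1 h2
    convert add_mem h1 h2 using 1
    simp [sub_mul, mul_sub]

/-- Every word in which the letters outside the range of `jJ` are even with multiplicity divisible
by `p` is the leading word of a product of generators of the center. -/
theorem exists_flatMap_genWord_perm [DecidableEq ι] [Fact p.Prime]
    (hI : IsCentralIndexing b par p jJ jC y) (M : Multiset ι)
    (h : ∀ s ∈ M, s ∉ Set.range jJ → par s = 0 ∧ p ∣ M.count s) :
    ∃ L : List (α ⊕ β), (L.flatMap (genWord p jJ jC) : Multiset ι) = M := by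
  induction M using Multiset.strongInductionOn with
  | ih M ih =>
    rcases M.empty_or_exists_mem with rfl | ⟨s, hs⟩
    · exact ⟨[], rfl⟩
    by_cases hJ : s ∈ Set.range jJ
    · obtain ⟨a, rfl⟩ := hJ
      obtain ⟨M, rfl⟩ := Multiset.exists_cons_of_mem hs
      obtain ⟨L, hL⟩ := ih M (Multiset.lt_cons_self _ _) fun s hs hsJ => by
        have := h s (by simp [hs]) hsJ
        rwa [Multiset.count_cons_of_ne (fun e => hsJ ⟨a, e.symm⟩)] at this
      exact ⟨Sum.inl a :: L, by simp [genWord, ← hL]⟩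
    · obtain ⟨hpar, hdvd⟩ := h s hs hJ
      obtain ⟨c, rfl⟩ := (hI.mem_range s hpar).resolve_left hJ
      have hle : Multiset.replicate p (jC c) ≤ M :=
        Multiset.le_count_iff_replicate_le.1
          (Nat.le_of_dvd (Multiset.count_pos.2 hs) hdvd)
      obtain ⟨M', rfl⟩ := Multiset.le_iff_exists_add.1 hle
      have hp := (Fact.out : p.Prime).pos
      obtain ⟨L, hL⟩ := ih M' (Multiset.lt_iff_cons_le.2 ⟨jC c, by
          rw [← Multiset.singleton_add]
          refine add_le_add_left ?_ _
          rw [Multiset.singleton_le, Multiset.mem_replicate]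
          exact ⟨hp.ne', rfl⟩⟩) fun s hs hsJ => by
        obtain ⟨h1, h2⟩ := h s (by simp [hs]) hsJ
        refine ⟨h1, ?_⟩
        rw [Multiset.count_add, Multiset.count_replicate] at h2
        split_ifs at h2 with e
        · exact (Nat.dvd_add_right (dvd_refl p)).1 h2
        · simpa using h2
      exact ⟨Sum.inr c :: L, by simp [genWord, ← hL, ← Multiset.coe_replicate]⟩

/-! ### The center of the enveloping algebra -/

/-- The homogeneous elements of parity `a` that super commute with `g`. -/
def SuperCommutes (b : Basis ι k g) (par : ι → ZMod 2) (j : g →ₗ[k] U) (a : ZMod 2) (z : U) :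
    Prop :=
  (∃ n, z ∈ fil b par j n a) ∧ ∀ q, j (b q) * z = sgn k (par q) a • (z * j (b q))

/-- A linear order for which everything outside `F` comes before `F`. -/
theorem exists_linearOrder_compl_lt (F : Finset ι) :
    ∃ _ : LinearOrder ι, ∀ t ∉ F, ∀ s ∈ F, t < s := by
  classical
  let : LinearOrder ι := linearOrderOfSTO WellOrderingRel
  let e : ι → Bool ×ₗ ι := fun i => toLex (decide (i ∈ F), i)
  have he : Function.Injective e := fun i i' h => by
    simpa [e] using congrArg (fun x => (ofLex x).2) h
  refine ⟨LinearOrder.lift' e he, fun t ht s hs => ?_⟩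
  change e t < e s
  simp only [e, Prod.Lex.toLex_lt_toLex]
  left
  simp [ht, hs]

/-- Induction on the length of the leading words: by `count_eq_zero_of_superCentral` these are the
leading words of products of generators, and subtracting the products leaves a shorter element. -/
theorem superCommutes_mem_adjoin [Fact p.Prime] [CharP k p] (hb : IsParityBasis b par)
    (hj : IsEnveloping j) (hI : IsCentralIndexing b par p jJ jC y)
    (hsep : Separating b (Set.range jJ)) {a : ZMod 2} {z : U} (hz : SuperCommutes b par j a z) :
    z ∈ Algebra.adjoin k (Set.range (centralGen b j p jJ jC y)) := by
  obtain ⟨⟨n, hn⟩, hz⟩ := hz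
  induction n generalizing z with
  | zero =>
    rw [fil_zero, Submodule.mem_bot] at hn
    rw [hn]
    exact zero_mem _
  | succ n ih =>
    obtain ⟨F, hzF⟩ := exists_finset_letters hn
    obtain ⟨_, hF⟩ := exists_linearOrder_compl_lt F
    -- the leading part of `z`, in normal words
    have hlead : z ∈ Submodule.span k (eword b j '' {l | Normal par l ∧ l.length = n ∧
        wpar par l = a ∧ ∀ s ∈ l, s ∈ F}) ⊔ fil b par j n a := by
      refine Submodule.span_le.2 ?_ hzF
      rintro _ ⟨l, ⟨⟨hl, rfl⟩, hlF⟩, rfl⟩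
      refine Submodule.span_le.2 ?_ (eword_mem_span_normal hb hj l)
      rintro _ ⟨m, ⟨hm, hm', hml⟩, rfl⟩
      by_cases hlen : m.length < n
      · exact Submodule.mem_sup_right (hm' ▸ eword_mem_fil hlen)
      · refine Submodule.mem_sup_left (Submodule.subset_span ⟨m, ⟨hm, ?_, hm', ?_⟩, rfl⟩)
        · rcases hml with h | h
          · omega
          · have := h.length_eq; omega
        · rcases hml with h | h
          · omega
          · exact fun s hs => hlF s (h.subset hs)
    obtain ⟨x, hx, r, hr, rfl⟩ := Submodule.mem_sup.1 hlead
    obtain ⟨c, hc, rfl⟩ := (Finsupp.mem_span_image_iff_linearCombination k).1 hx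
    replace hc : ∀ l ∈ c.support, Normal par l ∧ l.length = n ∧ wpar par l = a ∧
      ∀ s ∈ l, s ∈ F := fun l hl => hc hl
    have hcount := fun l hl s hs hsJ => count_eq_zero_of_superCentral hb hj hsep F hF hc hr hz
      (l := l) hl (s := s) hs hsJ
    have hL : ∀ l ∈ c.support, ∃ L : List (α ⊕ β), (L.flatMap (genWord p jJ jC)).Perm l := by
      intro l hl
      obtain ⟨L, hL⟩ := exists_flatMap_genWord_perm hI (l : Multiset ι) fun s hs hsJ => by
        have := hcount l hl s (by simpa using hs) hsJ
        rw [CharP.cast_eq_zero_iff k p] at this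
        simpa using this
      exact ⟨L, Multiset.coe_eq_coe.1 hL⟩
    choose! L hL using hL
    set Q : List ι → U := fun l => ((L l).map (centralGen b j p jJ jC y)).prod with hQ
    have hQcomm : ∀ l u, Commute (Q l) u := fun l u =>
      Commute.list_prod_left _ _ fun x hx => by
        obtain ⟨s, -, rfl⟩ := List.mem_map.1 hx
        exact commute_centralGen hb hj hI s u
    have hQmem : ∀ l, Q l ∈ Algebra.adjoin k (Set.range (centralGen b j p jJ jC y)) := fun l =>
      list_prod_mem fun x hx => by
        obtain ⟨s, -, rfl⟩ := List.mem_map.1 hx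
        exact Algebra.subset_adjoin ⟨s, rfl⟩
    have ha : ∀ l ∈ c.support, a = 0 := fun l hl => by
      rw [← (hc l hl).2.2.1]
      exact wpar_eq_zero fun s hs => par_of_mem_genWord hI ((hL l hl).mem_iff.2 hs)
    have hdiff : ∀ l ∈ c.support, eword b j l - Q l ∈ fil b par j n a := by
      intro l hl
      have h1 := prod_centralGen_sub_mem_fil (j := j) hb hI (L l)
      have h2 := eword_sub_mem_fil_of_perm hb hj (hL l hl) fun s hs => par_of_mem_genWord hI hs
      rw [(hL l hl).length_eq, (hc l hl).2.1, ← ha l hl] at h1 h2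
      rw [← neg_mem_iff]
      convert add_mem h1 h2 using 1
      simp only [hQ]
      abel
    have hsum : Finsupp.linearCombination k (eword b j) c =
        (Finsupp.linearCombination k fun l => eword b j l - Q l) c +
          Finsupp.linearCombination k Q c := by
      simp [Finsupp.linearCombination_apply, Finsupp.sum, smul_sub]
    have hQc : Finsupp.linearCombination k Q c ∈
        Algebra.adjoin k (Set.range (centralGen b j p jJ jC y)) := by
      rw [Finsupp.linearCombination_apply]
      exact sum_mem fun l _ => Subalgebra.smul_mem _ (hQmem l) _
    have hrest := ih (z := (Finsupp.linearCombination k fun l => eword b j l - Q l) c + r)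
      (fun q => by
        have h1 := hz q
        rw [hsum, add_right_comm] at h1
        have h2 : j (b q) * Finsupp.linearCombination k Q c =
            sgn k (par q) a • (Finsupp.linearCombination k Q c * j (b q)) := by
          rw [Finsupp.linearCombination_apply, Finsupp.sum, Finset.mul_sum, Finset.sum_mul,
            Finset.smul_sum]
          refine Finset.sum_congr rfl fun l hl => ?_
          rw [ha l hl, sgn_zero_right, one_smul]
          exact ((hQcomm l (j (b q))).smul_left (c l)).eq.symm
        rw [mul_add, add_mul _ (Finsupp.linearCombination k Q c), smul_add, h2] at h1
        exact add_right_cancel h1)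
      (add_mem (by
        rw [Finsupp.linearCombination_apply]
        exact Submodule.sum_mem _ fun l hl => Submodule.smul_mem _ _ (hdiff l hl)) hr)
    rw [hsum, add_right_comm]
    exact add_mem hrest hQc

theorem count_inl_flatMap_genWord [DecidableEq ι] [DecidableEq α] [DecidableEq β]
    (hI : IsCentralIndexing b par p jJ jC y)
    (L : List (α ⊕ β)) (a : α) :
    (L.flatMap (genWord p jJ jC)).count (jJ a) = (L : Multiset (α ⊕ β)).count (Sum.inl a) := by
  induction L with
  | nil => simp
  | cons x L ih =>
    rw [List.flatMap_cons, List.count_append, ih, ← Multiset.cons_coe, Multiset.count_cons]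
    rcases x with a' | c
    · by_cases h : a' = a
      · subst h; simp [genWord, add_comm]
      · have := hI.injective_left.ne h
        simp [genWord, Ne.symm h, this]
    · have := (hI.disjoint a c).symm
      simp [genWord, List.count_replicate, this]

theorem count_inr_flatMap_genWord [DecidableEq ι] [DecidableEq α] [DecidableEq β]
    (hI : IsCentralIndexing b par p jJ jC y)
    (L : List (α ⊕ β)) (c : β) :
    (L.flatMap (genWord p jJ jC)).count (jC c) = p * (L : Multiset (α ⊕ β)).count (Sum.inr c) := by
  induction L with
  | nil => simp
  | cons x L ih =>
    rw [List.flatMap_cons, List.count_append, ih, ← Multiset.cons_coe, Multiset.count_cons]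
    rcases x with a | c'
    · have := hI.disjoint a c
      simp [genWord, this]
    · by_cases h : c' = c
      · subst h; simp [genWord]; ring
      · have := hI.injective_right.ne h
        simp [genWord, List.count_replicate, Ne.symm h, this]

/-- The generators of the center freely generate every subalgebra `Z` that contains them and
consists of sums of super commuting elements. -/
theorem freelyGenerates_centralGen [Fact p.Prime] [CharP k p] (hb : IsParityBasis b par)
    (hj : IsEnveloping j) (hI : IsCentralIndexing b par p jJ jC y)
    (hsep : Separating b (Set.range jJ)) (Z : Subalgebra k U)
    (hZ : ∀ x, centralGen b j p jJ jC y x ∈ Z)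
    (hZ' : ∀ z ∈ Z, ∃ z₀ z₁, SuperCommutes b par j 0 z₀ ∧ SuperCommutes b par j 1 z₁ ∧
      z = z₀ + z₁) :
    FreelyGenerates (centralGen b j p jJ jC y) Z := by
  classical
  set v := centralGen b j p jJ jC y with hv
  let v' : α ⊕ β → Subalgebra.center k U := fun x => ⟨v x, by
    rw [Subalgebra.mem_center_iff]
    exact fun u => (commute_centralGen hb hj hI x u).eq.symm⟩
  set φ : MvPolynomial (α ⊕ β) k →ₐ[k] U :=
    (Subalgebra.center k U).val.comp (MvPolynomial.aeval v') with hφ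
  have hφX : ∀ s, φ (MvPolynomial.X s) = v s := fun s => by simp [hφ, v']
  have hφm : ∀ f : α ⊕ β →₀ ℕ, φ (MvPolynomial.monomial f 1) =
      ((Finsupp.toMultiset f).toList.map v).prod := by
    intro f
    have h1 : (MvPolynomial.monomial f 1 : MvPolynomial (α ⊕ β) k) =
        ((Finsupp.toMultiset f).toList.map MvPolynomial.X).prod := by
      rw [← Multiset.prod_coe, ← Multiset.map_coe, Multiset.coe_toList, Finsupp.toMultiset_map,
        Finsupp.prod_toMultiset, MvPolynomial.monomial_eq]
      simp [Finsupp.prod_mapDomain_index, pow_add]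
    rw [h1, map_list_prod, List.map_map]
    congr 1
    exact List.map_congr_left fun x _ => hφX x
  refine ⟨φ, hφX, ?_, ?_⟩
  · -- algebraic independence: compare leading words
    rw [injective_iff_map_eq_zero]
    intro P hP
    by_contra hne
    let : LinearOrder ι := linearOrderOfSTO WellOrderingRel
    let len : (α ⊕ β →₀ ℕ) → ℕ := fun f =>
      ((Finsupp.toMultiset f).toList.flatMap (genWord p jJ jC)).length
    let m : (α ⊕ β →₀ ℕ) → List ι := fun f =>
      ((Finsupp.toMultiset f).toList.flatMap (genWord p jJ jC)).insertionSort (· ≤ ·)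
    have hmp : ∀ f, (m f).Perm ((Finsupp.toMultiset f).toList.flatMap (genWord p jJ jC)) :=
      fun f => List.perm_insertionSort _ _
    have hmpar : ∀ f, ∀ s ∈ m f, par s = 0 := fun f s hs =>
      par_of_mem_genWord hI ((hmp f).mem_iff.1 hs)
    have hmn : ∀ f, Normal par (m f) := fun f => by
      have h1 : (m f).Pairwise (· ≤ ·) := List.pairwise_insertionSort _ _
      refine List.Pairwise.imp_of_mem (fun {s t} hs _ h => ?_) h1
      rw [not_bad_iff]
      rcases h.lt_or_eq with h | h
      · exact Or.inl h
      · exact Or.inr ⟨h, hmpar f s hs⟩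
    have hminj : Function.Injective m := by
      intro f f' h
      have hp : ∀ s, ((Finsupp.toMultiset f).toList.flatMap (genWord p jJ jC)).count s =
          ((Finsupp.toMultiset f').toList.flatMap (genWord p jJ jC)).count s := fun s => by
        rw [← (hmp f).count_eq, ← (hmp f').count_eq, h]
      have hc : ∀ (f : α ⊕ β →₀ ℕ) x,
          ((Finsupp.toMultiset f).toList : Multiset (α ⊕ β)).count x = f x := fun f x => by
        rw [Multiset.coe_toList, Finsupp.count_toMultiset]
      ext x
      rw [← hc f, ← hc f']
      rcases x with a | c
      · have := hp (jJ a)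
        rwa [count_inl_flatMap_genWord hI, count_inl_flatMap_genWord hI] at this
      · have := hp (jC c)
        rw [count_inr_flatMap_genWord hI, count_inr_flatMap_genWord hI] at this
        exact Nat.eq_of_mul_eq_mul_left (Fact.out : p.Prime).pos this
    have hlead : ∀ f, φ (MvPolynomial.monomial f 1) - eword b j (m f) ∈
        fil b par j (len f) 0 := by
      intro f
      have h1 := prod_centralGen_sub_mem_fil (j := j) hb hI (Finsupp.toMultiset f).toList
      have h2 := eword_sub_mem_fil_of_perm hb hj (hmp f) (hmpar f)
      rw [(hmp f).length_eq] at h2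
      rw [hφm]
      convert sub_mem h1 h2 using 1
      abel
    obtain ⟨f₀, hf₀, hmax⟩ := Finset.exists_max_image P.support len
      (by rwa [Finset.nonempty_iff_ne_empty, Ne, MvPolynomial.support_eq_empty])
    set c : List ι →₀ k := ∑ f ∈ P.support.filter (fun f => len f = len f₀),
      Finsupp.single (m f) (P.coeff f) with hc
    have hc0 : c = 0 := by
      refine eq_zero_of_linearCombination_mem_fil hb hj (n := len f₀) (a := 0) (fun l hl => ?_) ?_
      · obtain ⟨f, hf, hf'⟩ := Finset.mem_biUnion.1 (Finsupp.support_finsetSum hl)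
        have := Finset.mem_singleton.1 (Finsupp.support_single_subset hf')
        subst this
        exact ⟨hmn f, (hmp f).length_eq.trans (Finset.mem_filter.1 hf).2⟩
      · have hsum : ∑ f ∈ P.support, P.coeff f • φ (MvPolynomial.monomial f 1) = 0 := by
          rw [← hP]
          conv_rhs => rw [P.as_sum]
          rw [map_sum]
          refine Finset.sum_congr rfl fun f _ => ?_
          rw [← map_smul, MvPolynomial.smul_monomial, smul_eq_mul, mul_one]
        rw [← Finset.sum_filter_add_sum_filter_not _ (fun f => len f = len f₀)] at hsum
        have h1 : ∑ f ∈ P.support.filter (fun f => ¬ len f = len f₀),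
            P.coeff f • φ (MvPolynomial.monomial f 1) ∈ fil b par j (len f₀) 0 := by
          refine Submodule.sum_mem _ fun f hf => Submodule.smul_mem _ _ ?_
          obtain ⟨hf, hne⟩ := Finset.mem_filter.1 hf
          have hlt : len f < len f₀ := lt_of_le_of_ne (hmax f hf) hne
          have h2 := eword_mem_fil (b := b) (par := par) (j := j) (l := m f) (n := len f₀)
            (by rw [(hmp f).length_eq]; exact hlt)
          rw [wpar_eq_zero (hmpar f)] at h2
          simpa using add_mem (fil_mono hlt.le _ (hlead f)) h2
        have h2 : ∑ f ∈ P.support.filter (fun f => len f = len f₀),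
            P.coeff f • (φ (MvPolynomial.monomial f 1) - eword b j (m f)) ∈
            fil b par j (len f₀) 0 := by
          refine Submodule.sum_mem _ fun f hf => Submodule.smul_mem _ _ ?_
          rw [← (Finset.mem_filter.1 hf).2]
          exact hlead f
        convert neg_mem (add_mem h1 h2) using 1
        rw [eq_neg_iff_add_eq_zero, ← hsum, hc, map_sum]
        simp only [Finsupp.linearCombination_single, smul_sub, Finset.sum_sub_distrib]
        abel
    have h1 : c (m f₀) = P.coeff f₀ := by
      rw [hc, Finsupp.finsetSum_apply, Finset.sum_eq_single f₀]
      · simp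
      · intro f _ hne
        rw [Finsupp.single_eq_of_ne (hminj.ne hne.symm)]
      · intro h
        simp [MvPolynomial.mem_support_iff.1 hf₀] at h
    rw [hc0] at h1
    exact MvPolynomial.mem_support_iff.1 hf₀ h1.symm
  · have hadj : Algebra.adjoin k (Set.range v) ≤ φ.range :=
      Algebra.adjoin_le (by rintro _ ⟨s, rfl⟩; exact ⟨_, hφX s⟩)
    refine le_antisymm ?_ fun z hz => ?_
    · rintro _ ⟨P, rfl⟩
      change φ P ∈ Z
      induction P using MvPolynomial.induction_on with
      | C r => rw [MvPolynomial.algHom_C]; exact Z.algebraMap_mem r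
      | add P Q hP hQ => rw [map_add]; exact add_mem hP hQ
      | mul_X P s hP =>
        rw [map_mul, hφX]
        exact mul_mem hP (hZ s)
    · obtain ⟨z₀, z₁, h₀, h₁, rfl⟩ := hZ' z hz
      exact add_mem (hadj (superCommutes_mem_adjoin hb hj hI hsep h₀))
        (hadj (superCommutes_mem_adjoin hb hj hI hsep h₁))

end Center

end LieSuperalgebra

/-! ### Jacobson's formula for the `p`-th power of a sum -/

section Jacobson

variable {k : Type*} [Field k]

theorem coeff_zero_mul_linear {R : Type*} [Ring R] (a b : R) (Q : R[X]) :
    ((Polynomial.X * Polynomial.C a + Polynomial.C b) * Q).coeff 0 = b * Q.coeff 0 := by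
  rw [add_mul, mul_assoc, Polynomial.coeff_add, Polynomial.coeff_X_mul_zero, zero_add,
    Polynomial.coeff_C_mul]

theorem coeff_succ_mul_linear {R : Type*} [Ring R] (a b : R) (Q : R[X]) (i : ℕ) :
    ((Polynomial.X * Polynomial.C a + Polynomial.C b) * Q).coeff (i + 1) =
      a * Q.coeff i + b * Q.coeff (i + 1) := by
  rw [add_mul, mul_assoc, Polynomial.coeff_add, Polynomial.coeff_X_mul, Polynomial.coeff_C_mul,
    Polynomial.coeff_C_mul]

/-- The coefficients of `(a t + b) ^ m` are compatible with maps that intertwine `a` and `b`. -/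
theorem coeff_pow_apply_of_intertwines {V W : Type*} [AddCommGroup V] [Module k V]
    [AddCommGroup W] [Module k W] (f : V →ₗ[k] W) {a b : Module.End k V} {a' b' : Module.End k W}
    (ha : ∀ v, f (a v) = a' (f v)) (hb : ∀ v, f (b v) = b' (f v)) (m i : ℕ) (v : V) :
    f (((Polynomial.X * Polynomial.C a + Polynomial.C b) ^ m).coeff i v) =
      ((Polynomial.X * Polynomial.C a' + Polynomial.C b') ^ m).coeff i (f v) := by
  induction m generalizing i with
  | zero =>
    simp only [pow_zero, Polynomial.coeff_one]
    split_ifs <;> simp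
  | succ m ih =>
    rw [pow_succ', pow_succ']
    cases i with
    | zero =>
      rw [coeff_zero_mul_linear, coeff_zero_mul_linear, Module.End.mul_apply, Module.End.mul_apply,
        hb, ih]
    | succ i =>
      rw [coeff_succ_mul_linear, coeff_succ_mul_linear, LinearMap.add_apply, LinearMap.add_apply,
        Module.End.mul_apply, Module.End.mul_apply, Module.End.mul_apply, Module.End.mul_apply,
        map_add, ha, hb, ih, ih]

variable {U : Type*} [Ring U] [Algebra k U]

variable (k U) in
/-- The commutator `u ↦ x u - u x` in an associative algebra, linear in `x`. -/
def assocAd : U →ₗ[k] Module.End k U := LinearMap.mul k U - (LinearMap.mul k U).flip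

@[simp]
theorem assocAd_apply (x u : U) : assocAd k U x u = x * u - u * x := by simp [assocAd]

theorem assocAd_eq (x : U) :
    assocAd k U x = LinearMap.mulLeft k x - LinearMap.mulRight k x := by
  ext u; simp

theorem choose_pred_mul_neg_one_pow {A : Type*} [Ring A] (p : ℕ) [Fact p.Prime] [CharP A p]
    {m : ℕ} (hm : m < p) : ((p - 1).choose m : A) * (-1) ^ m = 1 := by
  have hp := (Fact.out : p.Prime)
  induction m with
  | zero => simp
  | succ m ih =>
    have h1 : (p.choose (m + 1) : A) = 0 :=
      (CharP.cast_eq_zero_iff A p _).2 (hp.dvd_choose_self (by omega) hm)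
    obtain ⟨q, rfl⟩ : ∃ q, p = q + 1 := ⟨p - 1, by omega⟩
    rw [Nat.choose_succ_succ, Nat.cast_add] at h1
    have h2 := ih (by omega)
    rw [Nat.add_sub_cancel] at h2 ⊢
    rw [eq_neg_of_add_eq_zero_right h1, pow_succ, mul_neg_one, neg_mul_neg, h2]

/-- In characteristic `p`, the geometric sum of `p` terms is `(a - b) ^ (p - 1)`. -/
theorem sub_pow_pred_eq_sum {A : Type*} [Ring A] (p : ℕ) [Fact p.Prime] [CharP A p] {a b : A}
    (h : Commute a b) :
    (a - b) ^ (p - 1) = ∑ m ∈ Finset.range p, a ^ m * b ^ (p - 1 - m) := by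
  have hp := (Fact.out : p.Prime)
  rw [sub_eq_add_neg, h.neg_right.add_pow, Nat.sub_add_cancel hp.one_lt.le]
  refine Finset.sum_congr rfl fun m hm => ?_
  have hm' : m < p := Finset.mem_range.1 hm
  have h1 := choose_pred_mul_neg_one_pow (A := A) p (m := p - 1 - m) (by omega)
  rw [Nat.choose_symm (by omega)] at h1
  rw [neg_pow b, mul_assoc, mul_assoc, (Nat.cast_commute _ _).eq.symm, ← mul_assoc ((-1 : A) ^ _),
    ← (Nat.cast_commute _ _).eq, h1, one_mul]

/-- The coefficients of an iterated commutator with `x t + y`. -/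
theorem coeff_assocAd_pow (x y u : U) (m i : ℕ) :
    ((assocAd k U[X] (Polynomial.X * Polynomial.C x + Polynomial.C y) ^ m)
      (Polynomial.C u)).coeff i =
    ((Polynomial.X * Polynomial.C (assocAd k U x) +
      Polynomial.C (assocAd k U y)) ^ m).coeff i u := by
  induction m generalizing i with
  | zero =>
    simp only [pow_zero, Module.End.one_apply, Polynomial.coeff_C, Polynomial.coeff_one]
    split_ifs <;> simp
  | succ m ih =>
    rw [pow_succ', pow_succ', Module.End.mul_apply, assocAd_apply, Polynomial.coeff_sub]
    set f := (assocAd k U[X] (Polynomial.X * Polynomial.C x + Polynomial.C y) ^ m)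
      (Polynomial.C u) with hf
    cases i with
    | zero =>
      rw [coeff_zero_mul_linear, coeff_zero_mul_linear, mul_add, Polynomial.coeff_add,
        Polynomial.coeff_mul_C, ← mul_assoc, Polynomial.coeff_mul_C, Polynomial.coeff_mul_X_zero,
        Module.End.mul_apply, assocAd_apply, ← ih]
      simp
    | succ i =>
      rw [coeff_succ_mul_linear, coeff_succ_mul_linear, mul_add, Polynomial.coeff_add,
        Polynomial.coeff_mul_C, ← mul_assoc, Polynomial.coeff_mul_C, Polynomial.coeff_mul_X,
        LinearMap.add_apply, Module.End.mul_apply, Module.End.mul_apply, assocAd_apply,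
        assocAd_apply, ← ih, ← ih]
      abel

theorem derivative_pow_eq_sum {R : Type*} [Ring R] (w : R[X]) (n : ℕ) :
    Polynomial.derivative (w ^ n) =
      ∑ m ∈ Finset.range n, w ^ m * Polynomial.derivative w * w ^ (n - 1 - m) := by
  induction n with
  | zero => simp
  | succ n ih =>
    rw [pow_succ, Polynomial.derivative_mul, ih, Finset.sum_range_succ, Finset.sum_mul]
    simp only [Nat.add_sub_cancel, Nat.sub_self, pow_zero, mul_one]
    congr 1
    refine Finset.sum_congr rfl fun m hm => ?_
    have := Finset.mem_range.1 hm
    rw [mul_assoc, ← pow_succ, show n - 1 - m + 1 = n - m by omega]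

/-- Jacobson's formula. The terms are the coefficients of `(x t + y) ^ p`, and are found by
differentiating with respect to `t`: the derivative is `(ad (x t + y)) ^ (p - 1) (x)`. -/
theorem add_pow_eq_jacobsonTerm (p : ℕ) [Fact p.Prime] [CharP k p] (x y : U) :
    (x + y) ^ p = x ^ p + y ^ p +
      ∑ i ∈ Finset.Ico 1 p, jacobsonTerm (assocAd k U) p i x y := by
  have hp := (Fact.out : p.Prime)
  rcases subsingleton_or_nontrivial U with h | h
  · exact Subsingleton.elim _ _
  have : CharP (Module.End k U[X]) p :=
    charP_of_injective_algebraMap (algebraMap k (Module.End k U[X])).injective p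
  set w : U[X] := Polynomial.X * Polynomial.C x + Polynomial.C y with hw
  have hdw : Polynomial.derivative w = Polynomial.C x := by simp [hw, -Polynomial.X_mul_C]
  have hder : Polynomial.derivative (w ^ p) = (assocAd k U[X] w ^ (p - 1)) (Polynomial.C x) := by
    rw [derivative_pow_eq_sum, hdw, assocAd_eq,
      sub_pow_pred_eq_sum p (LinearMap.commute_mulLeft_right w w), LinearMap.sum_apply]
    refine Finset.sum_congr rfl fun m _ => ?_
    rw [LinearMap.pow_mulLeft, LinearMap.pow_mulRight]
    simp [mul_assoc]
  have hcoeff : ∀ i ∈ Finset.Ico 1 p, (w ^ p).coeff i = jacobsonTerm (assocAd k U) p i x y := by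
    intro i hi
    obtain ⟨h1, h2⟩ := Finset.mem_Ico.1 hi
    have hne : (i : k) ≠ 0 := by
      rw [Ne, CharP.cast_eq_zero_iff k p]
      exact Nat.not_dvd_of_pos_of_lt h1 h2
    have h3 := congrArg (fun f => f.coeff (i - 1)) hder
    simp only [Polynomial.coeff_derivative] at h3
    rw [hw, coeff_assocAd_pow, ← hw, Nat.sub_add_cancel h1] at h3
    rw [jacobsonTerm, ← h3]
    have h4 : (w ^ p).coeff i * ((i - 1 : ℕ) + 1 : U) = (i : k) • (w ^ p).coeff i := by
      rw [← Nat.cast_succ, Nat.succ_eq_add_one, Nat.sub_add_cancel h1,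
        ← (Nat.cast_commute i _).eq]
      simp [Algebra.smul_def]
    rw [h4, smul_smul, inv_mul_cancel₀ hne, one_smul]
  have hdeg : w.natDegree ≤ 1 := by
    refine Polynomial.natDegree_add_le_of_degree_le ?_ (by simp)
    exact Polynomial.natDegree_mul_le.trans (by simp)
  have heval : (w ^ p).eval 1 = (x + y) ^ p := by
    have := map_pow (Polynomial.eval₂RingHom' (RingHom.id U) 1 fun a => Commute.one_right a) w p
    simp only [Polynomial.eval₂RingHom', RingHom.coe_mk, MonoidHom.coe_mk, OneHom.coe_mk] at this
    rw [Polynomial.eval, this]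
    congr 1
    simp [hw, -Polynomial.X_mul_C, Polynomial.eval₂_mul_C']
  rw [← heval, Polynomial.eval_eq_sum_range' (n := p + 1)
    (Nat.lt_succ_of_le ((Polynomial.natDegree_pow_le).trans (by nlinarith)))]
  simp only [one_pow, mul_one]
  rw [Finset.sum_range_succ, Finset.range_eq_Ico, Finset.sum_eq_sum_Ico_succ_bot hp.pos,
    Finset.sum_congr rfl hcoeff]
  have e0 : (w ^ p).coeff 0 = y ^ p := by
    have := map_pow (Polynomial.constantCoeff (R := U)) w p
    simpa [hw] using this
  have e1 : (w ^ p).coeff p = x ^ p := by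
    have := Polynomial.coeff_pow_of_natDegree_le (m := p) hdeg
    rw [mul_one] at this
    rw [this, hw]
    simp [-Polynomial.X_mul_C]
  rw [e0, e1]
  abel

end Jacobson

namespace LieSuperalgebra

/-! ### The enveloping algebra of a Lie superalgebra -/

section Relations

variable (k : Type*) [Field k] (g : Type*) [AddCommGroup g] [Module k g] [LieSuperalgebra k g]

/-- The two-sided ideal of relations of the enveloping algebra. -/
def relIdeal : Ideal (TensorAlgebra k g) where
  toAddSubmonoid := (relSpan k g).toAddSubmonoid
  smul_mem' := by
    intro c t ht
    change t ∈ relSpan k g at ht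
    change c * t ∈ relSpan k g
    induction ht using Submodule.span_induction with
    | zero => rw [mul_zero]; exact zero_mem _
    | add t t' h h' ht ht' => rw [mul_add]; exact add_mem ht ht'
    | smul r t h ht => rw [mul_smul_comm]; exact (relSpan k g).smul_mem _ ht
    | mem t h =>
      obtain ⟨u, v, a, b, x, y, hx, hy, rfl⟩ := h
      refine Submodule.subset_span ⟨c * u, v, a, b, x, y, hx, hy, ?_⟩
      simp [mul_assoc]

variable {k g} in
theorem mem_relIdeal {t : TensorAlgebra k g} : t ∈ relIdeal k g ↔ t ∈ relSpan k g := Iff.rfl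

instance : (relIdeal k g).IsTwoSided where
  mul_mem_of_left := by
    intro t c ht
    rw [mem_relIdeal] at ht ⊢
    induction ht using Submodule.span_induction with
    | zero => rw [zero_mul]; exact zero_mem _
    | add t t' h h' ht ht' => rw [add_mul]; exact add_mem ht ht'
    | smul r t h ht => rw [smul_mul_assoc]; exact (relSpan k g).smul_mem _ ht
    | mem t h =>
      obtain ⟨u, v, a, b, x, y, hx, hy, rfl⟩ := h
      exact Submodule.subset_span ⟨u, v * c, a, b, x, y, hx, hy, by simp [mul_assoc]⟩

variable {k g} in
theorem comm_mem_relIdeal {a b : ZMod 2} {x y : g} (hx : x ∈ (gr a : Submodule k g))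
    (hy : y ∈ (gr b : Submodule k g)) : comm (TensorAlgebra.ι k) a b x y ∈ relIdeal k g :=
  Submodule.subset_span ⟨1, 1, a, b, x, y, hx, hy, by simp⟩

/-- A linear map to an algebra that satisfies the relations and through which the quotient of the
tensor algebra by the ideal of relations factors is an enveloping algebra. -/
theorem isEnveloping_of_factors {U : Type*} [Ring U] [Algebra k U] {j : g →ₗ[k] U}
    (hrel : ∀ {a b : ZMod 2} {x y : g}, x ∈ (gr a : Submodule k g) →
      y ∈ (gr b : Submodule k g) → comm j a b x y = 0)
    (hsurj : Function.Surjective (TensorAlgebra.lift k j))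
    (F : U →ₐ[k] TensorAlgebra k g ⧸ relIdeal k g)
    (hF : ∀ x, F (j x) = Ideal.Quotient.mkₐ k (relIdeal k g) (TensorAlgebra.ι k x)) :
    IsEnveloping j where
  comm_eq_zero := hrel
  surjective := hsurj
  mem_relSpan t ht := by
    have h : F.comp (TensorAlgebra.lift k j) = Ideal.Quotient.mkₐ k (relIdeal k g) := by
      ext x; simpa using hF x
    have h1 := congrArg (fun f => f t) h
    simp only [AlgHom.comp_apply, ht, map_zero] at h1
    exact Ideal.Quotient.eq_zero_iff_mem.1 h1.symm

theorem isEnveloping_ι : IsEnveloping (ι k g) := by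
  have hlift : TensorAlgebra.lift k (ι k g) = RingQuot.mkAlgHom k (Rel k g) := by
    ext x
    rw [LinearMap.comp_apply, LinearMap.comp_apply]
    exact TensorAlgebra.lift_ι_apply _ _
  have hq : ∀ ⦃s t : TensorAlgebra k g⦄, Rel k g s t →
      Ideal.Quotient.mkₐ k (relIdeal k g) s = Ideal.Quotient.mkₐ k (relIdeal k g) t := by
    rintro _ _ ⟨hx, hy⟩
    refine Ideal.Quotient.eq.2 ?_
    rw [units_smul_eq_sgn k]
    exact comm_mem_relIdeal hx hy
  refine isEnveloping_of_factors k g (fun {a b x y} hx hy => ?_) ?_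
    (RingQuot.liftAlgHom k ⟨Ideal.Quotient.mkₐ k (relIdeal k g), hq⟩) (fun x => ?_)
  · have h := RingQuot.mkAlgHom_rel k (Rel.of hx hy)
    rw [units_smul_eq_sgn k, map_sub, map_smul, map_mul, map_mul] at h
    exact sub_eq_zero.2 h
  · rw [hlift]
    exact RingQuot.mkAlgHom_surjective k _
  · exact RingQuot.liftAlgHom_mkAlgHom_apply k _ _ _

end Relations

/-! ### Restricted structures -/

section PMap

variable {k : Type*} [Field k] {g : Type*} [AddCommGroup g] [Module k g] [LieSuperalgebra k g]
variable {ι' : Type*} {b : Basis ι' k g} {par : ι' → ZMod 2} {p : ℕ}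

theorem jacobsonTerm_mem_even {x y : g} (hx : x ∈ even k g) (hy : y ∈ even k g) (p i : ℕ) :
    jacobsonTerm (ad k g) p i x y ∈ even k g := by
  have h : ∀ {x : g}, x ∈ even k g → ∀ z ∈ even k g, ad k g x z ∈ even k g := fun hx z hz => by
    have := bracket_mem hx hz
    rwa [add_zero] at this
  have h1 := coeff_pow_apply_of_intertwines (even k g).subtype
    (a := (ad k g x).restrict (h hx)) (b := (ad k g y).restrict (h hy)) (a' := ad k g x)
    (b' := ad k g y) (fun _ => rfl) (fun _ => rfl) (p - 1) (i - 1) ⟨x, hx⟩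
  refine Submodule.smul_mem _ _ ?_
  rw [Submodule.subtype_apply, Submodule.subtype_apply] at h1
  rw [← h1]
  exact SetLike.coe_mem _

/-- A `p`-th power map is determined by its values on the even vectors of a homogeneous basis. -/
theorem IsPMap.ext [Fact p.Prime] (hb : IsParityBasis b par) {P P' : even k g → even k g}
    (hP : IsPMap k p P) (hP' : IsPMap k p P')
    (h : ∀ i (hi : b i ∈ even k g), par i = 0 → P ⟨b i, hi⟩ = P' ⟨b i, hi⟩) : P = P' := by
  have hp := (Fact.out : p.Prime)
  have hs := hb.gr_eq_span 0
  suffices H : ∀ x, x ∈ Submodule.span k (b '' {i | par i = 0}) →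
      ∀ hx : x ∈ even k g, P ⟨x, hx⟩ = P' ⟨x, hx⟩ from
    funext fun x => H x (hs.le x.2) x.2
  intro x hx
  induction hx using Submodule.span_induction with
  | mem x hx =>
    obtain ⟨i, hi, rfl⟩ := hx
    exact fun h' => h i h' hi
  | zero =>
    intro h0
    have e : (⟨0, h0⟩ : even k g) = (0 : k) • ⟨0, h0⟩ := by ext; simp
    rw [e, hP.map_smul, hP'.map_smul, zero_pow hp.ne_zero, zero_smul, zero_smul]
  | add x y hx hy ihx ihy =>
    intro h0
    have e : (⟨x + y, h0⟩ : even k g) = ⟨x, hs.ge hx⟩ + ⟨y, hs.ge hy⟩ := rfl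
    rw [e]
    refine Subtype.ext ?_
    rw [hP.map_add, hP'.map_add, ihx, ihy]
  | smul r x hx ih =>
    intro h0
    have e : (⟨r • x, h0⟩ : even k g) = r • ⟨x, hs.ge hx⟩ := rfl
    rw [e, hP.map_smul, hP'.map_smul, ih]

/-- Jacobson's theorem: values on an even basis that fit the adjoint representation extend to a
`p`-th power map. If `z i` is the central element `b_i ^ p - y_i` of the enveloping algebra, and `Z`
the `p`-semilinear map with `Z b_i = z i`, then the `p`-th power of `x` is `x ^ p - Z x`. -/
theorem exists_isPMap [Fact p.Prime] [CharP k p] (hb : IsParityBasis b par) (y : ι' → g)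
    (hy : ∀ i, par i = 0 → y i ∈ even k g)
    (had : ∀ i, par i = 0 → ad k g (y i) = ad k g (b i) ^ p) :
    ∃ P : even k g → even k g, IsPMap k p P ∧
      ∀ i (hi : b i ∈ even k g), par i = 0 → (P ⟨b i, hi⟩ : g) = y i := by
  classical
  have hp := (Fact.out : p.Prime)
  have hj := isEnveloping_ι k g
  set j := ι k g
  have hinj := hj.injective hb
  have hs := hb.gr_eq_span 0
  let z : ι' → Enveloping k g := fun i => if par i = 0 then j (b i) ^ p - j (y i) else 0
  have hz : ∀ i u, Commute (z i) u := by
    intro i u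
    by_cases hi : par i = 0
    · simp only [z, if_pos hi]
      exact commute_pow_sub hb hj p (hi ▸ hb.mem i) (hy i hi) (had i hi) u
    · simp only [z, if_neg hi]
      exact Commute.zero_left u
  let Z : g → Enveloping k g := fun x => (b.repr x).sum fun i c => c ^ p • z i
  have hZadd : ∀ x x', Z (x + x') = Z x + Z x' := by
    intro x x'
    simp only [Z, map_add]
    refine Finsupp.sum_add_index' (fun i => ?_) (fun i c c' => ?_)
    · rw [zero_pow hp.ne_zero, zero_smul]
    · rw [add_pow_char, add_smul]
  have hZsmul : ∀ (r : k) x, Z (r • x) = r ^ p • Z x := by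
    intro r x
    simp only [Z, map_smul]
    rw [Finsupp.sum_smul_index (fun i => by rw [zero_pow hp.ne_zero, zero_smul]), Finsupp.smul_sum]
    exact Finset.sum_congr rfl fun i _ => by simp only [mul_pow, mul_smul]
  have hZcomm : ∀ x u, Commute (Z x) u := fun x u =>
    Commute.sum_left _ _ _ fun i _ => (hz i u).smul_left _
  have hjac : ∀ {x x' : g}, x ∈ even k g → x' ∈ even k g → ∀ i,
      j (jacobsonTerm (ad k g) p i x x') = jacobsonTerm (assocAd k _) p i (j x) (j x') := by
    intro x x' hx hx' i
    have hbr : ∀ {x : g}, x ∈ even k g → ∀ v, j (ad k g x v) = assocAd k _ (j x) (j v) := by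
      intro x hx v
      have := ad_pow_apply hb hj hx 1 v
      rwa [pow_one, pow_one, ← assocAd_eq] at this
    rw [jacobsonTerm, jacobsonTerm, map_smul,
      coeff_pow_apply_of_intertwines j (hbr hx) (hbr hx')]
  have hadd : ∀ {x x' : g}, x ∈ even k g → x' ∈ even k g → ∀ {w w' : g},
      j w = j x ^ p - Z x → j w' = j x' ^ p - Z x' →
      j (w + w' + ∑ i ∈ Finset.Ico 1 p, jacobsonTerm (ad k g) p i x x') =
        j (x + x') ^ p - Z (x + x') := by
    intro x x' hx hx' w w' hw hw'
    rw [map_add j x, add_pow_eq_jacobsonTerm (k := k) p, hZadd, map_add, map_add, hw, hw', map_sum,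
      Finset.sum_congr rfl fun i _ => hjac hx hx' i]
    abel
  have hsmul : ∀ {x w : g} (r : k), j w = j x ^ p - Z x →
      j (r ^ p • w) = j (r • x) ^ p - Z (r • x) := by
    intro x w r hw
    rw [map_smul, hw, map_smul, smul_pow, hZsmul, smul_sub]
  have hbasis : ∀ i, par i = 0 → j (y i) = j (b i) ^ p - Z (b i) := by
    intro i hi
    have : Z (b i) = z i := by
      simp only [Z, Basis.repr_self]
      rw [Finsupp.sum_single_index (by rw [zero_pow hp.ne_zero, zero_smul]), one_pow, one_smul]
    rw [this]
    simp [z, hi]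
  have hex : ∀ x : even k g, ∃ w : even k g, j (w : g) = j (x : g) ^ p - Z x := by
    rintro ⟨x, hx⟩
    suffices H : ∀ x ∈ Submodule.span k (b '' {i | par i = 0}),
        ∃ w ∈ even k g, j w = j x ^ p - Z x by
      obtain ⟨w, hw, e⟩ := H x (hs.le hx)
      exact ⟨⟨w, hw⟩, e⟩
    clear hx x
    intro x hx
    induction hx using Submodule.span_induction with
    | mem x hx =>
      obtain ⟨i, hi, rfl⟩ := hx
      exact ⟨y i, hy i hi, hbasis i hi⟩
    | zero => exact ⟨0, zero_mem _, by simp [Z, hp.ne_zero]⟩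
    | add x x' hx hx' ih ih' =>
      obtain ⟨w, hw, e⟩ := ih
      obtain ⟨w', hw', e'⟩ := ih'
      rw [← hs] at hx hx'
      exact ⟨_, add_mem (add_mem hw hw') (Submodule.sum_mem _ fun i _ =>
        jacobsonTerm_mem_even hx hx' p i), hadd hx hx' e e'⟩
    | smul r x hx ih =>
      obtain ⟨w, hw, e⟩ := ih
      exact ⟨r ^ p • w, Submodule.smul_mem _ _ hw, hsmul r e⟩
  choose P hP using hex
  refine ⟨P, ⟨fun x => ?_, fun r x => ?_, fun x x' => ?_⟩, fun i hi hi' => ?_⟩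
  · refine LinearMap.ext fun v => hinj ?_
    have h1 := ad_pow_apply hb hj (P x).2 1 v
    have h2 := ad_pow_apply hb hj x.2 p v
    rw [ad_pow_char] at h2
    rw [h2, ← pow_one (ad k g (P x)), h1, pow_one, hP]
    have := (hZcomm (x : g) (j v)).eq
    simp only [LinearMap.sub_apply, LinearMap.mulLeft_apply, LinearMap.mulRight_apply, sub_mul,
      mul_sub, this]
    abel
  · refine Subtype.ext (hinj ?_)
    rw [hP]
    exact (hsmul r (hP x)).symm
  · refine hinj ?_
    rw [hP]
    exact (hadd x.2 x'.2 (hP x) (hP x')).symm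
  · refine hinj ?_
    rw [hP, hbasis i hi']

end PMap

/-! ### Lie algebras as Lie superalgebras -/

section OfLie

variable (k : Type*) [Field k] (L : Type*) [LieRing L] [LieAlgebra k L]

/-- A Lie algebra as a Lie superalgebra without odd elements. -/
abbrev ofLie : LieSuperalgebra k L where
  gr a := if a = 0 then ⊤ else ⊥
  isCompl := by simpa using isCompl_top_bot
  bracket := (LieAlgebra.ad k L : L →ₗ[k] Module.End k L)
  bracket_mem := by
    intro a b x y hx hy
    rcases zmod_two_eq a with rfl | rfl
    · rcases zmod_two_eq b with rfl | rfl
      · simp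
      · have : y = 0 := by simpa using hy
        simp [this]
    · have : x = 0 := by simpa using hx
      simp [this]
  bracket_skew := by
    intro a b x y hx hy
    rcases zmod_two_eq a with rfl | rfl
    · simp
    · have : x = 0 := by simpa using hx
      simp [this]
  bracket_jacobi := by
    intro a b c x y z hx hy hz
    rcases zmod_two_eq a with rfl | rfl
    · simp
    · have : x = 0 := by simpa using hx
      simp [this]
  bracket_cube := by
    intro x hx
    have : x = 0 := by simpa using hx
    simp [this]

variable {k L}

theorem mem_ofLie_gr_zero (x : L) : x ∈ (ofLie k L).gr 0 := by
  change x ∈ (if (0 : ZMod 2) = 0 then (⊤ : Submodule k L) else ⊥)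
  simp

theorem eq_zero_of_mem_ofLie_gr_one {x : L} (hx : x ∈ (ofLie k L).gr 1) : x = 0 := by
  change x ∈ (if (1 : ZMod 2) = 0 then (⊤ : Submodule k L) else ⊥) at hx
  simpa using hx

theorem isParityBasis_ofLie {ι' : Type*} (b : Basis ι' k L) :
    letI := ofLie k L
    IsParityBasis b fun _ => 0 := by
  let := ofLie k L
  exact ⟨fun i => mem_ofLie_gr_zero _, fun i h => absurd h (by decide), fun x _ => lie_self x⟩

attribute [local instance 100] LieRing.ofAssociativeRing

theorem isEnveloping_ofLie :
    letI := ofLie k L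
    IsEnveloping (UniversalEnvelopingAlgebra.ι k (L := L) :
      L →ₗ[k] UniversalEnvelopingAlgebra k L) := by
  let := ofLie k L
  have hmem : ∀ x : L, x ∈ (gr 0 : Submodule k L) := mem_ofLie_gr_zero
  have hlift : TensorAlgebra.lift k
      (UniversalEnvelopingAlgebra.ι k (L := L) : L →ₗ[k] UniversalEnvelopingAlgebra k L) =
      UniversalEnvelopingAlgebra.mkAlgHom k L := by
    ext x
    simp
  let f : L →ₗ⁅k⁆ TensorAlgebra k L ⧸ relIdeal k L :=
    { (Ideal.Quotient.mkₐ k (relIdeal k L)).toLinearMap ∘ₗ TensorAlgebra.ι k with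
      map_lie' := by
        intro x y
        have := comm_mem_relIdeal (hmem x) (hmem y)
        rw [comm, sgn_zero_left, one_smul] at this
        have := (Ideal.Quotient.eq (I := relIdeal k L)).2 this
        rw [LieRing.of_associative_ring_bracket]
        exact this.symm }
  refine isEnveloping_of_factors k L (fun {a b x y} hx hy => ?_) ?_
    (UniversalEnvelopingAlgebra.lift k f) (fun x => ?_)
  · have h : UniversalEnvelopingAlgebra.ι k ⁅x, y⁆ = _ := LieHom.map_lie _ x y
    rw [LieRing.of_associative_ring_bracket] at h
    rcases zmod_two_eq a with rfl | rfl
    · rw [comm, sgn_zero_left, one_smul, sub_eq_zero]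
      exact h.symm
    · have : x = 0 := eq_zero_of_mem_ofLie_gr_one hx
      simp [this, comm]
  · rw [hlift]
    exact RingCon.mkₐ_surjective _
  · exact UniversalEnvelopingAlgebra.lift_ι_apply k f x

end OfLie

/-! ### The separation of variables by translation -/

section Tensor

variable {k : Type*} [Field k] {A : Type*} [CommRing A] [Algebra k A]
variable {L : Type*} [AddCommGroup L] [Module k L]
variable {β : L →ₗ[k] L →ₗ[k] L} {B : (A ⊗[k] L) →ₗ[k] (A ⊗[k] L) →ₗ[k] (A ⊗[k] L)}

theorem bracket_tmul_pow_apply (hB : ∀ a c x z, B (a ⊗ₜ x) (c ⊗ₜ z) = (a * c) ⊗ₜ β x z)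
    (a c : A) (x z : L) (n : ℕ) :
    ((B (a ⊗ₜ x) : Module.End k (A ⊗[k] L)) ^ n) (c ⊗ₜ z) =
      (a ^ n * c) ⊗ₜ ((β x : Module.End k L) ^ n) z := by
  induction n with
  | zero => simp
  | succ n ih =>
    rw [pow_succ', pow_succ', pow_succ', Module.End.mul_apply, Module.End.mul_apply, ih, hB,
      mul_assoc]

theorem bracket_pow_tmul (hB : ∀ a c x z, B (a ⊗ₜ x) (c ⊗ₜ z) = (a * c) ⊗ₜ β x z)
    (a : A) {x y : L} {n : ℕ} (h : (β y : Module.End k L) = β x ^ n) :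
    (B ((a ^ n) ⊗ₜ y) : Module.End k (A ⊗[k] L)) = B (a ⊗ₜ x) ^ n :=
  TensorProduct.ext' fun c z => by rw [bracket_tmul_pow_apply hB, hB, h]

/-- An infinite cancellative monoid contains an element that translates a given finite set off
itself. -/
theorem exists_add_notMem {R : Type*} [AddCancelCommMonoid R] [Infinite R] (S : Finset R) :
    ∃ s, ∀ r ∈ S, s + r ∉ S := by
  have hfin : (⋃ r ∈ S, (fun s => s + r) ⁻¹' (S : Set R)).Finite :=
    S.finite_toSet.biUnion fun r _ =>
      S.finite_toSet.preimage (add_left_injective r).injOn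
  obtain ⟨s, hs⟩ := hfin.exists_notMem
  refine ⟨s, fun r hr h => hs ?_⟩
  simp only [Set.mem_iUnion, Set.mem_preimage, Finset.mem_coe]
  exact ⟨r, hr, h⟩

/-- For the current algebra and the loop algebra the leading symbol of a central element is as small
as possible: bracketing with `x ^ s ⊗ e_l` for large `s` moves all the variables `x ^ r ⊗ e_i` that
occur in it to new variables, and it keeps them apart for different `r`. -/
theorem separating_tensorProduct {R I : Type*} [AddCancelCommMonoid R] [Infinite R]
    [LieSuperalgebra k (A ⊗[k] L)] (m : Basis R k A) (hm : ∀ r s, m (r + s) = m r * m s)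
    (e : Basis I k L)
    (hB : ∀ a c x z, bracket (k := k) (a ⊗ₜ[k] x) (c ⊗ₜ[k] z) = (a * c : A) ⊗ₜ[k] β x z)
    {J : Set I} (hJ : ∀ x, (∀ l, β (e l) x = 0) → ∀ i ∉ J, e.repr x i = 0) :
    Separating (m.tensorProduct e) {x : R × I | x.2 ∈ J} := by
  classical
  intro F v _ hq
  obtain ⟨s, hs⟩ := exists_add_notMem (F.image Prod.fst)
  -- the coefficient of `m r` in an element of `A ⊗ L`
  let c : R → (A ⊗[k] L) →ₗ[k] L := fun r =>
    (TensorProduct.lid k L).toLinearMap ∘ₗ LinearMap.rTensor L (m.coord r)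
  have hc : ∀ r a x, c r (a ⊗ₜ x) = m.repr a r • x := fun r a x => by simp [c]
  rintro ⟨r, i⟩ hi
  have h1 : (m.tensorProduct e).repr v (r, i) = e.repr (c r v) i := by
    suffices H : (Finsupp.lapply (r, i) ∘ₗ (m.tensorProduct e).repr.toLinearMap :
        A ⊗[k] L →ₗ[k] k) = Finsupp.lapply i ∘ₗ e.repr.toLinearMap ∘ₗ c r from
      LinearMap.congr_fun H v
    exact TensorProduct.ext' fun a x => by simp [hc, mul_comm]
  rw [h1]
  refine hJ _ (fun l => ?_) i hi
  have h2 := hq (s, l) fun x hx y hy => by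
    have hne : s + x.1 ≠ y.1 := fun h =>
      hs x.1 (Finset.mem_image_of_mem _ hx) (h ▸ Finset.mem_image_of_mem _ hy)
    rw [Basis.tensorProduct_apply', Basis.tensorProduct_apply', hB, ← hm,
      ← Prod.mk.eta (p := y), Basis.tensorProduct_repr_tmul_apply, Basis.repr_self,
      Finsupp.single_eq_of_ne hne.symm]
    simp
  have h3 : c (s + r) (bracket (k := k) (m.tensorProduct e (s, l)) v) = β (e l) (c r v) := by
    suffices H : c (s + r) ∘ₗ bracket (k := k) (m.tensorProduct e (s, l)) = β (e l) ∘ₗ c r from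
      LinearMap.congr_fun H v
    refine (m.tensorProduct e).ext fun x => ?_
    change c (s + r) (bracket (k := k) (m.tensorProduct e (s, l)) (m.tensorProduct e x)) =
      β (e l) (c r (m.tensorProduct e x))
    rw [Basis.tensorProduct_apply', Basis.tensorProduct_apply', hB, ← hm, hc, hc, map_smul,
      Basis.repr_self, Basis.repr_self]
    congr 1
    by_cases h : x.1 = r
    · simp [h]
    · rw [Finsupp.single_eq_of_ne (Ne.symm h),
        Finsupp.single_eq_of_ne (fun h' => h (add_left_cancel h').symm)]
  rw [← h3, h2, map_zero]

end Tensor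

end LieSuperalgebra

open LieSuperalgebra

/-! ### The current algebra and the loop algebra of a Lie algebra -/

theorem FreelyGenerates.le {k : Type*} [Field k] {U : Type*} [Ring U] [Algebra k U] {σ : Type*}
    {v : σ → U} {Z : Subalgebra k U} (h : FreelyGenerates v Z) {S : Subalgebra k U}
    (hS : ∀ s, v s ∈ S) : Z ≤ S := by
  obtain ⟨φ, hφ, -, rfl⟩ := h
  rintro _ ⟨P, rfl⟩
  change φ P ∈ S
  induction P using MvPolynomial.induction_on with
  | C r => rw [MvPolynomial.algHom_C]; exact S.algebraMap_mem r
  | add P Q hP hQ => rw [map_add]; exact add_mem hP hQ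
  | mul_X P s hP =>
    rw [map_mul, hφ]
    exact mul_mem hP (hS s)


section Lie

variable {k : Type*} [Field k]

theorem IsPMap.toSuper {g : Type*} [LieRing g] [LieAlgebra k g] {p : ℕ} {P : g → g}
    (h : IsPMap k p P) :
    letI := ofLie k g
    LieSuperalgebra.IsPMap k p
      (fun x : even k g => (⟨P x, mem_ofLie_gr_zero (P x)⟩ : even k g)) :=
  letI := ofLie k g
  ⟨fun x => h.ad_map x, fun c x => Subtype.ext (h.map_smul c x), fun x y => h.map_add x y⟩

theorem isPMap_of_super {g : Type*} [LieRing g] [LieAlgebra k g] {p : ℕ} :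
    letI := ofLie k g
    ∀ {P : even k g → even k g}, LieSuperalgebra.IsPMap k p P →
      IsPMap k p fun x => (P ⟨x, mem_ofLie_gr_zero x⟩ : g) :=
  letI := ofLie k g
  fun h => ⟨fun x => h.ad_map ⟨x, mem_ofLie_gr_zero x⟩,
    fun c x => congrArg Subtype.val (h.map_smul c ⟨x, mem_ofLie_gr_zero x⟩),
    fun x y => h.map_add ⟨x, mem_ofLie_gr_zero x⟩ ⟨y, mem_ofLie_gr_zero y⟩⟩

variable {A : Type*} [CommRing A] [Algebra k A] {R I : Type*}
variable {L : Type*} [LieRing L] [LieAlgebra k L] {p : ℕ} {PL : L → L}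

/-- The restricted structure on `A ⊗ L`, by Jacobson's theorem: `(ad (m ⊗ e)) ^ p` is the adjoint
map of `m ^ p ⊗ e^[p]`. -/
theorem existsUnique_isInducedPMap [Fact p.Prime] [CharP k p] (hPL : IsPMap k p PL)
    (mb : Basis R k A) {m : R → A} (hm : ∀ r, mb r = m r) (e : Basis I k L) :
    ∃! P : A ⊗[k] L → A ⊗[k] L, IsInducedPMap p m e PL P := by
  let := ofLie k (A ⊗[k] L)
  have hb := isParityBasis_ofLie (mb.tensorProduct e)
  have hB : ∀ (a c : A) (x z : L), bracket (k := k) (a ⊗ₜ[k] x) (c ⊗ₜ[k] z) =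
      (a * c) ⊗ₜ[k] (LieAlgebra.ad k L : L →ₗ[k] L →ₗ[k] L) x z := fun _ _ _ _ => rfl
  obtain ⟨P, hP, hPb⟩ := exists_isPMap (p := p) hb (fun x => (m x.1 ^ p) ⊗ₜ PL (e x.2))
    (fun _ _ => mem_ofLie_gr_zero _) (fun x _ => by
      rw [Basis.tensorProduct_apply', hm]
      exact bracket_pow_tmul hB (m x.1) (hPL.ad_map (e x.2)))
  have hbm : ∀ r i, mb.tensorProduct e (r, i) = m r ⊗ₜ e i := fun r i => by
    rw [Basis.tensorProduct_apply, hm]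
  refine ⟨_, ⟨isPMap_of_super hP, fun r i => ?_⟩, fun P' hP' => ?_⟩
  · have := hPb (r, i) (mem_ofLie_gr_zero _) rfl
    simp only [hbm] at this
    exact this
  · have h := IsPMap.ext hb hP'.isPMap.toSuper hP fun x hx _ => by
      refine Subtype.ext ?_
      rw [hPb x hx rfl]
      have := hP'.map_tmul x.1 x.2
      rw [← hbm] at this
      exact this
    funext z
    exact congrArg Subtype.val (congrFun h ⟨z, mem_ofLie_gr_zero z⟩)

/-- The center of the enveloping algebra of `A ⊗ L`, for an algebra `A` with a multiplicative basis
that is indexed by an infinite cancellative monoid. -/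
theorem center_eq_and_freelyGenerates [Fact p.Prime] [CharP k p] [AddCancelCommMonoid R]
    [Infinite R] (mb : Basis R k A) {m : R → A} (hm : ∀ r, mb r = m r)
    (hadd : ∀ r s, m (r + s) = m r * m s) (e : Basis I k L) (J : Set I)
    (hJ : Submodule.span k (e '' J) = (LieAlgebra.center k L).toSubmodule)
    {P : A ⊗[k] L → A ⊗[k] L} (hP : IsPMap k p P) :
    Algebra.adjoin k
        (Set.range (fun s : J × R => UniversalEnvelopingAlgebra.ι k (m s.2 ⊗ₜ[k] e s.1)) ∪
          pCenter k p P) =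
        Subalgebra.center k (UniversalEnvelopingAlgebra k (A ⊗[k] L)) ∧
      FreelyGenerates
        (Sum.elim
          (fun s : J × R => UniversalEnvelopingAlgebra.ι k (m s.2 ⊗ₜ[k] e s.1))
          (fun s : (Jᶜ : Set I) × R =>
            UniversalEnvelopingAlgebra.ι k (m s.2 ⊗ₜ[k] e s.1) ^ p -
              UniversalEnvelopingAlgebra.ι k (P (m s.2 ⊗ₜ[k] e s.1))))
        (Subalgebra.center k (UniversalEnvelopingAlgebra k (A ⊗[k] L))) := by
  let := ofLie k (A ⊗[k] L)
  set b := mb.tensorProduct e with hbdef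
  have hb := isParityBasis_ofLie b
  have hj := isEnveloping_ofLie (k := k) (L := A ⊗[k] L)
  have hbm : ∀ r i, b (r, i) = m r ⊗ₜ e i := fun r i => by
    rw [hbdef, Basis.tensorProduct_apply, hm]
  have hcen : ∀ x ∈ LieAlgebra.center k L, ∀ i ∉ J, e.repr x i = 0 := by
    intro x hx i hi
    have hx' : x ∈ Submodule.span k (e '' J) := by rw [hJ]; exact hx
    by_contra h
    exact hi ((e.mem_span_image.1 hx') (Finsupp.mem_support_iff.2 h))
  have hsep := separating_tensorProduct mb (fun r s => by rw [hm, hm, hm, hadd]) e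
    (β := (LieAlgebra.ad k L : L →ₗ[k] L →ₗ[k] L)) (fun _ _ _ _ => rfl) (J := J) fun x hx =>
      hcen x fun y => by
        have h0 : ((LieAlgebra.ad k L : L →ₗ[k] L →ₗ[k] L).flip x) = 0 := e.ext fun l => hx l
        have := LinearMap.congr_fun h0 y
        exact this
  let jJ : J × R → R × I := fun s => (s.2, s.1)
  let jC : (Jᶜ : Set I) × R → R × I := fun s => (s.2, s.1)
  have hI : IsCentralIndexing b (fun _ => 0) p jJ jC fun s => P (m s.2 ⊗ₜ[k] e s.1) :=
    { injective_left := fun s t h => by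
        simp only [jJ, Prod.mk.injEq] at h
        exact Prod.ext (Subtype.ext h.2) h.1
      injective_right := fun s t h => by
        simp only [jC, Prod.mk.injEq] at h
        exact Prod.ext (Subtype.ext h.2) h.1
      disjoint := fun s t h => by
        simp only [jJ, jC, Prod.mk.injEq] at h
        exact t.1.2 (h.2 ▸ s.1.2)
      par_left := fun _ => rfl
      par_right := fun _ => rfl
      mem_range := fun x _ => by
        by_cases h : x.2 ∈ J
        · exact Or.inl ⟨(⟨x.2, h⟩, x.1), rfl⟩
        · exact Or.inr ⟨(⟨x.2, h⟩, x.1), rfl⟩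
      bracket_left := fun s => by
        have hs : (e s.1 : L) ∈ LieAlgebra.center k L := by
          have : e s.1 ∈ Submodule.span k (e '' J) := Submodule.subset_span ⟨_, s.1.2, rfl⟩
          rw [hJ] at this
          exact this
        refine TensorProduct.ext' fun c z => ?_
        rw [hbm]
        change ⁅m s.2 ⊗ₜ[k] e s.1, c ⊗ₜ[k] z⁆ = 0
        rw [LieAlgebra.ExtendScalars.bracket_tmul, ← lie_skew,
          (LieModule.mem_maxTrivSubmodule k L L _).1 hs z]
        simp
      mem_even := fun _ => mem_ofLie_gr_zero _
      ad_pow := fun s => by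
        rw [hbm]
        exact hP.ad_map _ }
  set j : A ⊗[k] L →ₗ[k] UniversalEnvelopingAlgebra k (A ⊗[k] L) :=
    (UniversalEnvelopingAlgebra.ι k (L := A ⊗[k] L) :
      A ⊗[k] L →ₗ[k] UniversalEnvelopingAlgebra k (A ⊗[k] L)) with hjdef
  have hgen : centralGen b j p jJ jC (fun s => P (m s.2 ⊗ₜ[k] e s.1)) = Sum.elim
      (fun s : J × R => UniversalEnvelopingAlgebra.ι k (m s.2 ⊗ₜ[k] e s.1))
      (fun s : (Jᶜ : Set I) × R =>
        UniversalEnvelopingAlgebra.ι k (m s.2 ⊗ₜ[k] e s.1) ^ p -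
          UniversalEnvelopingAlgebra.ι k (P (m s.2 ⊗ₜ[k] e s.1))) := by
    funext s
    rcases s with s | s
    · simp [centralGen, jJ, hbm, hjdef]
    · simp [centralGen, jC, hbm, hjdef]
  have hrange : Set.range jJ = {x : R × I | x.2 ∈ J} := by
    ext x
    constructor
    · rintro ⟨s, rfl⟩; exact s.1.2
    · exact fun h => ⟨(⟨x.2, h⟩, x.1), rfl⟩
  have hcentral : ∀ s, centralGen b j p jJ jC (fun s => P (m s.2 ⊗ₜ[k] e s.1)) s ∈
      Subalgebra.center k (UniversalEnvelopingAlgebra k (A ⊗[k] L)) := fun s => by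
    rw [Subalgebra.mem_center_iff]
    exact fun u => (commute_centralGen hb hj hI s u).eq.symm
  have hpc : ∀ x : A ⊗[k] L, j x ^ p - j (P x) ∈
      Subalgebra.center k (UniversalEnvelopingAlgebra k (A ⊗[k] L)) := fun x => by
    rw [Subalgebra.mem_center_iff]
    exact fun u => (commute_pow_sub hb hj p (mem_ofLie_gr_zero x) (mem_ofLie_gr_zero (P x))
      (hP.ad_map x) u).eq.symm
  have hfree := freelyGenerates_centralGen hb hj hI (hrange ▸ hsep) _ hcentral fun z hz => by
    refine ⟨z, 0, ⟨?_, fun q => ?_⟩, ⟨⟨0, zero_mem _⟩, fun q => by simp⟩, by simp⟩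
    · have hz' : z ∈ Submodule.span k (Set.range (eword b j)) := span_eword hj ▸ Submodule.mem_top
      clear hz
      induction hz' using Submodule.span_induction with
      | zero => exact ⟨0, zero_mem _⟩
      | add t t' _ _ ht ht' =>
        obtain ⟨n, hn⟩ := ht
        obtain ⟨n', hn'⟩ := ht'
        exact ⟨max n n', add_mem (fil_mono (le_max_left _ _) _ hn)
          (fil_mono (le_max_right _ _) _ hn')⟩
      | smul r t _ ht =>
        obtain ⟨n, hn⟩ := ht
        exact ⟨n, Submodule.smul_mem _ _ hn⟩
      | mem t ht =>
        obtain ⟨l, rfl⟩ := ht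
        have := eword_mem_fil_succ (b := b) (par := fun _ => 0) (j := j) l
        rw [wpar_eq_zero fun _ _ => rfl] at this
        exact ⟨_, this⟩
    · rw [sgn_zero_left, one_smul]
      exact Subalgebra.mem_center_iff.1 hz _
  rw [hgen] at hfree hcentral
  refine ⟨le_antisymm (Algebra.adjoin_le ?_) (hfree.le fun s => ?_), hfree⟩
  · rintro x (⟨s, rfl⟩ | hx)
    · exact hcentral (Sum.inl s)
    · refine (Algebra.adjoin_le ?_ : pCenter k p P ≤ _) hx
      rintro _ ⟨x, rfl⟩
      exact hpc x
  · rcases s with s | s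
    · exact Algebra.subset_adjoin (Or.inl ⟨s, rfl⟩)
    · exact Algebra.subset_adjoin (Or.inr (Algebra.subset_adjoin ⟨_, rfl⟩))

end Lie

namespace LieSuperalgebra

/-! ### The super center -/

section SuperCenter

variable {k : Type*} [Field k] {g : Type*} [AddCommGroup g] [Module k g] [LieSuperalgebra k g]

theorem ι_mem_envGr {a : ZMod 2} {x : g} (hx : x ∈ (gr a : Submodule k g)) :
    ι k g x ∈ envGr k g a :=
  Submodule.subset_span ⟨[⟨a, x, hx⟩], by simp, by simp⟩

theorem pow_mem_envGr {u : Enveloping k g} (hu : u ∈ envGr k g 0) (n : ℕ) :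
    u ^ n ∈ envGr k g 0 := by
  induction n with
  | zero => rw [pow_zero]; exact one_mem_envGr
  | succ n ih => simpa [pow_succ] using mul_mem_envGr ih hu

theorem mem_envCenter_of_commute {z : Enveloping k g} (hz : z ∈ envGr k g 0)
    (h : ∀ u, Commute z u) : z ∈ envCenter k g :=
  ⟨z, ⟨hz, fun b u _ => by rw [zero_mul, uzpow_zero, one_smul, (h u).eq, sub_self]⟩, 0,
    zero_mem _, (add_zero z).symm⟩

variable {ι' : Type*} {b : Basis ι' k g} {par : ι' → ZMod 2}

theorem exists_mem_fil_of_mem_envGr (hb : IsParityBasis b par) {a : ZMod 2} {z : Enveloping k g}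
    (hz : z ∈ envGr k g a) : ∃ n, z ∈ fil b par (ι k g) n a := by
  induction hz using Submodule.span_induction with
  | zero => exact ⟨0, zero_mem _⟩
  | add t t' _ _ ht ht' =>
    obtain ⟨n, hn⟩ := ht
    obtain ⟨n', hn'⟩ := ht'
    exact ⟨max n n', add_mem (fil_mono (le_max_left _ _) _ hn)
      (fil_mono (le_max_right _ _) _ hn')⟩
  | smul r t _ ht =>
    obtain ⟨n, hn⟩ := ht
    exact ⟨n, Submodule.smul_mem _ _ hn⟩
  | mem t ht =>
    obtain ⟨l, rfl, rfl⟩ := ht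
    refine ⟨l.length + 1, ?_⟩
    induction l with
    | nil => exact eword_mem_fil_succ (b := b) (par := par) (j := ι k g) []
    | cons x l ih =>
      rw [List.map_cons, List.map_cons, List.sum_cons, List.prod_cons]
      exact mul_mem_fil (j_mem_fil hb x.2.2) ih (by simp; omega)

theorem superCommutes_of_mem_superCentral (hb : IsParityBasis b par) {a : ZMod 2}
    {z : Enveloping k g} (hz : z ∈ superCentral k g a) : SuperCommutes b par (ι k g) a z := by
  refine ⟨exists_mem_fil_of_mem_envGr hb hz.1, fun q => ?_⟩
  have h := sub_eq_zero.1 (hz.2 _ _ (ι_mem_envGr (hb.mem q)))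
  rw [h, units_smul_eq_sgn k, smul_smul, sgn_comm, sgn_mul_self, one_smul]

end SuperCenter

/-! ### The current superalgebra and the loop superalgebra -/

section HomogeneousBasis

variable {k : Type*} [Field k] {L : Type*} [AddCommGroup L] [Module k L] [LieSuperalgebra k L]
variable {I₀ I₁ : Type*}

/-- The homogeneous basis of `L` formed by bases of its even and of its odd part. -/
def homogeneousBasis (e : Basis I₀ k (even k L)) (e₁ : Basis I₁ k (gr 1 : Submodule k L)) :
    Basis (I₀ ⊕ I₁) k L :=
  (e.prod e₁).map (Submodule.prodEquivOfIsCompl _ _ isCompl)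

@[simp]
theorem homogeneousBasis_inl (e : Basis I₀ k (even k L)) (e₁ : Basis I₁ k (gr 1 : Submodule k L))
    (i : I₀) : homogeneousBasis e e₁ (Sum.inl i) = e i := by
  simp [homogeneousBasis]

@[simp]
theorem homogeneousBasis_inr (e : Basis I₀ k (even k L)) (e₁ : Basis I₁ k (gr 1 : Submodule k L))
    (i : I₁) : homogeneousBasis e e₁ (Sum.inr i) = e₁ i := by
  simp [homogeneousBasis]

/-- The parity of the members of a homogeneous basis. -/
def indexPar : I₀ ⊕ I₁ → ZMod 2 := Sum.elim (fun _ => 0) (fun _ => 1)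

theorem homogeneousBasis_mem (e : Basis I₀ k (even k L)) (e₁ : Basis I₁ k (gr 1 : Submodule k L))
    (i : I₀ ⊕ I₁) : homogeneousBasis e e₁ i ∈ (gr (indexPar i) : Submodule k L) := by
  rcases i with i | i
  · rw [homogeneousBasis_inl]; exact (e i).2
  · rw [homogeneousBasis_inr]; exact (e₁ i).2

variable {A : Type*} [CommRing A] [Algebra k A] {R : Type*}

theorem isParityBasis_tensorProduct (h2 : (2 : k) ≠ 0) (mb : Basis R k A)
    (e : Basis I₀ k (even k L)) (e₁ : Basis I₁ k (gr 1 : Submodule k L)) :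
    IsParityBasis (mb.tensorProduct (homogeneousBasis e e₁)) fun x => indexPar x.2 where
  mem x := by
    rw [Basis.tensorProduct_apply']
    exact tmul_mem_tensorGr _ (homogeneousBasis_mem e e₁ x.2)
  two_ne_zero _ _ := h2
  bracket_self x hx := by
    have h := bracket_skew (k := k) hx hx
    rw [mul_zero, uzpow_zero, one_smul] at h
    have h' : (2 : k) • bracket (k := k) x x = 0 := by
      rw [two_smul]
      nth_rewrite 1 [h]
      exact neg_add_cancel _
    exact (smul_eq_zero.1 h').resolve_left h2

variable {p : ℕ} {PL : even k L → even k L}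

theorem two_ne_zero_of_charP [Fact p.Prime] [CharP k p] (hp2 : p ≠ 2) : (2 : k) ≠ 0 := fun h => by
  have := (CharP.cast_eq_zero_iff k p 2).1 (by exact_mod_cast h)
  exact hp2 ((Nat.prime_dvd_prime_iff_eq Fact.out Nat.prime_two).1 this)

/-- The restricted structure on the superalgebra `A ⊗ L`, by Jacobson's theorem. -/
theorem existsUnique_isInducedPMap [Fact p.Prime] [CharP k p] (hp2 : p ≠ 2) (hPL : IsPMap k p PL)
    (mb : Basis R k A) {m : R → A} (hm : ∀ r, mb r = m r) (e : Basis I₀ k (even k L))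
    (e₁ : Basis I₁ k (gr 1 : Submodule k L)) :
    ∃! P : even k (A ⊗[k] L) → even k (A ⊗[k] L), IsInducedPMap p m e PL P := by
  have hb := isParityBasis_tensorProduct (two_ne_zero_of_charP (k := k) hp2) mb e e₁
  have hbm : ∀ r i, mb.tensorProduct (homogeneousBasis e e₁) (r, Sum.inl i) =
      m r ⊗ₜ (e i : L) := fun r i => by
    rw [Basis.tensorProduct_apply, hm, homogeneousBasis_inl]
  obtain ⟨P, hP, hPb⟩ := exists_isPMap (p := p) hb
    (fun x => Sum.elim (fun i => (m x.1 ^ p) ⊗ₜ[k] (PL (e i) : L)) (fun _ => 0) x.2)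
    (by
      rintro ⟨r, i | i⟩ h
      · exact tmul_mem_tensorGr _ (PL (e i)).2
      · exact zero_mem _)
    (by
      rintro ⟨r, i | i⟩ h
      · rw [hbm]
        exact bracket_pow_tmul tensorBracket_tmul (m r) (hPL.ad_map (e i))
      · exact absurd h one_ne_zero)
  have hPm : ∀ r i, P (evenTmul (m r) (e i)) = evenTmul (m r ^ p) (PL (e i)) := fun r i => by
    refine Subtype.ext ?_
    have := hPb (r, Sum.inl i) ((hbm r i).symm ▸ (evenTmul (m r) (e i)).2) rfl
    simp only [hbm] at this
    exact this
  refine ⟨P, ⟨hP, hPm⟩, fun P' hP' => IsPMap.ext hb hP'.isPMap hP ?_⟩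
  rintro ⟨r, i | i⟩ hx h
  · have e' : (⟨_, hx⟩ : even k (A ⊗[k] L)) = evenTmul (m r) (e i) := Subtype.ext (hbm r i)
    rw [e', hPm, hP'.map_tmul]
  · exact absurd h one_ne_zero

/-- The super center of the enveloping superalgebra of `A ⊗ L`, for an algebra `A` with a
multiplicative basis that is indexed by an infinite cancellative monoid. -/
theorem center_eq_and_freelyGenerates [Fact p.Prime] [CharP k p] (hp2 : p ≠ 2)
    [AddCancelCommMonoid R] [Infinite R] (mb : Basis R k A) {m : R → A} (hm : ∀ r, mb r = m r)
    (hadd : ∀ r s, m (r + s) = m r * m s) (e : Basis I₀ k (even k L))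
    (e₁ : Basis I₁ k (gr 1 : Submodule k L)) (J : Set I₀)
    (hJ : Submodule.span k ((fun i => (e i : L)) '' J) = center k L)
    {P : even k (A ⊗[k] L) → even k (A ⊗[k] L)} (hP : IsPMap k p P) :
    Algebra.adjoin k
        (Set.range (fun s : J × R => ι k (A ⊗[k] L) (m s.2 ⊗ₜ (e s.1 : L))) ∪ pCenter k p P) =
        envCenter k (A ⊗[k] L) ∧
      FreelyGenerates
        (Sum.elim
          (fun s : J × R => ι k (A ⊗[k] L) (m s.2 ⊗ₜ (e s.1 : L)))
          (fun s : (Jᶜ : Set I₀) × R =>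
            ι k (A ⊗[k] L) (m s.2 ⊗ₜ (e s.1 : L)) ^ p -
              ι k (A ⊗[k] L) (P (evenTmul (m s.2) (e s.1)))))
        (envCenter k (A ⊗[k] L)) := by
  set b := mb.tensorProduct (homogeneousBasis e e₁) with hbdef
  have hb : IsParityBasis b fun x => indexPar x.2 :=
    isParityBasis_tensorProduct (two_ne_zero_of_charP (k := k) hp2) mb e e₁
  have hj := isEnveloping_ι k (A ⊗[k] L)
  have hbm : ∀ r i, b (r, Sum.inl i) = m r ⊗ₜ (e i : L) := fun r i => by
    rw [hbdef, Basis.tensorProduct_apply, hm, homogeneousBasis_inl]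
  have himage : (fun i => (e i : L)) '' J = homogeneousBasis e e₁ '' (Sum.inl '' J) := by
    rw [Set.image_image]
    exact Set.image_congr fun i _ => (homogeneousBasis_inl e e₁ i).symm
  have hcen : ∀ x ∈ center k L, ∀ i ∉ (Sum.inl '' J : Set (I₀ ⊕ I₁)),
      (homogeneousBasis e e₁).repr x i = 0 := by
    intro x hx i hi
    rw [← hJ, himage] at hx
    by_contra h
    exact hi (((homogeneousBasis e e₁).mem_span_image.1 hx) (Finsupp.mem_support_iff.2 h))
  -- an element killed by all `[e_l, -]` is central, as the bracket is symmetric up to signs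
  have hflip : ∀ x : L, (∀ l, bracket (k := k) (homogeneousBasis e e₁ l) x = 0) →
      x ∈ center k L := by
    intro x hx
    have hx' : ∀ z : L, bracket (k := k) z x = 0 := LinearMap.congr_fun
      ((homogeneousBasis e e₁).ext hx : (bracket (k := k) (L := L)).flip x = 0)
    obtain ⟨u, hu, v, hv, rfl⟩ := Submodule.mem_sup.1
      ((isCompl (k := k) (L := L)).sup_eq_top ▸ Submodule.mem_top (x := x))
    have key : ∀ {a : ZMod 2} {z : L}, z ∈ (gr a : Submodule k L) →
        bracket (k := k) z u = 0 ∧ bracket (k := k) z v = 0 := by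
      intro a z hz
      have h := hx' z
      rw [map_add] at h
      have hu' := bracket_mem hz hu
      have hv' := bracket_mem hz hv
      have hne : a + 0 ≠ a + 1 := fun h => zero_ne_one (add_left_cancel h)
      have h0 : bracket (k := k) z u = 0 := by
        refine Submodule.disjoint_def.1 (disjoint_gr hne) _ hu' ?_
        rw [eq_neg_of_add_eq_zero_left h]
        exact neg_mem hv'
      exact ⟨h0, by rwa [h0, zero_add] at h⟩
    refine LinearMap.mem_ker.2 ((homogeneousBasis e e₁).ext fun l => ?_)
    have hl := homogeneousBasis_mem e e₁ l
    change bracket (k := k) (u + v) _ = 0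
    rw [map_add, LinearMap.add_apply, bracket_skew hu hl, bracket_skew hv hl, (key hl).1,
      (key hl).2]
    simp
  have hsep := separating_tensorProduct mb (fun r s => by rw [hm, hm, hm, hadd])
    (homogeneousBasis e e₁) (tensorBracket_tmul (k := k) (A := A) (L := L))
    (J := Sum.inl '' J) fun x hx => hcen x (hflip x hx)
  let jJ : J × R → R × (I₀ ⊕ I₁) := fun s => (s.2, Sum.inl s.1)
  let jC : (Jᶜ : Set I₀) × R → R × (I₀ ⊕ I₁) := fun s => (s.2, Sum.inl s.1)
  have hI : IsCentralIndexing b (fun x => indexPar x.2) p jJ jC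
      fun s => (P (evenTmul (m s.2) (e s.1)) : A ⊗[k] L) :=
    { injective_left := fun s t h => by
        simp only [jJ, Prod.mk.injEq, Sum.inl.injEq] at h
        exact Prod.ext (Subtype.ext h.2) h.1
      injective_right := fun s t h => by
        simp only [jC, Prod.mk.injEq, Sum.inl.injEq] at h
        exact Prod.ext (Subtype.ext h.2) h.1
      disjoint := fun s t h => by
        simp only [jJ, jC, Prod.mk.injEq, Sum.inl.injEq] at h
        exact t.1.2 (h.2 ▸ s.1.2)
      par_left := fun _ => rfl
      par_right := fun _ => rfl
      mem_range := by
        rintro ⟨r, i | i⟩ h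
        · by_cases h : i ∈ J
          · exact Or.inl ⟨(⟨i, h⟩, r), rfl⟩
          · exact Or.inr ⟨(⟨i, h⟩, r), rfl⟩
        · exact absurd h one_ne_zero
      bracket_left := fun s => by
        have hs : (e s.1 : L) ∈ center k L := hJ ▸ Submodule.subset_span ⟨_, s.1.2, rfl⟩
        refine TensorProduct.ext' fun c z => ?_
        rw [hbm]
        change (m s.2 * c) ⊗ₜ[k] bracket (k := k) (e s.1 : L) z = 0
        rw [LinearMap.congr_fun (LinearMap.mem_ker.1 hs) z, LinearMap.zero_apply,
          TensorProduct.tmul_zero]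
      mem_even := fun s => (P (evenTmul (m s.2) (e s.1))).2
      ad_pow := fun s => by
        rw [hbm]
        exact hP.ad_map _ }
  have hgen : centralGen b (ι k (A ⊗[k] L)) p jJ jC
        (fun s => (P (evenTmul (m s.2) (e s.1)) : A ⊗[k] L)) = Sum.elim
      (fun s : J × R => ι k (A ⊗[k] L) (m s.2 ⊗ₜ (e s.1 : L)))
      (fun s : (Jᶜ : Set I₀) × R =>
        ι k (A ⊗[k] L) (m s.2 ⊗ₜ (e s.1 : L)) ^ p -
          ι k (A ⊗[k] L) (P (evenTmul (m s.2) (e s.1)))) := by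
    funext s
    rcases s with s | s
    · simp [centralGen, jJ, hbm]
    · simp [centralGen, jC, hbm]
  have hrange : Set.range jJ = {x : R × (I₀ ⊕ I₁) | x.2 ∈ (Sum.inl '' J : Set (I₀ ⊕ I₁))} := by
    ext x
    constructor
    · rintro ⟨s, rfl⟩; exact ⟨s.1, s.1.2, rfl⟩
    · rintro ⟨i, hi, hx⟩; exact ⟨(⟨i, hi⟩, x.1), Prod.ext rfl hx⟩
  have hpc : ∀ x : even k (A ⊗[k] L), ι k (A ⊗[k] L) (x : A ⊗[k] L) ^ p -
      ι k (A ⊗[k] L) (P x : A ⊗[k] L) ∈ envCenter k (A ⊗[k] L) := fun x =>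
    mem_envCenter_of_commute
      (sub_mem (pow_mem_envGr (ι_mem_envGr x.2) p) (ι_mem_envGr (P x).2))
      (commute_pow_sub hb hj p x.2 (P x).2 (hP.ad_map x))
  have hcentral : ∀ s, centralGen b (ι k (A ⊗[k] L)) p jJ jC
      (fun s => (P (evenTmul (m s.2) (e s.1)) : A ⊗[k] L)) s ∈ envCenter k (A ⊗[k] L) := by
    intro s
    refine mem_envCenter_of_commute ?_ (commute_centralGen hb hj hI s)
    rw [hgen]
    rcases s with s | s
    · exact ι_mem_envGr (evenTmul (m s.2) (e s.1)).2
    · exact sub_mem (pow_mem_envGr (ι_mem_envGr (evenTmul (m s.2) (e s.1)).2) p)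
        (ι_mem_envGr (P (evenTmul (m s.2) (e s.1))).2)
  have hfree := freelyGenerates_centralGen hb hj hI (hrange ▸ hsep) _ hcentral fun z hz => by
    obtain ⟨z₀, h₀, z₁, h₁, rfl⟩ := hz
    exact ⟨z₀, z₁, superCommutes_of_mem_superCentral hb h₀,
      superCommutes_of_mem_superCentral hb h₁, rfl⟩
  rw [hgen] at hfree hcentral
  refine ⟨le_antisymm (Algebra.adjoin_le ?_) (hfree.le fun s => ?_), hfree⟩
  · rintro x (⟨s, rfl⟩ | hx)
    · exact hcentral (Sum.inl s)
    · refine (Algebra.adjoin_le ?_ : pCenter k p P ≤ _) hx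
      rintro _ ⟨x, rfl⟩
      exact hpc x
  · rcases s with s | s
    · exact Algebra.subset_adjoin (Or.inl ⟨s, rfl⟩)
    · exact Algebra.subset_adjoin (Or.inr (Algebra.subset_adjoin ⟨evenTmul (m s.2) (e s.1), rfl⟩))

end HomogeneousBasis

end LieSuperalgebra

end LieCenter

end

open LieCenter in
theorem theorem1p2 {k : Type*} [Field k] [IsAlgClosed k] (p : ℕ) [Fact p.Prime] [CharP k p] :
    -- Lie algebras
    (∀ {L : Type*} [LieRing L] [LieAlgebra k L] (PL : L → L) (_ : IsPMap k p PL)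
      {I : Type*} (e : Module.Basis I k L) (J : Set I)
      (_ : Submodule.span k (e '' J) = (LieAlgebra.center k L).toSubmodule),
      -- the current algebra `L[x]`
      ((∃! P : k[X] ⊗[k] L → k[X] ⊗[k] L,
          IsInducedPMap p (fun r : ℕ => (Polynomial.X ^ r : k[X])) e PL P) ∧
        ∀ P : k[X] ⊗[k] L → k[X] ⊗[k] L,
          IsInducedPMap p (fun r : ℕ => (Polynomial.X ^ r : k[X])) e PL P →
          Algebra.adjoin k
              (Set.range (fun s : J × ℕ => UniversalEnvelopingAlgebra.ι k ((Polynomial.X ^ s.2 : k[X]) ⊗ₜ e s.1)) ∪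
                pCenter k p P) =
              (Subalgebra.center k (UniversalEnvelopingAlgebra k (k[X] ⊗[k] L))) ∧
            FreelyGenerates
              (Sum.elim
                (fun s : J × ℕ => UniversalEnvelopingAlgebra.ι k ((Polynomial.X ^ s.2 : k[X]) ⊗ₜ e s.1))
                (fun s : (Jᶜ : Set I) × ℕ =>
                  UniversalEnvelopingAlgebra.ι k ((Polynomial.X ^ s.2 : k[X]) ⊗ₜ e s.1) ^ p -
                    UniversalEnvelopingAlgebra.ι k (P ((Polynomial.X ^ s.2 : k[X]) ⊗ₜ e s.1))))
              (Subalgebra.center k (UniversalEnvelopingAlgebra k (k[X] ⊗[k] L)))) ∧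
      -- the loop algebra `L(x)`
      ((∃! P : k[T;T⁻¹] ⊗[k] L → k[T;T⁻¹] ⊗[k] L,
          IsInducedPMap p (fun r : ℤ => (LaurentPolynomial.T r : k[T;T⁻¹])) e PL P) ∧
        ∀ P : k[T;T⁻¹] ⊗[k] L → k[T;T⁻¹] ⊗[k] L,
          IsInducedPMap p (fun r : ℤ => (LaurentPolynomial.T r : k[T;T⁻¹])) e PL P →
          Algebra.adjoin k
              (Set.range (fun s : J × ℤ => UniversalEnvelopingAlgebra.ι k ((LaurentPolynomial.T s.2 : k[T;T⁻¹]) ⊗ₜ e s.1)) ∪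
                pCenter k p P) =
              (Subalgebra.center k (UniversalEnvelopingAlgebra k (k[T;T⁻¹] ⊗[k] L))) ∧
            FreelyGenerates
              (Sum.elim
                (fun s : J × ℤ => UniversalEnvelopingAlgebra.ι k ((LaurentPolynomial.T s.2 : k[T;T⁻¹]) ⊗ₜ e s.1))
                (fun s : (Jᶜ : Set I) × ℤ =>
                  UniversalEnvelopingAlgebra.ι k ((LaurentPolynomial.T s.2 : k[T;T⁻¹]) ⊗ₜ e s.1) ^ p -
                    UniversalEnvelopingAlgebra.ι k (P ((LaurentPolynomial.T s.2 : k[T;T⁻¹]) ⊗ₜ e s.1))))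
              (Subalgebra.center k (UniversalEnvelopingAlgebra k (k[T;T⁻¹] ⊗[k] L))))) ∧
    -- Lie superalgebras
    (p ≠ 2 → ∀ {L : Type*} [AddCommGroup L] [Module k L] [LieSuperalgebra k L]
      (PL : LieSuperalgebra.even k L → LieSuperalgebra.even k L)
      (_ : LieSuperalgebra.IsPMap k p PL)
      {I₀ I₁ : Type*} (e : Module.Basis I₀ k (LieSuperalgebra.even k L))
      (_ : Module.Basis I₁ k (LieSuperalgebra.gr 1 : Submodule k L)) (J : Set I₀)
      (_ : Submodule.span k ((fun i => (e i : L)) '' J) = LieSuperalgebra.center k L),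
      -- the current superalgebra `L[x]`
      ((∃! P : LieSuperalgebra.even k (k[X] ⊗[k] L) → LieSuperalgebra.even k (k[X] ⊗[k] L),
          LieSuperalgebra.IsInducedPMap p (fun r : ℕ => (Polynomial.X ^ r : k[X])) e PL P) ∧
        ∀ P : LieSuperalgebra.even k (k[X] ⊗[k] L) → LieSuperalgebra.even k (k[X] ⊗[k] L),
          LieSuperalgebra.IsInducedPMap p (fun r : ℕ => (Polynomial.X ^ r : k[X])) e PL P →
          Algebra.adjoin k
              (Set.range (fun s : J × ℕ => LieSuperalgebra.ι k (k[X] ⊗[k] L) ((Polynomial.X ^ s.2 : k[X]) ⊗ₜ (e s.1 : L))) ∪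
                LieSuperalgebra.pCenter k p P) =
              (LieSuperalgebra.envCenter k (k[X] ⊗[k] L)) ∧
            FreelyGenerates
              (Sum.elim
                (fun s : J × ℕ => LieSuperalgebra.ι k (k[X] ⊗[k] L) ((Polynomial.X ^ s.2 : k[X]) ⊗ₜ (e s.1 : L)))
                (fun s : (Jᶜ : Set I₀) × ℕ =>
                  LieSuperalgebra.ι k (k[X] ⊗[k] L) ((Polynomial.X ^ s.2 : k[X]) ⊗ₜ (e s.1 : L)) ^ p -
                    LieSuperalgebra.ι k (k[X] ⊗[k] L) (P (LieSuperalgebra.evenTmul (Polynomial.X ^ s.2 : k[X]) (e s.1)))))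
              (LieSuperalgebra.envCenter k (k[X] ⊗[k] L))) ∧
      -- the loop superalgebra `L(x)`
      ((∃! P : LieSuperalgebra.even k (k[T;T⁻¹] ⊗[k] L) → LieSuperalgebra.even k (k[T;T⁻¹] ⊗[k] L),
          LieSuperalgebra.IsInducedPMap p (fun r : ℤ => (LaurentPolynomial.T r : k[T;T⁻¹])) e PL P) ∧
        ∀ P : LieSuperalgebra.even k (k[T;T⁻¹] ⊗[k] L) → LieSuperalgebra.even k (k[T;T⁻¹] ⊗[k] L),
          LieSuperalgebra.IsInducedPMap p (fun r : ℤ => (LaurentPolynomial.T r : k[T;T⁻¹])) e PL P →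
          Algebra.adjoin k
              (Set.range (fun s : J × ℤ => LieSuperalgebra.ι k (k[T;T⁻¹] ⊗[k] L) ((LaurentPolynomial.T s.2 : k[T;T⁻¹]) ⊗ₜ (e s.1 : L))) ∪
                LieSuperalgebra.pCenter k p P) =
              (LieSuperalgebra.envCenter k (k[T;T⁻¹] ⊗[k] L)) ∧
            FreelyGenerates
              (Sum.elim
                (fun s : J × ℤ => LieSuperalgebra.ι k (k[T;T⁻¹] ⊗[k] L) ((LaurentPolynomial.T s.2 : k[T;T⁻¹]) ⊗ₜ (e s.1 : L)))
                (fun s : (Jᶜ : Set I₀) × ℤ =>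
                  LieSuperalgebra.ι k (k[T;T⁻¹] ⊗[k] L) ((LaurentPolynomial.T s.2 : k[T;T⁻¹]) ⊗ₜ (e s.1 : L)) ^ p -
                    LieSuperalgebra.ι k (k[T;T⁻¹] ⊗[k] L) (P (LieSuperalgebra.evenTmul (LaurentPolynomial.T s.2 : k[T;T⁻¹]) (e s.1)))))
              (LieSuperalgebra.envCenter k (k[T;T⁻¹] ⊗[k] L)))) := by
  have hX : ∀ r, Polynomial.basisMonomials k r = (Polynomial.X ^ r : k[X]) := fun r => by
    rw [Polynomial.coe_basisMonomials]
    exact Polynomial.monomial_one_right_eq_X_pow r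
  have hT : ∀ r, AddMonoidAlgebra.basis ℤ k r = (LaurentPolynomial.T r : k[T;T⁻¹]) := fun _ => rfl
  constructor
  · intro L _ _ PL hPL I e J hJ
    exact ⟨⟨existsUnique_isInducedPMap hPL _ hX e, fun P hP =>
        center_eq_and_freelyGenerates _ hX (pow_add _) e J hJ hP.isPMap⟩,
      existsUnique_isInducedPMap hPL _ hT e, fun P hP =>
        center_eq_and_freelyGenerates _ hT LaurentPolynomial.T_add e J hJ hP.isPMap⟩
  · intro hp2 L _ _ _ PL hPL I₀ I₁ e e₁ J hJ
    exact ⟨⟨LieSuperalgebra.existsUnique_isInducedPMap hp2 hPL _ hX e e₁, fun P hP =>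
        LieSuperalgebra.center_eq_and_freelyGenerates hp2 _ hX (pow_add _) e e₁ J hJ hP.isPMap⟩,
      LieSuperalgebra.existsUnique_isInducedPMap hp2 hPL _ hT e e₁, fun P hP =>
        LieSuperalgebra.center_eq_and_freelyGenerates hp2 _ hT LaurentPolynomial.T_add e e₁ J hJ
          hP.isPMap⟩
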